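/- Let $P\in\mathbb{C}[t_1,t_2]$ be irreducible, put $P^*(t_1):=P(t_1,0)$, and assume that $P^*$ has no zero on the unit circle $S^1$. Let $$m(P)=\int_0^1\!\int_0^1\log|P(e^{2\pi i\alpha_1},e^{2\pi i\alpha_2})|\,d\alpha_1\,d\alpha_2$$ be the logarithmic Mahler measure, $B\subset\mathbb{C}$ the closed unit disc, $T^2=S^1\times S^1$, $Z^*(P)=\{(t_1,t_2)\in(\mathbb{C}^*)^2: P(t_1,t_2)=0\}$, and $X:=Z^*(P)^{\mathrm{reg}}$ its regular locus. Let $A$ be the union of the one-dimensional connected components of $(S^1\times B)\cap Z^*(P)$, and assume $A\subset X$. Orient the arcs of $A$ by increasing argument of $t_1\in S^1$, and let $R_P$ be the set of points of $A$ at which the number of arcs of $A$ running into the point differs from the number of arcs of $A$ running out of it. On $(\mathbb{C}^*)^2$ let $$C_2=C_2(\log|t_1|,\log|t_2|)=\tfrac12\Bigl(\log|t_1|\tfrac{dt_2}{t_2}-\log|t_2|\tfrac{dt_1}{t_1}-\log|t_1|\tfrac{d\bar t_2}{\bar t_2}+\log|t_2|\tfrac{d\bar t_1}{\bar t_1}\Bigr).$$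 For $\Lambda\subset\mathbb{C}$ write $\Lambda(n)=(2\pi i)^n\Lambda$; homology and cohomology are singular. Then: 1. $R_P\subset T^2$. 2. By integration, $C_2$ defines a class $[C_2]\in H^1(X,R_P;\mathbb{R}(1))$: there is exactly one class in this group that is represented by a cocycle of the pair $(X,R_P)$ whose value on every continuously differentiable singular $1$-simplex $\sigma$ of $X$ is $\int_\sigma C_2$. 3. There are finitely many closed paths $\chi_\mu$ and finitely many non-closed paths $\psi_\nu$ in $X$, along all of which the argument of $t_1\in S^1$ is strictly increasing, which together have image $A$ and run through $A$ exactly once (up to finitely many coincidences of points), the set of end points of the $\psi_\nu$ being $R_P$, such that the class $$[A]:=\sum_\mu[\chi_\mu]+\sum_\nu[\psi_\nu]\in H_1(X,R_P;\mathbb{Z}),\qquad [A]\otimes(2\pi i)^{-1}\in H_1(X,R_P;\mathbb{Z}(-1)),$$ satisfies $$m(P)-m(P^*)=\bigl\langle [C_2],\,[A]\otimes(2\pi i)^{-1}\bigr\rangle,$$ where $\langle\cdot,\cdot\rangle$ is the natural (Kronecker) pairing of relative cohomology and homology. -/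

import Mathlib

open scoped Topology

noncomputable section

namespace MahlerSymbol

/-! ### Singular simplices, chains and cochains -/

/-- Singular `n`-simplices of `X`. -/
abbrev Simplex (n : ℕ) (X : Type*) [TopologicalSpace X] : Type _ :=
  C(stdSimplex ℝ (Fin (n + 1)), X)

/-- The `i`-th face of a singular simplex (omit the `i`-th vertex). -/
def face {X : Type*} [TopologicalSpace X] {n : ℕ} (i : Fin (n + 2)) (σ : Simplex (n + 1) X) :
    Simplex n X :=
  σ.comp ⟨stdSimplex.map i.succAbove, stdSimplex.continuous_map _⟩

/-- Singular `n`-chains of `X` with coefficients in `G`. -/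
abbrev Chain (n : ℕ) (X : Type*) [TopologicalSpace X] (G : Type*) [AddCommGroup G] : Type _ :=
  Simplex n X →₀ G

/-- The singular boundary `∂ (g • σ) = ∑ i, (-1) ^ i g • (σ ∘ dᵢ)`. -/
def boundary (n : ℕ) (X : Type*) [TopologicalSpace X] (G : Type*) [AddCommGroup G] :
    Chain (n + 1) X G →+ Chain n X G :=
  Finsupp.liftAddHom fun σ =>
    ∑ i : Fin (n + 2), ((-1 : ℤ) ^ (i : ℕ)) • Finsupp.singleAddHom (face i σ)

/-- Chains of `X` all of whose simplices lie in the subspace `R`. -/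
def chainsIn (n : ℕ) {X : Type*} [TopologicalSpace X] (R : Set X) (G : Type*) [AddCommGroup G] :
    AddSubgroup (Chain n X G) where
  carrier := {c | ∀ σ : Simplex n X, ¬ Set.range σ ⊆ R → c σ = 0}
  zero_mem' := fun _ _ => rfl
  add_mem' := fun {a b} ha hb σ h => by
    rw [Finsupp.add_apply, ha σ h, hb σ h, add_zero]
  neg_mem' := fun {a} ha σ h => by
    rw [Finsupp.neg_apply, ha σ h, neg_zero]

/-- Relative `1`-cycles of the pair `(X, R)`. -/
def relCycles {X : Type*} [TopologicalSpace X] (R : Set X) (G : Type*) [AddCommGroup G] :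
    AddSubgroup (Chain 1 X G) :=
  (chainsIn 0 R G).comap (boundary 0 X G)

/-- Relative `1`-boundaries of the pair `(X, R)`: `∂ C₂(X) + C₁(R)`. -/
def relBoundaries {X : Type*} [TopologicalSpace X] (R : Set X) (G : Type*) [AddCommGroup G] :
    AddSubgroup (Chain 1 X G) :=
  (boundary 1 X G).range ⊔ chainsIn 1 R G

/-- The relative singular homology group `H₁(X, R; G)`. -/
abbrev RelH1 {X : Type*} [TopologicalSpace X] (R : Set X) (G : Type*) [AddCommGroup G] : Type _ :=
  relCycles R G ⧸ (relBoundaries R G).addSubgroupOf (relCycles R G)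

/-- Singular `n`-cochains of `X` with coefficients in `M`. -/
abbrev Cochain (n : ℕ) (X : Type*) [TopologicalSpace X] (M : Type*) [AddCommGroup M] : Type _ :=
  Simplex n X → M

/-- The singular coboundary `(δ f) σ = ∑ i, (-1) ^ i f (σ ∘ dᵢ)`. -/
def coboundary (n : ℕ) (X : Type*) [TopologicalSpace X] (M : Type*) [AddCommGroup M] :
    Cochain n X M →+ Cochain (n + 1) X M where
  toFun f σ := ∑ i : Fin (n + 2), ((-1 : ℤ) ^ (i : ℕ)) • f (face i σ)
  map_zero' := by
    funext σ
    simp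
  map_add' f g := by
    funext σ
    simp [Finset.sum_add_distrib]

/-- Cochains of `X` vanishing on all simplices in `R`, i.e. cochains of the pair `(X, R)`. -/
def relCochains (n : ℕ) {X : Type*} [TopologicalSpace X] (R : Set X) (M : Type*)
    [AddCommGroup M] : AddSubgroup (Cochain n X M) where
  carrier := {f | ∀ σ : Simplex n X, Set.range σ ⊆ R → f σ = 0}
  zero_mem' := fun _ _ => rfl
  add_mem' := fun {a b} ha hb σ h => by
    rw [Pi.add_apply, ha σ h, hb σ h, add_zero]
  neg_mem' := fun {a} ha σ h => by
    rw [Pi.neg_apply, ha σ h, neg_zero]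

/-- Relative `1`-cocycles of the pair `(X, R)`. -/
def relCocycles {X : Type*} [TopologicalSpace X] (R : Set X) (M : Type*) [AddCommGroup M] :
    AddSubgroup (Cochain 1 X M) :=
  relCochains 1 R M ⊓ (coboundary 1 X M).ker

/-- Relative `1`-coboundaries of the pair `(X, R)`. -/
def relCoboundaries {X : Type*} [TopologicalSpace X] (R : Set X) (M : Type*) [AddCommGroup M] :
    AddSubgroup (Cochain 1 X M) :=
  (relCochains 0 R M).map (coboundary 0 X M)

/-- The relative singular cohomology group `H¹(X, R; M)`. -/
abbrev RelCoH1 {X : Type*} [TopologicalSpace X] (R : Set X) (M : Type*) [AddCommGroup M] :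
    Type _ :=
  relCocycles R M ⧸ (relCoboundaries R M).addSubgroupOf (relCocycles R M)

/-! ### The Kronecker pairing -/

/-- Evaluation `⟨f, ∑ g • σ⟩ = ∑ f(σ) g` of cochains on chains,
for coefficients in additive subgroups of `ℂ`. -/
def evalChain (n : ℕ) (X : Type*) [TopologicalSpace X] (M N : AddSubgroup ℂ) :
    Cochain n X M →+ Chain n X N →+ ℂ where
  toFun f := Finsupp.liftAddHom fun σ => (AddMonoidHom.mulLeft (f σ : ℂ)).comp N.subtype
  map_zero' := by
    ext σ g
    simp
  map_add' f g := by
    ext σ x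
    simp [add_mul]

theorem evalChain_single {n : ℕ} {X : Type*} [TopologicalSpace X] {M N : AddSubgroup ℂ}
    (f : Cochain n X M) (σ : Simplex n X) (g : N) :
    evalChain n X M N f (Finsupp.single σ g) = (f σ : ℂ) * g := by
  simp [evalChain]

theorem evalChain_coboundary {n : ℕ} {X : Type*} [TopologicalSpace X] {M N : AddSubgroup ℂ}
    (f : Cochain n X M) (c : Chain (n + 1) X N) :
    evalChain (n + 1) X M N (coboundary n X M f) c =
      evalChain n X M N f (boundary n X N c) := by
  induction c using Finsupp.induction_linear with
  | zero => simp
  | add a b ha hb => rw [map_add, map_add, map_add, ha, hb]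
  | single σ g =>
    rw [evalChain_single]
    simp only [boundary, coboundary, Finsupp.liftAddHom_apply_single,
      AddMonoidHom.finsetSum_apply, map_sum]
    simp [evalChain_single, Finset.sum_mul, mul_assoc, mul_left_comm]

theorem evalChain_eq_zero {n : ℕ} {X : Type*} [TopologicalSpace X] {R : Set X}
    {M N : AddSubgroup ℂ} {f : Cochain n X M} (hf : f ∈ relCochains n R M)
    {c : Chain n X N} (hc : c ∈ chainsIn n R N) : evalChain n X M N f c = 0 := by
  simp only [evalChain, AddMonoidHom.coe_mk, ZeroHom.coe_mk, Finsupp.liftAddHom_apply]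
  refine Finset.sum_eq_zero fun σ hσ => ?_
  have h : Set.range σ ⊆ R := by
    by_contra h
    exact (Finsupp.mem_support_iff.1 hσ) (hc σ h)
  simp [hf σ h]

/-- The Kronecker pairing `H¹(X, R; M) × H₁(X, R; N) → ℂ`, `M, N ⊆ ℂ`. -/
def kronecker {X : Type*} [TopologicalSpace X] (R : Set X) (M N : AddSubgroup ℂ) :
    RelCoH1 R M →+ RelH1 R N →+ ℂ :=
  QuotientAddGroup.lift _
    { toFun := fun f => QuotientAddGroup.lift _
        ((evalChain 1 X M N f).comp (relCycles R N).subtype) (by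
          rintro ⟨c, hc⟩ hb
          rw [AddSubgroup.mem_addSubgroupOf] at hb
          obtain ⟨_, ⟨d, rfl⟩, r, hr, h⟩ := AddSubgroup.mem_sup.1 hb
          have h0 : coboundary 1 X M f = 0 := f.2.2
          have h1 := evalChain_coboundary (N := N) (f : Cochain 1 X M) d
          rw [h0, map_zero, AddMonoidHom.zero_apply] at h1
          change evalChain 1 X M N f c = 0
          change _ = c at h
          rw [← h, map_add, ← h1, evalChain_eq_zero f.2.1 hr, add_zero])
      map_zero' := by
        ext c
        simp
      map_add' := fun f g => by
        ext c
        simp } (by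
    rintro ⟨f, hf⟩ hb
    rw [AddSubgroup.mem_addSubgroupOf] at hb
    obtain ⟨u, hu, h⟩ := hb
    change _ = f at h
    ext ⟨c, hc⟩
    change evalChain 1 X M N f c = 0
    rw [← h, evalChain_coboundary]
    exact evalChain_eq_zero hu hc)

/-! ### Coefficients -/

/-- The Tate twist `Λ(n) = (2πi)ⁿ Λ` of a subgroup `Λ ⊆ ℂ`. -/
def tate (Λ : AddSubgroup ℂ) (n : ℤ) : AddSubgroup ℂ :=
  Λ.map (AddMonoidHom.mulLeft ((2 * Real.pi * Complex.I : ℂ) ^ n))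

/-- `ℤ` as a subgroup of `ℂ`. -/
def intSubgroup : AddSubgroup ℂ := (Int.castAddHom ℂ).range

/-- `ℝ` as a subgroup of `ℂ`. -/
def realSubgroup : AddSubgroup ℂ := Complex.ofRealHom.toAddMonoidHom.range

/-- The isomorphism `ℤ → ℤ(n)`, `k ↦ k (2πi)ⁿ`. -/
def toTate (n : ℤ) : ℤ →+ tate intSubgroup n where
  toFun k := ⟨(2 * Real.pi * Complex.I : ℂ) ^ n * k, ⟨(k : ℂ), ⟨k, rfl⟩, rfl⟩⟩
  map_zero' := by simp
  map_add' a b := by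
    ext
    simp [mul_add]

theorem boundary_mapRange {n : ℕ} {X : Type*} [TopologicalSpace X] {G G' : Type*}
    [AddCommGroup G] [AddCommGroup G'] (φ : G →+ G') (c : Chain (n + 1) X G) :
    boundary n X G' (Finsupp.mapRange.addMonoidHom φ c) =
      Finsupp.mapRange.addMonoidHom φ (boundary n X G c) := by
  induction c using Finsupp.induction_linear with
  | zero => simp
  | add a b ha hb => rw [map_add, map_add, map_add, map_add, ha, hb]
  | single σ g =>
    simp only [boundary, Finsupp.mapRange.addMonoidHom_apply, Finsupp.mapRange_single,
      Finsupp.liftAddHom_apply_single, AddMonoidHom.finsetSum_apply, AddMonoidHom.smul_apply,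
      Finsupp.singleAddHom_apply]
    rw [← Finsupp.mapRange.addMonoidHom_apply, map_sum]
    refine Finset.sum_congr rfl fun i _ => ?_
    rw [map_zsmul, Finsupp.mapRange.addMonoidHom_apply, Finsupp.mapRange_single]

theorem mapRange_mem_chainsIn {n : ℕ} {X : Type*} [TopologicalSpace X] {R : Set X}
    {G G' : Type*} [AddCommGroup G] [AddCommGroup G'] (φ : G →+ G') {c : Chain n X G}
    (hc : c ∈ chainsIn n R G) :
    Finsupp.mapRange.addMonoidHom φ c ∈ chainsIn n R G' := fun σ h => by
  rw [Finsupp.mapRange.addMonoidHom_apply, Finsupp.mapRange_apply, hc σ h, map_zero]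

/-- The map `H₁(X, R; G) → H₁(X, R; G')` induced by a homomorphism of coefficients. -/
def mapCoeff {X : Type*} [TopologicalSpace X] (R : Set X) {G G' : Type*} [AddCommGroup G]
    [AddCommGroup G'] (φ : G →+ G') : RelH1 R G →+ RelH1 R G' :=
  QuotientAddGroup.map _ _
    (((Finsupp.mapRange.addMonoidHom φ).comp (relCycles R G).subtype).codRestrict
      (relCycles R G') (fun c => by
        change boundary 0 X G' (Finsupp.mapRange.addMonoidHom φ c) ∈ chainsIn 0 R G'
        rw [boundary_mapRange]
        exact mapRange_mem_chainsIn φ c.2)) (by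
    rintro ⟨c, hc⟩ hb
    rw [AddSubgroup.mem_addSubgroupOf] at hb
    obtain ⟨_, ⟨d, rfl⟩, r, hr, h⟩ := AddSubgroup.mem_sup.1 hb
    change _ = c at h
    change Finsupp.mapRange.addMonoidHom φ c ∈ relBoundaries R G'
    rw [← h, map_add, ← boundary_mapRange]
    exact AddSubgroup.add_mem_sup ⟨_, rfl⟩ (mapRange_mem_chainsIn φ hr))

/-! ### Classes of paths -/

/-- The singular `1`-simplex of a path; the vertices `0, 1` go to the initial and end point. -/
def simplexOfPath {X : Type*} [TopologicalSpace X] (γ : C(unitInterval, X)) : Simplex 1 X :=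
  γ.comp ⟨stdSimplexHomeomorphUnitInterval, stdSimplexHomeomorphUnitInterval.continuous⟩

theorem face_simplexOfPath {X : Type*} [TopologicalSpace X] (γ : C(unitInterval, X)) :
    face 0 (simplexOfPath γ) = ContinuousMap.const _ (γ 1) ∧
      face 1 (simplexOfPath γ) = ContinuousMap.const _ (γ 0) := by
  have key : ∀ x : stdSimplex ℝ (Fin 1), x = stdSimplex.vertex 0 := fun x =>
    Subsingleton.elim _ _
  constructor
  · ext x
    rw [key x]
    change γ (stdSimplexHomeomorphUnitInterval (stdSimplex.map _ (stdSimplex.vertex 0))) = γ 1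
    rw [stdSimplex.map_vertex]
    rfl
  · ext x
    rw [key x]
    change γ (stdSimplexHomeomorphUnitInterval (stdSimplex.map _ (stdSimplex.vertex 0))) = γ 0
    rw [stdSimplex.map_vertex]
    rfl

theorem single_mem_relCycles {X : Type*} [TopologicalSpace X] {R : Set X} (γ : C(unitInterval, X))
    (h : γ 0 = γ 1 ∨ γ 0 ∈ R ∧ γ 1 ∈ R) :
    Finsupp.single (simplexOfPath γ) (1 : ℤ) ∈ relCycles R ℤ := by
  have hb : boundary 0 X ℤ (Finsupp.single (simplexOfPath γ) 1) =
      Finsupp.single (ContinuousMap.const _ (γ 1)) 1 -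
        Finsupp.single (ContinuousMap.const _ (γ 0)) 1 := by
    rw [← (face_simplexOfPath γ).1, ← (face_simplexOfPath γ).2]
    simp [boundary, Fin.sum_univ_two, sub_eq_add_neg]
  change boundary 0 X ℤ _ ∈ chainsIn 0 R ℤ
  rw [hb]
  rcases h with h | ⟨h0, h1⟩
  · rw [h, sub_self]
    exact zero_mem _
  · have hc : ∀ x ∈ R, Finsupp.single (ContinuousMap.const _ x : Simplex 0 X) (1 : ℤ) ∈
        chainsIn 0 R ℤ := by
      intro x hx σ hσ
      refine Finsupp.single_eq_of_ne fun h => hσ ?_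
      rw [h]
      rintro _ ⟨y, rfl⟩
      exact hx
    exact sub_mem (hc _ h1) (hc _ h0)

/-- The class in `H₁(X, R; ℤ)` of a path that is closed or has its end points in `R`. -/
def pathClass {X : Type*} [TopologicalSpace X] (R : Set X) (γ : C(unitInterval, X))
    (h : γ 0 = γ 1 ∨ γ 0 ∈ R ∧ γ 1 ∈ R) : RelH1 R ℤ :=
  QuotientAddGroup.mk ⟨Finsupp.single (simplexOfPath γ) 1, single_mem_relCycles γ h⟩

/-! ### Differential forms and their de Rham classes -/

/-- Multiplication by `i` on `ℂ²`, as a real-linear map. -/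
def mulI : (ℂ × ℂ) →L[ℝ] (ℂ × ℂ) :=
  (Complex.I • ContinuousLinearMap.id ℂ (ℂ × ℂ)).restrictScalars ℝ

/-- The differential `dε` of a real function, as a complex-valued real-linear form. -/
def dForm (ε : ℂ × ℂ → ℝ) (p : ℂ × ℂ) : (ℂ × ℂ) →L[ℝ] ℂ :=
  Complex.ofRealCLM.comp (fderiv ℝ ε p)

/-- The form `∂ε`, the complex-linear part of `dε`. -/
def delForm (ε : ℂ × ℂ → ℝ) (p : ℂ × ℂ) : (ℂ × ℂ) →L[ℝ] ℂ :=
  (1 / 2 : ℂ) • (dForm ε p - Complex.I • (dForm ε p).comp mulI)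

/-- The form `∂̄ε`, the complex-antilinear part of `dε`. -/
def delBarForm (ε : ℂ × ℂ → ℝ) (p : ℂ × ℂ) : (ℂ × ℂ) →L[ℝ] ℂ :=
  (1 / 2 : ℂ) • (dForm ε p + Complex.I • (dForm ε p).comp mulI)

/-- The `1`-form `C₂(ε₀, ε₁) = ε₀ ∂ε₁ - ε₁ ∂ε₀ - ε₀ ∂̄ε₁ + ε₁ ∂̄ε₀`. -/
def C2 (ε₀ ε₁ : ℂ × ℂ → ℝ) (p : ℂ × ℂ) : (ℂ × ℂ) →L[ℝ] ℂ :=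
  ε₀ p • delForm ε₁ p - ε₁ p • delForm ε₀ p - ε₀ p • delBarForm ε₁ p + ε₁ p • delBarForm ε₀ p

/-- The form `C₂(log |t₁|, log |t₂|)`. -/
def C2log : ℂ × ℂ → (ℂ × ℂ) →L[ℝ] ℂ :=
  C2 (fun p => Real.log ‖p.1‖) (fun p => Real.log ‖p.2‖)

/-- A singular `1`-simplex of `X ⊆ ℂ²` as a path in `ℂ²`. -/
def pathOfSimplex {X : Set (ℂ × ℂ)} (σ : Simplex 1 X) :
    Path (σ (stdSimplexHomeomorphUnitInterval.symm 0) : ℂ × ℂ)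
      (σ (stdSimplexHomeomorphUnitInterval.symm 1) : ℂ × ℂ) where
  toFun t := σ (stdSimplexHomeomorphUnitInterval.symm t)
  continuous_toFun := by fun_prop
  source' := rfl
  target' := rfl

/-- `c` is the relative singular cohomology class attached to the `1`-form `ω` on `X` by
integration: it is represented by a singular cocycle of the pair `(X, R)` whose value on every
continuously differentiable simplex `σ` of `X` is `∫_σ ω`. -/
def IsDeRhamClass {X : Set (ℂ × ℂ)} (R : Set X) (M : AddSubgroup ℂ)
    (ω : ℂ × ℂ → (ℂ × ℂ) →L[ℝ] ℂ) (c : RelCoH1 R M) : Prop :=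
  ∃ f : relCocycles R M, QuotientAddGroup.mk f = c ∧
    ∀ σ : Simplex 1 X, ContDiffOn ℝ 1 (pathOfSimplex σ).extend (Set.Icc 0 1) →
      ((f : Cochain 1 X M) σ : ℂ) = curveIntegral ω (pathOfSimplex σ)

/-! ### Polynomials in two variables -/

/-- The value `P(p₁, p₂)`. -/
def evalAt (P : MvPolynomial (Fin 2) ℂ) (p : ℂ × ℂ) : ℂ := MvPolynomial.eval ![p.1, p.2] P

/-- `e(φ) = exp(2πiφ)`. -/
def e (φ : ℝ) : ℂ := Complex.exp (2 * Real.pi * Complex.I * φ)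

/-- The logarithmic Mahler measure. -/
def mahler (P : MvPolynomial (Fin 2) ℂ) : ℝ :=
  ∫ α₁ in (0 : ℝ)..1, ∫ α₂ in (0 : ℝ)..1, Real.log ‖evalAt P (e α₁, e α₂)‖

/-- `P*(t₁) = P(t₁, 0)`, viewed as a polynomial in `t₁, t₂`. -/
def pStar (P : MvPolynomial (Fin 2) ℂ) : MvPolynomial (Fin 2) ℂ :=
  MvPolynomial.aeval ![MvPolynomial.X 0, 0] P

/-- The real torus `T² = S¹ × S¹`. -/
def torus : Set (ℂ × ℂ) := {p | ‖p.1‖ = 1 ∧ ‖p.2‖ = 1}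

/-- `Z*(P)`, the zeros of `P` in `(ℂ*)²`. -/
def zeroLocus (P : MvPolynomial (Fin 2) ℂ) : Set (ℂ × ℂ) :=
  {p | p.1 ≠ 0 ∧ p.2 ≠ 0 ∧ evalAt P p = 0}

/-- The regular locus of `Z*(P)` for `P` irreducible, by the Jacobian criterion. -/
def regLocus (P : MvPolynomial (Fin 2) ℂ) : Set (ℂ × ℂ) :=
  {p ∈ zeroLocus P | evalAt (MvPolynomial.pderiv 0 P) p ≠ 0 ∨
    evalAt (MvPolynomial.pderiv 1 P) p ≠ 0}

/-- `(S¹ × B) ∩ Z*(P)`, `B` the closed unit disc. -/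
def discLocus (P : MvPolynomial (Fin 2) ℂ) : Set (ℂ × ℂ) :=
  {p ∈ zeroLocus P | ‖p.1‖ = 1 ∧ ‖p.2‖ ≤ 1}

/-- The set `A`: the union of the one-dimensional connected components of `(S¹ × B) ∩ Z*(P)`.
This set is semi-algebraic of dimension at most one when `P(·, 0)` has no zero on `S¹`, so its
connected components of dimension one are exactly those with more than one point. -/
def arcSet (P : MvPolynomial (Fin 2) ℂ) : Set (ℂ × ℂ) :=
  {p ∈ discLocus P | (connectedComponentIn (discLocus P) p).Nontrivial}

/-- The number of points of `A` over `p₁ e(δ)` whose second coordinate is `r`-close to `p₂`.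
For `r` small and `δ > 0` small with respect to `r` this is the number of arcs of `A` running
out of `p` in the direction of increasing argument of `t₁`, and `branchCount P p r (-δ)` is the
number of arcs of `A` running into `p`. -/
def branchCount (P : MvPolynomial (Fin 2) ℂ) (p : ℂ × ℂ) (r δ : ℝ) : ℕ :=
  {q ∈ arcSet P | q.1 = p.1 * e δ ∧ dist q.2 p.2 < r}.ncard

/-- The set `R_P` of the points of `A` at which the number of arcs of `A` running into the point
differs from the number of arcs of `A` running out of it. -/
def boundaryPts (P : MvPolynomial (Fin 2) ℂ) : Set (ℂ × ℂ) :=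
  {p ∈ arcSet P | ¬ ∀ᶠ r in 𝓝[>] (0 : ℝ), ∀ᶠ δ in 𝓝[>] (0 : ℝ),
    branchCount P p r (-δ) = branchCount P p r δ}

/-- `R_P` as a subset of the space `Z*(P)^reg`. -/
def boundaryIn (P : MvPolynomial (Fin 2) ℂ) : Set (regLocus P) :=
  Subtype.val ⁻¹' boundaryPts P

/-- Along the path `γ` the coordinate `t₁` moves on `S¹` in the positive direction. -/
def IsPositive {X : Set (ℂ × ℂ)} (γ : C(unitInterval, X)) : Prop :=
  ∃ θ : unitInterval → ℝ, Continuous θ ∧ StrictMono θ ∧ ∀ s, (γ s : ℂ × ℂ).1 = e (θ s)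

/-- A decomposition of `A` into finitely many closed paths `χ` and paths with boundary `ψ` in
`Z*(P)^reg`, positively oriented with respect to `t₁`, together running through `A` exactly once
(up to finitely many coincidences of points), the end points of the `ψ` being the points of
`R_P`. -/
structure ArcDecomposition (P : MvPolynomial (Fin 2) ℂ) where
  /-- the number of closed paths -/
  numClosed : ℕ
  /-- the number of paths with boundary -/
  numOpen : ℕ
  /-- the closed paths -/
  χ : Fin numClosed → C(unitInterval, regLocus P)
  /-- the paths with boundary -/
  ψ : Fin numOpen → C(unitInterval, regLocus P)
  closed : ∀ μ, χ μ 0 = χ μ 1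
  notClosed : ∀ ν, ψ ν 0 ≠ ψ ν 1
  positive_closed : ∀ μ, IsPositive (χ μ)
  positive_open : ∀ ν, IsPositive (ψ ν)
  cover : {p : ℂ × ℂ | (∃ μ s, (χ μ s : ℂ × ℂ) = p) ∨ ∃ ν s, (ψ ν s : ℂ × ℂ) = p} = arcSet P
  once : {x : ((Fin numClosed ⊕ Fin numOpen) × unitInterval) × ((Fin numClosed ⊕ Fin numOpen) × unitInterval) |
    x.1 ≠ x.2 ∧ Sum.elim χ ψ x.1.1 x.1.2 = Sum.elim χ ψ x.2.1 x.2.2}.Finite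
  endpoints : {x : regLocus P | ∃ ν, x = ψ ν 0 ∨ x = ψ ν 1} = boundaryIn P

/-- The class `[A] = ∑ [χ] + ∑ [ψ]` in `H₁(Z*(P)^reg, R_P; ℤ)`. -/
def ArcDecomposition.cls {P : MvPolynomial (Fin 2) ℂ} (D : ArcDecomposition P) :
    RelH1 (boundaryIn P) ℤ :=
  ∑ μ, pathClass (boundaryIn P) (D.χ μ) (Or.inl (D.closed μ)) +
    ∑ ν, pathClass (boundaryIn P) (D.ψ ν)
      (Or.inr ⟨D.endpoints ▸ ⟨ν, Or.inl rfl⟩, D.endpoints ▸ ⟨ν, Or.inr rfl⟩⟩)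

/-- The class `[A] ⊗ (2πi)⁻¹` in `H₁(Z*(P)^reg, R_P; ℤ(-1))`. -/
def ArcDecomposition.twistedCls {P : MvPolynomial (Fin 2) ℂ} (D : ArcDecomposition P) :
    RelH1 (boundaryIn P) (tate intSubgroup (-1)) :=
  mapCoeff (boundaryIn P) (toTate (-1)) D.cls

end MahlerSymbol

end

/-!
Why the theorem holds.

*Arcs.* Over the unit circle the curve is cut at finitely many critical values of `t₁`
(`exists_critical_values`). They are found by elimination: away from them the fibres are unramified,
because `P` is irreducible, and roots do not cross the circle `|t₂| = 1`,
because either `P` does not divide its reciprocal polynomial, so that the roots stay off the circle,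
or it does, so that the fibres are symmetric under inversion in the circle. Hence the roots in the
closed disc form a finite covering of the complement of the critical values; its sheets extend
continuously to the end points of the intervals, since fibres are finite. This is the structure
`ArcFamily`; its arcs make up `A` (`ArcFamily.arcSet_eq`), and a point of `A` belongs to `R_P` if
and only if different numbers of arcs start and end there (`ArcFamily.mem_boundaryPts_iff`). At a
point with `|t₂| < 1` both numbers are the degree of the projection to the `t₁`-line on a punctured
neighbourhood of the point, which is connected; so `R_P` lies on the torus
(`ArcFamily.boundaryPts_subset_torus`).

*Class.* On the curve `C₂(log |t₁|, log |t₂|)` is `2πi` times a real closed form, because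
`d log t₁ ∧ d log t₂` vanishes on a curve: a local primitive is written down from a holomorphic
primitive of `log t₁ d log t₂` (`exists_primitive`). The form can therefore be integrated over
arbitrary continuous simplices by gluing local primitives (`exists_glued`), and this gives a
cocycle (`formCochain`), which vanishes on simplices in `R_P` as this set is finite. It is unique
because a cocycle that vanishes on smooth simplices vanishes: in a chart every path is homotopic to
a segment (`cocycle_eq_zero_of_contDiffOn`).

*Cycle.* Joining arcs end to start as long as possible leaves closed paths and paths whose end
points are exactly the points where the numbers of ingoing and outgoing arcs differ, because joining
does not change the boundary of the sum of the arcs (`Traverses.exists_reduced`,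
`ArcFamily.exists_arcDecomposition`). Nor does it change the value of a cocycle.

*Formula.* By Jensen's formula on the fibres, `m(P) - m(P*)` is the sum of the integrals of
`-log |t₂|` over the arcs (`ArcFamily.mahler_sub_mahler_pStar`), and on `|t₁| = 1` this is the
integral of the form (`ArcFamily.increment_path`).
-/

/-! ### Elimination of the second variable -/

namespace MahlerSymbol

open Polynomial

theorem evalAt_equivMvPolynomial (p : ℂ[X][X]) (t z : ℂ) :
    evalAt (Bivariate.equivMvPolynomial ℂ p) (t, z) = (p.map (evalRingHom t)).eval z := by
  have h : (MvPolynomial.eval ![t, z]).comp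
      (Bivariate.equivMvPolynomial ℂ : ℂ[X][X] →+* MvPolynomial (Fin 2) ℂ) =
      (evalRingHom z).comp (mapRingHom (evalRingHom t)) := by
    ext <;> simp
  exact congr($h p)

/-- The specialization `P(t, ·)` of a polynomial in two variables. -/
noncomputable def fiberPoly (P : MvPolynomial (Fin 2) ℂ) (t : ℂ) : ℂ[X] :=
  ((Bivariate.equivMvPolynomial ℂ).symm P).map (evalRingHom t)

theorem eval_fiberPoly (P : MvPolynomial (Fin 2) ℂ) (t z : ℂ) :
    (fiberPoly P t).eval z = evalAt P (t, z) := by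
  rw [fiberPoly, ← evalAt_equivMvPolynomial, AlgEquiv.apply_symm_apply]

theorem derivative_fiberPoly (P : MvPolynomial (Fin 2) ℂ) (t : ℂ) :
    derivative (fiberPoly P t) = fiberPoly (MvPolynomial.pderiv 1 P) t := by
  have h := Bivariate.pderiv_one_equivMvPolynomial ((Bivariate.equivMvPolynomial ℂ).symm P)
  rw [AlgEquiv.apply_symm_apply] at h
  rw [fiberPoly, fiberPoly, h, AlgEquiv.symm_apply_apply, derivative_map]

theorem evalAt_eq_zero_of_dvd {P Q : MvPolynomial (Fin 2) ℂ} (h : P ∣ Q) {p : ℂ × ℂ}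
    (hp : evalAt P p = 0) : evalAt Q p = 0 := by
  obtain ⟨R, rfl⟩ := h
  rw [evalAt, map_mul]
  exact mul_eq_zero_of_left hp _

/-- An irreducible polynomial `P` and a polynomial `Q` that it does not divide have only finitely
many common zeros up to the second coordinate: by the Gauss lemma their resultant with respect to
the second variable does not vanish. If `P` does not involve the second variable, it is itself
the eliminant. -/
theorem exists_eliminant {P Q : MvPolynomial (Fin 2) ℂ} (hP : Irreducible P) (h : ¬ P ∣ Q) :
    ∃ r : ℂ[X], r ≠ 0 ∧ ∀ t z, evalAt P (t, z) = 0 → evalAt Q (t, z) = 0 → r.eval t = 0 := by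
  obtain ⟨p, rfl⟩ := (Bivariate.equivMvPolynomial ℂ).surjective P
  obtain ⟨q, rfl⟩ := (Bivariate.equivMvPolynomial ℂ).surjective Q
  rw [MulEquiv.irreducible_iff] at hP
  rw [map_dvd_iff] at h
  simp only [evalAt_equivMvPolynomial]
  by_cases hd : p.natDegree = 0
  · obtain ⟨r, rfl⟩ := natDegree_eq_zero.1 hd
    refine ⟨r, ?_, fun t z h1 _ => by simpa using h1⟩
    rintro rfl
    exact hP.ne_zero (by simp)
  have hprim : p.IsPrimitive := hP.isPrimitive hd
  have hinj : Function.Injective (algebraMap ℂ[X] (FractionRing ℂ[X])) :=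
    IsFractionRing.injective _ _
  have hres : resultant p q ≠ 0 := by
    intro h0
    have h1 : resultant (p.map (algebraMap ℂ[X] (FractionRing ℂ[X])))
        (q.map (algebraMap ℂ[X] (FractionRing ℂ[X]))) = 0 := by
      rw [natDegree_map_eq_of_injective hinj, natDegree_map_eq_of_injective hinj,
        resultant_map_map, h0, map_zero]
    refine (resultant_eq_zero_iff.1 h1).2 ?_
    refine (EuclideanDomain.isCoprime_of_dvd ?_ ?_)
    · rintro ⟨h2, -⟩
      rw [Polynomial.map_eq_zero_iff hinj] at h2
      exact hP.ne_zero h2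
    · intro z hz _ hzp hzq
      have hirr := (hprim.irreducible_iff_irreducible_map_fraction_map
        (K := FractionRing ℂ[X])).1 hP
      have h3 := (hirr.dvd_iff.1 hzp).resolve_left hz
      exact h (hprim.dvd_of_fraction_map_dvd_fraction_map (K := FractionRing ℂ[X])
        (h3.dvd.trans hzq))
  obtain ⟨a, b, -, -, hab⟩ := exists_mul_add_mul_eq_C_resultant p q le_rfl le_rfl (Or.inl hd)
  refine ⟨_, hres, fun t z h1 h2 => ?_⟩
  have h3 := congrArg (fun f => (f.map (evalRingHom t)).eval z) hab
  simpa [h1, h2] using h3.symm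

/-- Only finitely many fibres of an irreducible curve over the `t₁`-line have a multiple point. -/
theorem exists_eliminant_pderiv {P : MvPolynomial (Fin 2) ℂ} (hP : Irreducible P) :
    ∃ r : ℂ[X], r ≠ 0 ∧ ∀ t z, evalAt P (t, z) = 0 →
      evalAt (MvPolynomial.pderiv 1 P) (t, z) = 0 → r.eval t = 0 := by
  by_cases h : P ∣ MvPolynomial.pderiv 1 P
  -- For degree reasons the derivative vanishes, so that `P` does not involve `t₂`.
  · obtain ⟨p, rfl⟩ := (Bivariate.equivMvPolynomial ℂ).surjective P
    rw [Bivariate.pderiv_one_equivMvPolynomial, map_dvd_iff] at h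
    rw [MulEquiv.irreducible_iff] at hP
    have hd : p.natDegree = 0 := by
      by_contra hd
      have h1 : derivative p ≠ 0 := fun h0 => hd (derivative_eq_zero.1 h0)
      exact absurd (natDegree_le_of_dvd h h1) (not_le.2 (natDegree_derivative_lt hd))
    obtain ⟨r, rfl⟩ := natDegree_eq_zero.1 hd
    refine ⟨r, ?_, fun t z h1 _ => by simpa [evalAt_equivMvPolynomial] using h1⟩
    rintro rfl
    exact hP.ne_zero (by simp)
  · exact exists_eliminant hP h

/-! ### The reciprocal polynomial -/

/-- The reciprocal polynomial `(t₁t₂)^N conj (P(1 / conj t₁, 1 / conj t₂))`, `N` the total degree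
of `P`. -/
noncomputable def reciprocal (P : MvPolynomial (Fin 2) ℂ) : MvPolynomial (Fin 2) ℂ :=
  ∑ d ∈ P.support, MvPolynomial.C (starRingEnd ℂ (P.coeff d)) *
    (MvPolynomial.X 0 ^ (P.totalDegree - d 0) * MvPolynomial.X 1 ^ (P.totalDegree - d 1))

theorem evalAt_reciprocal (P : MvPolynomial (Fin 2) ℂ) {t z : ℂ} (ht : t ≠ 0) (hz : z ≠ 0) :
    evalAt (reciprocal P) (t, z) = (t * z) ^ P.totalDegree *
      starRingEnd ℂ (evalAt P ((starRingEnd ℂ t)⁻¹, (starRingEnd ℂ z)⁻¹)) := by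
  simp only [evalAt, reciprocal, MvPolynomial.eval_eq' _ P, map_sum, Finset.mul_sum]
  refine Finset.sum_congr rfl fun d hd => ?_
  have hle : ∀ i, d i ≤ P.totalDegree := fun i => by
    refine le_trans ?_ (MvPolynomial.le_totalDegree hd)
    by_cases hi : d i = 0
    · simp [hi]
    · exact Finset.single_le_sum (f := d) (fun _ _ => Nat.zero_le _) (Finsupp.mem_support_iff.2 hi)
  simp only [map_mul, map_pow, MvPolynomial.eval_C, MvPolynomial.eval_X, Fin.prod_univ_two,
    Matrix.cons_val_zero, Matrix.cons_val_one, map_inv₀, Complex.conj_conj]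
  rw [pow_sub₀ _ ht (hle 0), pow_sub₀ _ hz (hle 1), mul_pow, inv_pow, inv_pow]
  ring

/-- The zeros of `P` over the unit circle are generically either off the torus or symmetric with
respect to inversion in the unit circle: on the torus `P` and its reciprocal vanish simultaneously,
so either they have few common zeros or `P` divides its reciprocal. -/
theorem exists_eliminant_reciprocal {P : MvPolynomial (Fin 2) ℂ} (hP : Irreducible P) :
    (∃ r : ℂ[X], r ≠ 0 ∧ ∀ t z : ℂ, ‖t‖ = 1 → ‖z‖ = 1 → evalAt P (t, z) = 0 → r.eval t = 0) ∨
      ∀ t z : ℂ, ‖t‖ = 1 → z ≠ 0 → evalAt P (t, z) = 0 →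
        evalAt P (t, (starRingEnd ℂ z)⁻¹) = 0 := by
  have hinv : ∀ t : ℂ, ‖t‖ = 1 → (starRingEnd ℂ t)⁻¹ = t := fun t ht => by
    rw [← Complex.inv_eq_conj ht, inv_inv]
  have hne : ∀ t : ℂ, ‖t‖ = 1 → t ≠ 0 := fun t ht h0 => by simp [h0] at ht
  by_cases h : P ∣ reciprocal P
  · right
    intro t z ht hz h0
    have h1 := evalAt_eq_zero_of_dvd h h0
    rw [evalAt_reciprocal P (hne t ht) hz, hinv t ht] at h1
    have h2 := (mul_eq_zero.1 h1).resolve_left (pow_ne_zero _ (mul_ne_zero (hne t ht) hz))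
    exact (map_eq_zero _).1 h2
  · left
    obtain ⟨r, hr, H⟩ := exists_eliminant hP h
    refine ⟨r, hr, fun t z ht hz h0 => H t z h0 ?_⟩
    rw [evalAt_reciprocal P (hne t ht) (hne z hz), hinv t ht, hinv z hz, h0]
    simp

/-- A finite set of values of `t₁` outside of which the fibres of the curve are unramified and, over
the unit circle, stay off the torus unless the whole curve is symmetric under inversion. -/
theorem exists_critical_values {P : MvPolynomial (Fin 2) ℂ} (hP : Irreducible P) :
    ∃ C : Set ℂ, C.Finite ∧
      (∀ t z, t ∉ C → evalAt P (t, z) = 0 → evalAt (MvPolynomial.pderiv 1 P) (t, z) ≠ 0) ∧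
      ((∀ t z : ℂ, ‖t‖ = 1 → ‖z‖ = 1 → t ∉ C → evalAt P (t, z) ≠ 0) ∨
        ∀ t z : ℂ, ‖t‖ = 1 → z ≠ 0 → evalAt P (t, z) = 0 →
          evalAt P (t, (starRingEnd ℂ z)⁻¹) = 0) := by
  obtain ⟨r, hr, h1⟩ := exists_eliminant_pderiv hP
  have hfin : ∀ r : ℂ[X], r ≠ 0 → {t : ℂ | r.eval t = 0}.Finite := fun r hr => by
    refine (r.roots.toFinset.finite_toSet).subset fun t ht => ?_
    simpa [hr] using ht
  rcases exists_eliminant_reciprocal hP with ⟨s, hs, h2⟩ | h2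
  · refine ⟨{t | r.eval t = 0} ∪ {t | s.eval t = 0}, (hfin r hr).union (hfin s hs), ?_, Or.inl ?_⟩
    · exact fun t z ht h0 h3 => ht (Or.inl (h1 t z h0 h3))
    · exact fun t z h3 h4 ht h0 => ht (Or.inr (h2 t z h3 h4 h0))
  · exact ⟨{t | r.eval t = 0}, hfin r hr, fun t z ht h0 h3 => ht (h1 t z h0 h3), Or.inr h2⟩

end MahlerSymbol

/-! ### Local parametrizations of the curve -/

namespace MahlerSymbol

open Filter Metric

theorem hasStrictFDerivAt_evalAt (P : MvPolynomial (Fin 2) ℂ) (q : ℂ × ℂ) :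
    HasStrictFDerivAt (evalAt P)
      (evalAt (MvPolynomial.pderiv 0 P) q • ContinuousLinearMap.fst ℂ ℂ ℂ +
        evalAt (MvPolynomial.pderiv 1 P) q • ContinuousLinearMap.snd ℂ ℂ ℂ) q := by
  induction P using MvPolynomial.induction_on with
  | C a =>
    have h : evalAt (MvPolynomial.C a) = fun _ => a := funext fun q => by simp [evalAt]
    rw [h]
    refine (hasStrictFDerivAt_const a q).congr_fderiv ?_
    ext <;> simp [evalAt]
  | add p r hp hr =>
    have h : evalAt (p + r) = evalAt p + evalAt r := funext fun q => by simp [evalAt]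
    rw [h]
    refine (hp.add hr).congr_fderiv ?_
    simp only [evalAt, map_add]
    module
  | mul_X p i hp =>
    have h : evalAt (p * MvPolynomial.X i) = evalAt p * fun q => ![q.1, q.2] i :=
      funext fun q => by simp [evalAt]
    rw [h]
    fin_cases i
    · refine (hp.mul hasStrictFDerivAt_fst).congr_fderiv ?_
      ext <;> simp [evalAt, MvPolynomial.pderiv_X]
    · refine (hp.mul hasStrictFDerivAt_snd).congr_fderiv ?_
      ext <;> simp [evalAt, MvPolynomial.pderiv_X]

theorem continuous_evalAt (P : MvPolynomial (Fin 2) ℂ) : Continuous (evalAt P) :=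
  continuous_iff_continuousAt.2 fun q => (hasStrictFDerivAt_evalAt P q).continuousAt

/-- The implicit function theorem for `f : ℂ × ℂ → ℂ`, with differentiability of the implicit
function in a whole neighbourhood. -/
theorem exists_implicit {f a b : ℂ × ℂ → ℂ}
    (hf : ∀ q, HasStrictFDerivAt f
      (a q • ContinuousLinearMap.fst ℂ ℂ ℂ + b q • ContinuousLinearMap.snd ℂ ℂ ℂ) q)
    (hb : Continuous b) {u : ℂ × ℂ} (h0 : f u = 0) (hbu : b u ≠ 0) :
    ∃ h : ℂ → ℂ, h u.1 = u.2 ∧ (∀ᶠ t in 𝓝 u.1, DifferentiableAt ℂ h t) ∧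
      ∀ᶠ q in 𝓝 u, f q = 0 ↔ h q.1 = q.2 := by
  have key : ∀ v : ℂ × ℂ, f v = 0 → b v ≠ 0 → ∃ h : ℂ → ℂ, h v.1 = v.2 ∧
      DifferentiableAt ℂ h v.1 ∧ ∀ᶠ q in 𝓝 v, f q = 0 ↔ h q.1 = q.2 := by
    intro v hv hbv
    have hinv : ((a v • ContinuousLinearMap.fst ℂ ℂ ℂ + b v • ContinuousLinearMap.snd ℂ ℂ ℂ) ∘L
        .inr ℂ ℂ ℂ).IsInvertible := by
      refine ⟨ContinuousLinearEquiv.unitsEquivAut ℂ (Units.mk0 _ hbv), ?_⟩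
      ext
      simp
    refine ⟨(hf v).implicitFunctionOfProdDomain hinv, ?_,
      ((hf v).hasStrictFDerivAt_implicitFunctionOfProdDomain hinv).differentiableAt, ?_⟩
    · exact ((hf v).eventually_apply_eq_iff_implicitFunctionOfProdDomain hinv).self_of_nhds.1 rfl
    · simpa [hv] using (hf v).eventually_apply_eq_iff_implicitFunctionOfProdDomain hinv
  obtain ⟨h, h1, h2, h3⟩ := key u h0 hbu
  refine ⟨h, h1, ?_, h3⟩
  have hcont : Tendsto (fun t => (t, h t)) (𝓝 u.1) (𝓝 u) := by
    have h4 : Tendsto (fun t => (t, h t)) (𝓝 u.1) (𝓝 (u.1, h u.1)) :=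
      tendsto_id.prodMk_nhds h2.continuousAt.tendsto
    rwa [h1] at h4
  -- At a nearby point of the graph the implicit function there agrees with `h` by uniqueness.
  filter_upwards [hcont.eventually h3.eventually_nhds,
    hcont.eventually (hb.continuousAt.eventually_ne hbu)] with t ht hbt
  obtain ⟨g, g1, g2, g3⟩ := key (t, h t) (ht.self_of_nhds.2 rfl) hbt
  refine g2.congr_of_eventuallyEq ?_
  have hcont' : Tendsto (fun s => (s, g s)) (𝓝 t) (𝓝 (t, h t)) := by
    have h4 : Tendsto (fun s => (s, g s)) (𝓝 t) (𝓝 (t, g t)) :=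
      tendsto_id.prodMk_nhds g2.continuousAt.tendsto
    rwa [show g t = h t from g1] at h4
  filter_upwards [hcont'.eventually ht, hcont'.eventually g3] with s hs hs'
  exact hs.1 (hs'.2 rfl)

/-- A chart of `Z*(P)^reg` at `p`: one of the two coordinates, `π`, is a local coordinate, and `ψ`
is the inverse of its restriction to the curve. -/
theorem exists_chart {P : MvPolynomial (Fin 2) ℂ} {p : ℂ × ℂ} (hp : p ∈ regLocus P) :
    ∃ (π : ℂ × ℂ →L[ℂ] ℂ) (ψ : ℂ → ℂ × ℂ) (r : ℝ), 0 < r ∧ DifferentiableOn ℂ ψ (ball (π p) r) ∧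
      (∀ z ∈ ball (π p) r, ψ z ∈ regLocus P ∧ π (ψ z) = z) ∧ ψ (π p) = p ∧
      ∀ᶠ q in 𝓝 p, q ∈ regLocus P → ψ (π q) = q := by
  have hopen : ∀ᶠ q in 𝓝 p, evalAt P q = 0 → q ∈ regLocus P := by
    have h1 : ∀ᶠ q in 𝓝 p, q.1 ≠ 0 := continuous_fst.continuousAt.eventually_ne hp.1.1
    have h2 : ∀ᶠ q in 𝓝 p, q.2 ≠ 0 := continuous_snd.continuousAt.eventually_ne hp.1.2.1
    have h3 : ∀ᶠ q in 𝓝 p, evalAt (MvPolynomial.pderiv 0 P) q ≠ 0 ∨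
        evalAt (MvPolynomial.pderiv 1 P) q ≠ 0 := by
      rcases hp.2 with h | h
      · exact ((continuous_evalAt _).continuousAt.eventually_ne h).mono fun _ => Or.inl
      · exact ((continuous_evalAt _).continuousAt.eventually_ne h).mono fun _ => Or.inr
    filter_upwards [h1, h2, h3] with q a1 a2 a3 a4 using ⟨⟨a1, a2, a4⟩, a3⟩
  have finish : ∀ (π : ℂ × ℂ →L[ℂ] ℂ) (ψ : ℂ → ℂ × ℂ), ψ (π p) = p → (∀ z, π (ψ z) = z) →
      (∀ᶠ z in 𝓝 (π p), DifferentiableAt ℂ ψ z) →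
      (∀ᶠ q in 𝓝 p, evalAt P q = 0 ↔ ψ (π q) = q) →
      ∃ (π : ℂ × ℂ →L[ℂ] ℂ) (ψ : ℂ → ℂ × ℂ) (r : ℝ), 0 < r ∧
      DifferentiableOn ℂ ψ (ball (π p) r) ∧
      (∀ z ∈ ball (π p) r, ψ z ∈ regLocus P ∧ π (ψ z) = z) ∧ ψ (π p) = p ∧
      ∀ᶠ q in 𝓝 p, q ∈ regLocus P → ψ (π q) = q := by
    intro π ψ h1 h2 h3 h4
    have hc : Tendsto ψ (𝓝 (π p)) (𝓝 p) := by
      have := h3.self_of_nhds.continuousAt.tendsto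
      rwa [h1] at this
    have hev := (hc.eventually (hopen.and h4)).and h3
    obtain ⟨r, hr, hball⟩ := Metric.eventually_nhds_iff_ball.1 hev
    refine ⟨π, ψ, r, hr, fun z hz => (hball z hz).2.differentiableWithinAt, fun z hz => ⟨?_, h2 z⟩,
      h1, h4.mono fun q hq hq' => hq.1 hq'.1.2.2⟩
    exact (hball z hz).1.1 ((hball z hz).1.2.2 (by rw [h2]))
  rcases hp.2 with h | h
  -- If only the first partial derivative is known not to vanish, the coordinates are interchanged.
  · have hf : ∀ q : ℂ × ℂ, HasStrictFDerivAt (fun q : ℂ × ℂ => evalAt P q.swap)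
        (evalAt (MvPolynomial.pderiv 1 P) q.swap • ContinuousLinearMap.fst ℂ ℂ ℂ +
          evalAt (MvPolynomial.pderiv 0 P) q.swap • ContinuousLinearMap.snd ℂ ℂ ℂ) q := by
      intro q
      have hs : HasStrictFDerivAt (fun q : ℂ × ℂ => q.swap)
          ((ContinuousLinearMap.snd ℂ ℂ ℂ).prod (ContinuousLinearMap.fst ℂ ℂ ℂ)) q :=
        hasStrictFDerivAt_snd.prodMk hasStrictFDerivAt_fst
      refine ((hasStrictFDerivAt_evalAt P q.swap).comp q hs).congr_fderiv ?_
      ext <;> simp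
    obtain ⟨g, g1, g2, g3⟩ := exists_implicit (u := p.swap) hf
      ((continuous_evalAt _).comp continuous_swap) (by simpa using hp.1.2.2) (by simpa using h)
    refine finish (ContinuousLinearMap.snd ℂ ℂ ℂ) (fun z => (g z, z)) ?_ (fun z => rfl) ?_ ?_
    · exact Prod.ext g1 rfl
    · exact g2.mono fun z hz => hz.prodMk differentiableAt_id
    · have := (continuous_swap.tendsto p).eventually g3
      filter_upwards [this] with q hq
      rw [Prod.swap_swap] at hq
      rw [hq]
      exact ⟨fun h => Prod.ext h rfl, fun h => congrArg Prod.fst h⟩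
  · obtain ⟨g, g1, g2, g3⟩ := exists_implicit (hasStrictFDerivAt_evalAt P) (continuous_evalAt _)
      hp.1.2.2 h
    refine finish (ContinuousLinearMap.fst ℂ ℂ ℂ) (fun z => (z, g z)) ?_ (fun z => rfl) ?_ ?_
    · exact Prod.ext rfl g1
    · exact g2.mono fun z hz => differentiableAt_id.prodMk hz
    · filter_upwards [g3] with q hq
      rw [hq]
      exact ⟨fun h => Prod.ext rfl h, fun h => congrArg Prod.snd h⟩

end MahlerSymbol

/-! ### Finite-to-one projections as covering maps -/

namespace MahlerSymbol

open Filter Metric Set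

/-- If the sets `R t ⊆ ℂ`, `t ∈ T`, are uniformly bounded and closed as a family, finite for
`t ∈ s`, and locally given by continuous functions near `s`, then their total space is a covering
of `s`. -/
theorem isCoveringMapOn_of_local_sections {T : Type*} [TopologicalSpace T] [T2Space T]
    {R : T → Set ℂ} {K : Set ℂ} (hK : IsCompact K) (hRK : ∀ t, R t ⊆ K)
    (hcl : IsClosed {x : T × ℂ | x.2 ∈ R x.1}) {s : Set T} (hfin : ∀ t ∈ s, (R t).Finite)
    (hloc : ∀ t ∈ s, ∀ z ∈ R t, ∃ h : T → ℂ, h t = z ∧ (∀ᶠ u in 𝓝 t, ContinuousAt h u) ∧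
      (∀ᶠ u in 𝓝 t, h u ∈ R u) ∧ ∀ᶠ q in 𝓝 (t, z), q.2 ∈ R q.1 → h q.1 = q.2) :
    IsCoveringMapOn (fun x : {x : T × ℂ // x.2 ∈ R x.1} => x.1.1) s := by
  have hclosed : IsClosedMap (fun x : {x : T × ℂ // x.2 ∈ R x.1} => x.1.1) := by
    have : CompactSpace K := isCompact_iff_compactSpace.1 hK
    let j : {x : T × ℂ // x.2 ∈ R x.1} → T × K := fun x => (x.1.1, ⟨x.1.2, hRK _ x.2⟩)
    have hjc : Continuous j := (continuous_fst.comp continuous_subtype_val).prodMk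
      ((continuous_snd.comp continuous_subtype_val).subtype_mk _)
    have hj : Topology.IsClosedEmbedding j := by
      refine ⟨.of_comp hjc (continuous_id.prodMap continuous_subtype_val)
        Topology.IsEmbedding.subtypeVal, ?_⟩
      have h1 : range j = Prod.map id Subtype.val ⁻¹' {x : T × ℂ | x.2 ∈ R x.1} := by
        ext ⟨t, z⟩
        constructor
        · rintro ⟨x, hx⟩
          rw [← hx]
          exact x.2
        · exact fun h => ⟨⟨(t, z), h⟩, rfl⟩
      rw [h1]
      exact hcl.preimage (continuous_id.prodMap continuous_subtype_val)
    exact (isClosedMap_fst_of_compactSpace (X := T) (Y := K)).comp hj.isClosedMap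
  -- A closed local homeomorphism with finite fibres is a covering.
  refine hclosed.isCoveringMapOn_of_isLocalHomeomorphOn ?_ ?_
  · intro t ht
    refine Set.Finite.of_finite_image (f := fun x => x.1.2) ((hfin t ht).subset ?_) ?_
    · rintro _ ⟨⟨⟨u, z⟩, hx⟩, rfl, rfl⟩
      exact hx
    · rintro ⟨⟨u, z⟩, hx⟩ rfl ⟨⟨u', z'⟩, hx'⟩ h h'
      simp only [mem_preimage, mem_singleton_iff] at h
      subst h
      simp only at h'
      subst h'
      rfl
  · rintro x hx
    obtain ⟨⟨t, z⟩, hz⟩ := x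
    obtain ⟨h, rfl, hc, hR, hu⟩ := hloc t hx z hz
    rw [nhds_prod_eq] at hu
    obtain ⟨V, hV, U, hU, hVU⟩ := mem_prod_iff.1 hu
    obtain ⟨U', hU'U, hU'o, hzU'⟩ := _root_.mem_nhds_iff.1 hU
    have hW : ∀ᶠ u in 𝓝 t, u ∈ V ∧ ContinuousAt h u ∧ h u ∈ R u ∧ h u ∈ U' := by
      filter_upwards [hV, hc, hR, hc.self_of_nhds.eventually_mem (hU'o.mem_nhds hzU')]
        with u a b c d using ⟨a, b, c, d⟩
    obtain ⟨W, hW, hWo, htW⟩ := _root_.mem_nhds_iff.1 hW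
    classical
    refine ⟨{
      toFun := fun x => x.1.1
      invFun := fun u => if hu : h u ∈ R u then ⟨(u, h u), hu⟩ else ⟨(t, h t), hz⟩
      source := {x | x.1.1 ∈ W ∧ x.1.2 ∈ U'}
      target := W
      map_source' := fun x hx => hx.1
      map_target' := fun u hu => by
        simp only [dif_pos (hW hu).2.2.1]
        exact ⟨hu, (hW hu).2.2.2⟩
      left_inv' := fun x hx => by
        have h1 := (hW hx.1).2.2.1
        simp only [dif_pos h1]
        exact Subtype.ext (Prod.ext rfl (hVU (mk_mem_prod (hW hx.1).1 (hU'U hx.2)) x.2))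
      right_inv' := fun u hu => by
        simp only [dif_pos (hW hu).2.2.1]
      open_source := (hWo.preimage (continuous_fst.comp continuous_subtype_val)).inter
        (hU'o.preimage (continuous_snd.comp continuous_subtype_val))
      open_target := hWo
      continuousOn_toFun := (continuous_fst.comp continuous_subtype_val).continuousOn
      continuousOn_invFun := by
        refine (Topology.IsInducing.subtypeVal
          (t := {x : T × ℂ | x.2 ∈ R x.1})).continuousOn_iff.2 ?_
        have h1 : ContinuousOn (fun u => (u, h u)) W :=
          continuousOn_id.prodMk fun u hu => (hW hu).2.1.continuousWithinAt
        refine h1.congr fun u hu => ?_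
        simp only [Function.comp, dif_pos (hW hu).2.2.1] }, ⟨htW, hzU'⟩, rfl⟩

section Interval

variable {R : ℝ → Set ℂ} {s : Set ℝ}

/-- Continuous sections over an interval exist through every point of a covering, and are unique. -/
theorem existsUnique_section
    (cov : IsCoveringMapOn (fun x : {x : ℝ × ℂ // x.2 ∈ R x.1} => x.1.1) s) {a b : ℝ}
    (hab : Ioo a b ⊆ s) {m : ℝ} (hm : m ∈ Ioo a b) {z : ℂ} (hz : z ∈ R m) :
    ∃ F : ℝ → ℂ, (ContinuousOn F (Ioo a b) ∧ F m = z ∧ ∀ α ∈ Ioo a b, F α ∈ R α) ∧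
      ∀ G : ℝ → ℂ, ContinuousOn G (Ioo a b) → G m = z → (∀ α ∈ Ioo a b, G α ∈ R α) →
        EqOn G F (Ioo a b) := by
  have : ContractibleSpace (Ioo a b) := (convex_Ioo a b).contractibleSpace ⟨m, hm⟩
  have : LocallyPathConnectedSpace (Ioo a b) := isOpen_Ioo.locallyPathConnectedSpace
  obtain ⟨L, ⟨hL1, hL2⟩, hL3⟩ := cov.existsUnique_continuousMap_lifts (A := Ioo a b)
    ⟨Subtype.val, continuous_subtype_val⟩ (a₀ := ⟨m, hm⟩) (e₀ := ⟨(m, z), hz⟩) rfl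
    (fun x => hab x.2)
  have hL4 : ∀ x, (L x).1.1 = x := fun x => congrFun hL2 x
  classical
  have hF : ∀ x : Ioo a b, (fun α => if h : α ∈ Ioo a b then (L ⟨α, h⟩).1.2 else 0) x =
      (L x).1.2 := fun x => by simp only [dif_pos x.2]
  refine ⟨fun α => if h : α ∈ Ioo a b then (L ⟨α, h⟩).1.2 else 0, ⟨?_, ?_, ?_⟩, ?_⟩
  · rw [continuousOn_iff_continuous_domRestrict]
    have : Continuous fun x => (L x).1.2 :=
      continuous_snd.comp (continuous_subtype_val.comp L.continuous)
    exact this.congr fun x => (hF x).symm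
  · rw [hF ⟨m, hm⟩, hL1]
  · intro α hα
    rw [hF ⟨α, hα⟩]
    have := (L ⟨α, hα⟩).2
    rwa [hL4] at this
  · intro G hG hGm hGR α hα
    have := hL3 ⟨fun x => ⟨(x, G x), hGR x x.2⟩, Continuous.subtype_mk
      (continuous_subtype_val.prodMk (continuousOn_iff_continuous_domRestrict.1 hG)) _⟩
      ⟨Subtype.ext (Prod.ext rfl hGm), rfl⟩
    rw [hF ⟨α, hα⟩, ← this]
    rfl

/-- A continuous section has a limit where the fibre is finite: otherwise, by the intermediate value
theorem, its cluster set would meet small circles around the points of the fibre. -/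
theorem exists_tendsto_section {K : Set ℂ} (hK : IsCompact K) (hRK : ∀ t, R t ⊆ K)
    (hcl : IsClosed {x : ℝ × ℂ | x.2 ∈ R x.1}) {b : ℝ} (hfin : (R b).Finite) {l : Filter ℝ}
    [NeBot l] (hl : ∀ S ∈ l, ∃ S' ∈ l, S' ⊆ S ∧ IsPreconnected S') (hlb : l ≤ 𝓝 b) {S : Set ℝ}
    (hS : S ∈ l) {F : ℝ → ℂ} (hF : ContinuousOn F S) (hFR : ∀ α ∈ S, F α ∈ R α) :
    ∃ w ∈ R b, Tendsto F l (𝓝 w) := by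
  have hclus : ∀ (l' : Filter ℝ), l' ≤ l → ∀ w, ClusterPt w (map F l') → w ∈ R b := by
    intro l' hl' w hw
    obtain ⟨u, hu, hw'⟩ := mapClusterPt_iff_ultrafilter.1 hw
    have h1 : Tendsto (fun α => (α, F α)) u (𝓝 (b, w)) :=
      Tendsto.prodMk_nhds (tendsto_id.mono_left ((hu.trans hl').trans hlb)) hw'
    refine hcl.mem_of_tendsto h1 ?_
    exact (hu.trans hl') (mem_of_superset hS hFR)
  have hev : map F l ≤ 𝓟 K := by
    rw [le_principal_iff]
    exact mem_map.2 (mem_of_superset hS fun α hα => hRK _ (hFR α hα))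
  obtain ⟨w, -, hw⟩ := hK hev
  have hwR := hclus l le_rfl w hw
  refine ⟨w, hwR, ?_⟩
  -- Small circles around `w` do not meet the fibre over `b`.
  have hiso : ∀ᶠ ε in 𝓝[>] (0 : ℝ), ∀ w' ∈ R b, dist w' w ≠ ε := by
    rw [eventually_all_finite hfin]
    intro w' _
    by_cases h : dist w' w = 0
    · filter_upwards [self_mem_nhdsWithin] with ε hε
      rw [h]
      exact (ne_of_gt hε).symm
    · exact (eventually_ne_nhds (Ne.symm h)).filter_mono nhdsWithin_le_nhds |>.mono
        fun ε hε => hε.symm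
  have hsmall : ∀ᶠ ε in 𝓝[>] (0 : ℝ), ∀ᶠ α in l, dist (F α) w < ε := by
    filter_upwards [hiso, self_mem_nhdsWithin] with ε hε hε0
    by_contra hnot
    -- The section comes arbitrarily close to `w` and leaves the disc of radius `ε` again and again.
    have hfreq : ∃ᶠ α in l, dist (F α) w = ε := by
      rw [frequently_iff]
      intro A hA
      obtain ⟨A', hA', hA'A, hconn⟩ := hl (A ∩ S) (inter_mem hA hS)
      obtain ⟨α₁, h1, h1'⟩ := frequently_iff.1
        (mapClusterPt_iff_frequently.1 hw _ (ball_mem_nhds w hε0)) hA'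
      obtain ⟨α₂, h2, h2'⟩ := frequently_iff.1 (not_eventually.1 hnot) hA'
      have hc : ContinuousOn (fun α => dist (F α) w) A' :=
        continuous_id.dist continuous_const |>.comp_continuousOn (hF.mono fun x hx => (hA'A hx).2)
      obtain ⟨α, hα, hα'⟩ := hconn.intermediate_value h1 h2 hc ⟨(mem_ball.1 h1').le, not_lt.1 h2'⟩
      exact ⟨α, (hA'A hα).1, hα'⟩
    have : NeBot (l ⊓ 𝓟 {α | dist (F α) w = ε}) := frequently_mem_iff_neBot.1 hfreq
    have h3 : map F (l ⊓ 𝓟 {α | dist (F α) w = ε}) ≤ 𝓟 (sphere w ε) := by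
      rw [le_principal_iff]
      exact mem_inf_of_right (fun α hα => hα)
    obtain ⟨w', hw', hc'⟩ := (isCompact_sphere w ε) h3
    exact hε w' (hclus _ inf_le_left w' hc') hw'
  rw [Metric.tendsto_nhds]
  intro ε hε
  obtain ⟨ε', h1, h2, h3⟩ := (hsmall.and (Ioo_mem_nhdsGT hε)).exists
  exact h1.mono fun α hα => hα.trans h3

/-- Sections over `]a, b[` extend continuously to `[a, b]`. -/
theorem exists_continuousOn_Icc_section {K : Set ℂ} (hK : IsCompact K) (hRK : ∀ t, R t ⊆ K)
    (hcl : IsClosed {x : ℝ × ℂ | x.2 ∈ R x.1}) (hfin : ∀ t, (R t).Finite) {a b : ℝ}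
    (hab : a < b) {F : ℝ → ℂ} (hF : ContinuousOn F (Ioo a b)) (hFR : ∀ α ∈ Ioo a b, F α ∈ R α) :
    ∃ G : ℝ → ℂ, ContinuousOn G (Icc a b) ∧ EqOn G F (Ioo a b) ∧ ∀ α ∈ Icc a b, G α ∈ R α := by
  obtain ⟨wa, hwa, ha⟩ := exists_tendsto_section hK hRK hcl (hfin a) (l := 𝓝[>] a) (fun S hS => by
    obtain ⟨c, hc, hcS⟩ := mem_nhdsGT_iff_exists_Ioo_subset.1 hS
    exact ⟨Ioo a c, Ioo_mem_nhdsGT hc, hcS, isPreconnected_Ioo⟩) nhdsWithin_le_nhds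
    (Ioo_mem_nhdsGT hab) hF hFR
  obtain ⟨wb, hwb, hb⟩ := exists_tendsto_section hK hRK hcl (hfin b) (l := 𝓝[<] b) (fun S hS => by
    obtain ⟨c, hc, hcS⟩ := mem_nhdsLT_iff_exists_Ioo_subset.1 hS
    exact ⟨Ioo c b, Ioo_mem_nhdsLT hc, hcS, isPreconnected_Ioo⟩) nhdsWithin_le_nhds
    (Ioo_mem_nhdsLT hab) hF hFR
  have hext : EqOn (extendFrom (Ioo a b) F) F (Ioo a b) := fun x hx =>
    extendFrom_extends hF x hx
  refine ⟨extendFrom (Ioo a b) F, continuousOn_Icc_extendFrom_Ioo hF ha hb, hext, ?_⟩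
  intro α hα
  rcases eq_or_lt_of_le hα.1 with rfl | h1
  · rwa [eq_lim_at_left_extendFrom_Ioo hab ha]
  rcases eq_or_lt_of_le hα.2 with rfl | h2
  · rwa [eq_lim_at_right_extendFrom_Ioo hab hb]
  rw [hext ⟨h1, h2⟩]
  exact hFR α ⟨h1, h2⟩

end Interval

end MahlerSymbol

/-! ### Cutting the curve over the unit circle into arcs -/

namespace MahlerSymbol

open Filter Metric Set

theorem e_add (α β : ℝ) : e (α + β) = e α * e β := by
  rw [e, e, e, ← Complex.exp_add]
  push_cast
  ring_nf

theorem norm_e (α : ℝ) : ‖e α‖ = 1 := by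
  rw [e, show 2 * Real.pi * Complex.I * (α : ℂ) = ((2 * Real.pi * α : ℝ) : ℂ) * Complex.I by
    push_cast; ring]
  exact Complex.norm_exp_ofReal_mul_I _

theorem e_ne_zero (α : ℝ) : e α ≠ 0 := Complex.exp_ne_zero _

theorem e_eq_e_iff {α β : ℝ} : e α = e β ↔ ∃ n : ℤ, α = β + n := by
  rw [e, e, Complex.exp_eq_exp_iff_exists_int]
  refine exists_congr fun n => ?_
  have h : (2 * Real.pi * Complex.I : ℂ) ≠ 0 := Complex.two_pi_I_ne_zero
  constructor
  · intro hn
    have : (2 * Real.pi * Complex.I : ℂ) * α = 2 * Real.pi * Complex.I * (β + n) := by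
      rw [hn]; ring
    exact_mod_cast mul_left_cancel₀ h this
  · rintro rfl
    push_cast
    ring

theorem hasDerivAt_e (α : ℝ) : HasDerivAt e (2 * Real.pi * Complex.I * e α) α := by
  have h1 : HasDerivAt (fun z : ℂ => Complex.exp (2 * Real.pi * Complex.I * z))
      (Complex.exp (2 * Real.pi * Complex.I * (α : ℂ)) * (2 * Real.pi * Complex.I * 1)) (α : ℂ) :=
    ((hasDerivAt_id (α : ℂ)).const_mul (2 * Real.pi * Complex.I)).cexp
  refine h1.comp_ofReal.congr_deriv ?_
  rw [e]
  ring

theorem continuous_e : Continuous e :=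
  continuous_iff_continuousAt.2 fun α => (hasDerivAt_e α).continuousAt

theorem exists_e_eq {t : ℂ} (ht : ‖t‖ = 1) : ∃ α ∈ Ico (0 : ℝ) 1, e α = t := by
  obtain ⟨θ, hθ⟩ := (Complex.norm_eq_one_iff t).1 ht
  refine ⟨Int.fract (θ / (2 * Real.pi)), ⟨Int.fract_nonneg _, Int.fract_lt_one _⟩, ?_⟩
  have h : e (Int.fract (θ / (2 * Real.pi))) = e (θ / (2 * Real.pi)) :=
    e_eq_e_iff.2 ⟨-⌊θ / (2 * Real.pi)⌋, by rw [Int.fract]; push_cast; ring⟩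
  rw [h, ← hθ, e]
  congr 1
  push_cast
  field_simp

theorem eq_of_e_eq {α β : ℝ} (hα : α ∈ Ioo (0 : ℝ) 1) (hβ : β ∈ Icc (0 : ℝ) 1)
    (h : e α = e β) : α = β := by
  obtain ⟨n, hn⟩ := e_eq_e_iff.1 h
  have h1 : (n : ℝ) < 1 := by linarith [hα.2, hβ.1]
  have h2 : (-1 : ℝ) < n := by linarith [hα.1, hβ.2]
  have h3 : n = 0 := by
    have : n < 1 := by exact_mod_cast h1
    have : -1 < n := by exact_mod_cast h2
    omega
  simpa [h3] using hn

theorem finite_setOf_e_mem {C : Set ℂ} (hC : C.Finite) : {α ∈ Icc (0 : ℝ) 1 | e α ∈ C}.Finite := by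
  have h : (Ioo (0 : ℝ) 1 ∩ e ⁻¹' C).Finite := by
    refine Set.Finite.of_finite_image (f := e) (hC.subset ?_) ?_
    · rintro _ ⟨α, hα, rfl⟩
      exact hα.2
    · exact fun α hα β hβ => eq_of_e_eq hα.1 (Ioo_subset_Icc_self hβ.1)
  refine (h.union (Set.toFinite {0, 1})).subset fun α hα => ?_
  rcases eq_or_lt_of_le hα.1.1 with h0 | h0
  · exact Or.inr (Or.inl h0.symm)
  rcases eq_or_lt_of_le hα.1.2 with h1 | h1
  · exact Or.inr (Or.inr h1)
  · exact Or.inl ⟨⟨h0, h1⟩, hα.2⟩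

/-- The points of the closed unit disc on the fibre of the curve over `e(α)`. -/
def discFiber (P : MvPolynomial (Fin 2) ℂ) (α : ℝ) : Set ℂ :=
  {z | ‖z‖ ≤ 1 ∧ evalAt P (e α, z) = 0}

theorem isClosed_discFiber (P : MvPolynomial (Fin 2) ℂ) :
    IsClosed {x : ℝ × ℂ | x.2 ∈ discFiber P x.1} := by
  have h : Continuous fun x : ℝ × ℂ => (e x.1, x.2) :=
    (continuous_e.comp continuous_fst).prodMk continuous_snd
  exact (isClosed_le (continuous_norm.comp continuous_snd) continuous_const).inter
    (isClosed_eq ((continuous_evalAt P).comp h) continuous_const)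

theorem fiberPoly_ne_zero {P : MvPolynomial (Fin 2) ℂ} {t : ℂ} (h : evalAt P (t, 0) ≠ 0) :
    fiberPoly P t ≠ 0 := fun h0 => h (by rw [← eval_fiberPoly, h0, Polynomial.eval_zero])

theorem finite_fiber {P : MvPolynomial (Fin 2) ℂ} {t : ℂ} (h : evalAt P (t, 0) ≠ 0) :
    {z | evalAt P (t, z) = 0}.Finite := by
  refine (Polynomial.finite_setOfPred_isRoot (fiberPoly_ne_zero h)).subset fun z hz => ?_
  rw [mem_ofPred_eq, Polynomial.IsRoot, eval_fiberPoly]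
  exact hz

variable {P : MvPolynomial (Fin 2) ℂ}

theorem finite_discFiber (hstar : ∀ z : ℂ, ‖z‖ = 1 → evalAt P (z, 0) ≠ 0) (α : ℝ) :
    (discFiber P α).Finite :=
  (finite_fiber (hstar _ (norm_e α))).subset fun _ hz => hz.2

theorem ne_zero_of_mem_discFiber (hstar : ∀ z : ℂ, ‖z‖ = 1 → evalAt P (z, 0) ≠ 0) {α : ℝ} {z : ℂ}
    (hz : z ∈ discFiber P α) : z ≠ 0 := by
  rintro rfl
  exact hstar _ (norm_e α) hz.2

theorem mem_discLocus (hstar : ∀ z : ℂ, ‖z‖ = 1 → evalAt P (z, 0) ≠ 0) {α : ℝ} {z : ℂ} :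
    (e α, z) ∈ discLocus P ↔ z ∈ discFiber P α :=
  ⟨fun h => ⟨h.2.2, h.1.2.2⟩, fun h => ⟨⟨e_ne_zero α, ne_zero_of_mem_discFiber hstar h, h.2⟩,
    norm_e α, h.1⟩⟩

/-- Off the critical values the fibres in the closed disc are locally the values of differentiable
functions. On the boundary of the disc this uses the symmetry of the curve: the inverse of a root
in the unit circle is a root nearby, so it is the same root. -/
theorem exists_local_section (hstar : ∀ z : ℂ, ‖z‖ = 1 → evalAt P (z, 0) ≠ 0) {C : Set ℂ}
    (hC : (∀ t z : ℂ, ‖t‖ = 1 → ‖z‖ = 1 → t ∉ C → evalAt P (t, z) ≠ 0) ∨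
        ∀ t z : ℂ, ‖t‖ = 1 → z ≠ 0 → evalAt P (t, z) = 0 →
          evalAt P (t, (starRingEnd ℂ z)⁻¹) = 0) {α : ℝ} {z : ℂ} (hα : e α ∉ C)
    (hz : z ∈ discFiber P α) (hd : evalAt (MvPolynomial.pderiv 1 P) (e α, z) ≠ 0) :
    ∃ h : ℝ → ℂ, h α = z ∧ (∀ᶠ β in 𝓝 α, DifferentiableAt ℝ h β) ∧
      (∀ᶠ β in 𝓝 α, h β ∈ discFiber P β) ∧
      ∀ᶠ q in 𝓝 (α, z), q.2 ∈ discFiber P q.1 → h q.1 = q.2 := by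
  obtain ⟨h, h1, h2, h3⟩ := exists_implicit (hasStrictFDerivAt_evalAt P) (continuous_evalAt _)
    hz.2 hd
  simp only at h1 h2
  have hcont : ∀ f : ℝ → ℂ, Tendsto f (𝓝 α) (𝓝 z) →
      Tendsto (fun β => (e β, f β)) (𝓝 α) (𝓝 (e α, z)) :=
    fun f hf => continuous_e.continuousAt.tendsto.prodMk_nhds hf
  have hlim : Tendsto (fun β => h (e β)) (𝓝 α) (𝓝 z) := by
    have := h2.self_of_nhds.continuousAt.tendsto.comp (continuous_e.tendsto α)
    rwa [h1] at this
  have hroot : ∀ᶠ β in 𝓝 α, evalAt P (e β, h (e β)) = 0 :=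
    ((hcont _ hlim).eventually h3).mono fun β hβ => hβ.2 rfl
  refine ⟨fun β => h (e β), h1, ?_, ?_, ?_⟩
  · filter_upwards [(continuous_e.tendsto α).eventually h2] with β hβ
    exact (hβ.restrictScalars ℝ).comp β (hasDerivAt_e β).differentiableAt
  · rcases lt_or_eq_of_le hz.1 with hlt | heq
    · filter_upwards [hroot, hlim.norm.eventually_lt_const hlt] with β h4 h5 using ⟨h5.le, h4⟩
    rcases hC with hC | hC
    · exact absurd hz.2 (hC _ _ (norm_e α) heq hα)
    have hz0 := ne_zero_of_mem_discFiber hstar hz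
    have hfix : (starRingEnd ℂ z)⁻¹ = z := by rw [← Complex.inv_eq_conj heq, inv_inv]
    have hlim' : Tendsto (fun β => (starRingEnd ℂ (h (e β)))⁻¹) (𝓝 α) (𝓝 z) := by
      have := ((Complex.continuous_conj.tendsto z).comp hlim).inv₀ ((map_ne_zero _).2 hz0)
      rwa [hfix] at this
    filter_upwards [hroot, (hcont _ hlim').eventually h3, hlim.eventually_ne hz0] with β h4 h5 h6
    have h7 := h5.1 (hC _ _ (norm_e β) h6 h4)
    have h8 : ‖h (e β)‖ ^ 2 = 1 := by
      have h9 : h (e β) * starRingEnd ℂ (h (e β)) = 1 := by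
        nth_rewrite 1 [h7]
        exact inv_mul_cancel₀ ((map_ne_zero _).2 h6)
      rw [Complex.mul_conj] at h9
      rw [Complex.sq_norm]
      exact_mod_cast h9
    exact ⟨by nlinarith [norm_nonneg (h (e β))], h4⟩
  · have hmap : Tendsto (fun q : ℝ × ℂ => (e q.1, q.2)) (𝓝 (α, z)) (𝓝 (e α, z)) :=
      ((continuous_e.comp continuous_fst).prodMk continuous_snd).tendsto (α, z)
    filter_upwards [hmap.eventually h3] with q hq hq' using hq.1 hq'.2

/-- A decomposition of the curve over the unit circle into arcs: finitely many critical arguments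
in `[0, 1]`, and the graphs of functions `F i` over the closed intervals between two consecutive
critical arguments, which are disjoint and exhaust the curve apart from the critical arguments. -/
structure ArcFamily (P : MvPolynomial (Fin 2) ℂ) where
  /-- the index set of the arcs -/
  ι : Type
  [fintype : Fintype ι]
  /-- the critical arguments -/
  crit : Finset ℝ
  /-- the arguments of the initial points -/
  lo : ι → ℝ
  /-- the arguments of the end points -/
  hi : ι → ℝ
  /-- the second coordinate along the arcs, as a function of the argument of the first -/
  F : ι → ℝ → ℂ
  crit_subset : ∀ α ∈ crit, α ∈ Icc (0 : ℝ) 1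
  zero_mem : (0 : ℝ) ∈ crit
  one_mem : (1 : ℝ) ∈ crit
  lo_mem : ∀ i, lo i ∈ crit
  hi_mem : ∀ i, hi i ∈ crit
  lt : ∀ i, lo i < hi i
  notMem : ∀ i, ∀ α ∈ Ioo (lo i) (hi i), α ∉ crit
  cont : ∀ i, ContinuousOn (F i) (Icc (lo i) (hi i))
  mem : ∀ i, ∀ α ∈ Icc (lo i) (hi i), F i α ∈ discFiber P α
  inj : ∀ i j, ∀ α ∈ Ioo (lo i) (hi i), α ∈ Ioo (lo j) (hi j) → F i α = F j α → i = j
  exists_eq : ∀ α ∈ Icc (0 : ℝ) 1, α ∉ crit → ∀ z ∈ discFiber P α,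
    ∃ i, α ∈ Ioo (lo i) (hi i) ∧ F i α = z
  pderiv_ne_zero : ∀ α ∈ Icc (0 : ℝ) 1, α ∉ crit → ∀ z, evalAt P (e α, z) = 0 →
    evalAt (MvPolynomial.pderiv 1 P) (e α, z) ≠ 0
  differentiableAt : ∀ i, ∀ α ∈ Ioo (lo i) (hi i), DifferentiableAt ℝ (F i) α

attribute [instance] ArcFamily.fintype

/-- The arcs are the sheets of the covering by the fibres in the closed disc, extended to the
end points of the intervals between consecutive critical arguments. The arguments `0` and `1` are
counted as critical, so that the circle is cut open. -/
theorem nonempty_arcFamily (hP : Irreducible P)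
    (hstar : ∀ z : ℂ, ‖z‖ = 1 → evalAt P (z, 0) ≠ 0) : Nonempty (ArcFamily P) := by
  classical
  obtain ⟨C, hCfin, hC1, hC2⟩ := exists_critical_values hP
  have hcov : IsCoveringMapOn (fun x : {x : ℝ × ℂ // x.2 ∈ discFiber P x.1} => x.1.1)
      {α | e α ∉ C} := by
    refine isCoveringMapOn_of_local_sections (isCompact_closedBall (0 : ℂ) 1)
      (fun α z hz => by simpa using hz.1) (isClosed_discFiber P)
      (fun α _ => finite_discFiber hstar α) fun α hα z hz => ?_
    obtain ⟨h, h1, h2, h3, h4⟩ := exists_local_section hstar hC2 hα hz (hC1 _ _ hα hz.2)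
    exact ⟨h, h1, h2.mono fun β hβ => hβ.continuousAt, h3, h4⟩
  let crit : Finset ℝ := insert 0 (insert 1 (finite_setOf_e_mem hCfin).toFinset)
  have hcrit : ∀ α, α ∈ crit ↔ α = 0 ∨ α = 1 ∨ α ∈ Icc (0 : ℝ) 1 ∧ e α ∈ C := fun α => by
    simp [crit]
  have hsub : ∀ α ∈ crit, α ∈ Icc (0 : ℝ) 1 := fun α hα => by
    rcases (hcrit α).1 hα with rfl | rfl | h
    · simp
    · simp
    · exact h.1
  -- An arc is given by its interval and its value at the midpoint.
  let ι : Type := Σ ab : {ab : crit × crit // ab.1.1 < ab.2.1 ∧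
    ∀ c ∈ crit, c ∉ Ioo ab.1.1 ab.2.1}, discFiber P ((ab.1.1.1 + ab.1.2.1) / 2)
  have : ∀ α, Finite (discFiber P α) := fun α => finite_discFiber hstar α
  have : Finite ι := inferInstanceAs (Finite (Σ _, _))
  let lo : ι → ℝ := fun i => i.1.1.1
  let hi : ι → ℝ := fun i => i.1.1.2
  have hlt : ∀ i, lo i < hi i := fun i => i.1.2.1
  have hIcc : ∀ i, Icc (lo i) (hi i) ⊆ Icc 0 1 := fun i =>
    Icc_subset_Icc (hsub _ i.1.1.1.2).1 (hsub _ i.1.1.2.2).2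
  have hnot : ∀ i, ∀ α ∈ Ioo (lo i) (hi i), α ∉ crit := fun i α hα hc => i.1.2.2 α hc hα
  have hIoo : ∀ i, Ioo (lo i) (hi i) ⊆ {α | e α ∉ C} := fun i α hα hc =>
    hnot i α hα ((hcrit α).2 (Or.inr (Or.inr ⟨hIcc i (Ioo_subset_Icc_self hα), hc⟩)))
  have hmid : ∀ i, (lo i + hi i) / 2 ∈ Ioo (lo i) (hi i) := fun i => by
    constructor <;> linarith [hlt i]
  choose F₀ hF₀ hF₀u using fun i : ι => existsUnique_section hcov (hIoo i) (hmid i) i.2.2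
  choose F hF1 hF2 hF3 using fun i : ι => exists_continuousOn_Icc_section
    (isCompact_closedBall (0 : ℂ) 1) (fun α z hz => by simpa using hz.1) (isClosed_discFiber P)
    (finite_discFiber hstar) (hlt i) (hF₀ i).1 (hF₀ i).2.2
  have hFmid : ∀ i, F i ((lo i + hi i) / 2) = i.2 := fun i => by
    rw [hF2 i (hmid i), (hF₀ i).2.1]
  -- An arc is determined by its value at any argument in the interior of its interval.
  have huniq : ∀ i, ∀ G : ℝ → ℂ, ContinuousOn G (Ioo (lo i) (hi i)) →
      (∀ α ∈ Ioo (lo i) (hi i), G α ∈ discFiber P α) →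
      ∀ α ∈ Ioo (lo i) (hi i), F i α = G α → EqOn (F i) G (Ioo (lo i) (hi i)) := by
    intro i G hG hGR α hα h
    obtain ⟨H, -, hH⟩ := existsUnique_section hcov (hIoo i) hα (hGR α hα)
    have h1 := hH G hG rfl hGR
    have h2 := hH (F i) ((hF1 i).mono Ioo_subset_Icc_self) h
      fun β hβ => hF3 i β (Ioo_subset_Icc_self hβ)
    exact fun β hβ => (h2 hβ).trans (h1 hβ).symm
  refine ⟨{
    ι := ι
    fintype := Fintype.ofFinite ι
    crit := crit
    lo := lo
    hi := hi
    F := F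
    crit_subset := hsub
    zero_mem := (hcrit 0).2 (Or.inl rfl)
    one_mem := (hcrit 1).2 (Or.inr (Or.inl rfl))
    lo_mem := fun i => i.1.1.1.2
    hi_mem := fun i => i.1.1.2.2
    lt := hlt
    notMem := hnot
    cont := hF1
    mem := hF3
    inj := ?_
    exists_eq := ?_
    pderiv_ne_zero := fun α hα hc z hz => hC1 _ _
      (fun h => hc ((hcrit α).2 (Or.inr (Or.inr ⟨hα, h⟩)))) hz
    differentiableAt := ?_ }⟩
  -- Arcs that meet over a non-critical argument have the same interval and the same midpoint.
  · intro i j α hi' hj' h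
    have h1 : lo i = lo j := by
      have a1 : ¬ (lo i < lo j) := fun h => i.1.2.2 (lo j) j.1.1.1.2 ⟨h, hj'.1.trans hi'.2⟩
      have a2 : ¬ (lo j < lo i) := fun h => j.1.2.2 (lo i) i.1.1.1.2 ⟨h, hi'.1.trans hj'.2⟩
      linarith
    have h2 : hi i = hi j := by
      have a1 : ¬ (hi i < hi j) := fun h => j.1.2.2 (hi i) i.1.1.2.2 ⟨hj'.1.trans hi'.2, h⟩
      have a2 : ¬ (hi j < hi i) := fun h => i.1.2.2 (hi j) j.1.1.2.2 ⟨hi'.1.trans hj'.2, h⟩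
      linarith
    have h3 := huniq i (F j) (by rw [h1, h2]; exact (hF1 j).mono Ioo_subset_Icc_self)
      (by rw [h1, h2]; exact fun β hβ => hF3 j β (Ioo_subset_Icc_self hβ)) α hi' h (hmid i)
    rw [hFmid, h1, h2, hFmid] at h3
    obtain ⟨⟨⟨⟨a, ha⟩, ⟨b, hb⟩⟩, hab⟩, z, hz⟩ := i
    obtain ⟨⟨⟨⟨a', ha'⟩, ⟨b', hb'⟩⟩, hab'⟩, z', hz'⟩ := j
    simp only [lo, hi] at h1 h2 h3
    subst h1 h2 h3
    rfl
  -- The interval of a non-critical argument is bounded by the nearest critical ones.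
  · intro α hα hc z hz
    have hα0 : α ≠ 0 := fun h => hc ((hcrit α).2 (Or.inl h))
    have hα1 : α ≠ 1 := fun h => hc ((hcrit α).2 (Or.inr (Or.inl h)))
    obtain ⟨a, ha, hamax⟩ := (crit.filter (· < α)).exists_maximal
      ⟨0, Finset.mem_filter.2 ⟨(hcrit 0).2 (Or.inl rfl), lt_of_le_of_ne hα.1 hα0.symm⟩⟩
    obtain ⟨b, hb, hbmin⟩ := (crit.filter (α < ·)).exists_minimal
      ⟨1, Finset.mem_filter.2 ⟨(hcrit 1).2 (Or.inr (Or.inl rfl)), lt_of_le_of_ne hα.2 hα1⟩⟩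
    rw [Finset.mem_filter] at ha hb
    let ab : {ab : crit × crit // ab.1.1 < ab.2.1 ∧ ∀ c ∈ crit, c ∉ Ioo ab.1.1 ab.2.1} :=
      ⟨(⟨a, ha.1⟩, ⟨b, hb.1⟩), ha.2.trans hb.2, fun c hcc hcI => by
        rcases lt_trichotomy c α with h | h | h
        · exact absurd (hamax (Finset.mem_filter.2 ⟨hcc, h⟩) hcI.1.le) (not_le.2 hcI.1)
        · exact hc (h ▸ hcc)
        · exact absurd (hbmin (Finset.mem_filter.2 ⟨hcc, h⟩) hcI.2.le) (not_le.2 hcI.2)⟩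
    have hsubs : Ioo a b ⊆ {α | e α ∉ C} := fun β hβ hcc =>
      ab.2.2 β ((hcrit β).2 (Or.inr (Or.inr ⟨⟨(hsub a ha.1).1.trans hβ.1.le,
        hβ.2.le.trans (hsub b hb.1).2⟩, hcc⟩))) hβ
    obtain ⟨G, ⟨hG1, hG2, hG3⟩, -⟩ := existsUnique_section hcov hsubs ⟨ha.2, hb.2⟩ hz
    have hm : (a + b) / 2 ∈ Ioo a b := by constructor <;> linarith [ha.2, hb.2]
    let i : ι := ⟨ab, G ((a + b) / 2), hG3 _ hm⟩
    refine ⟨i, ⟨ha.2, hb.2⟩, ?_⟩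
    rw [← hG2]
    exact huniq i G hG1 hG3 _ hm (hFmid i) ⟨ha.2, hb.2⟩
  · intro i α hα
    have hm := hF3 i α (Ioo_subset_Icc_self hα)
    obtain ⟨h, h1, h2, h3, h4⟩ := exists_local_section hstar hC2 (hIoo i hα) hm
      (hC1 _ _ (hIoo i hα) hm.2)
    refine h2.self_of_nhds.congr_of_eventuallyEq ?_
    have hcont : ContinuousAt (F i) α := (hF1 i).continuousAt (Icc_mem_nhds hα.1 hα.2)
    have hlim : Tendsto (fun β => (β, F i β)) (𝓝 α) (𝓝 (α, F i α)) :=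
      tendsto_id.prodMk_nhds hcont
    filter_upwards [hlim.eventually h4, Ioo_mem_nhds hα.1 hα.2] with β h5 h6
    exact (h5 (hF3 i β (Ioo_subset_Icc_self h6))).symm

end MahlerSymbol

/-! ### Branches of the curve near a point of the open disc -/

namespace MahlerSymbol

open Filter Metric Set

/-- The punctured disc is the image of a half plane under the exponential map. -/
theorem isPathConnected_punctured_ball (c : ℂ) {η : ℝ} (hη : 0 < η) :
    IsPathConnected (ball c η \ {c}) := by
  have h : ball c η \ {c} = (fun w => c + Complex.exp w) '' {w | w.re < Real.log η} := by
    ext t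
    constructor
    · rintro ⟨ht, htc⟩
      have h0 : t - c ≠ 0 := sub_ne_zero.2 htc
      refine ⟨Complex.log (t - c), ?_, by simp [Complex.exp_log h0]⟩
      rw [mem_ofPred_eq, Complex.log_re]
      exact Real.log_lt_log (norm_pos_iff.2 h0) (by rwa [mem_ball_iff_norm] at ht)
    · rintro ⟨w, hw, rfl⟩
      refine ⟨?_, by simp [Complex.exp_ne_zero]⟩
      rw [mem_ball_iff_norm, add_sub_cancel_left, Complex.norm_exp]
      exact (Real.lt_log_iff_exp_lt hη).1 hw
  rw [h]
  refine IsPathConnected.image ?_ (by fun_prop)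
  exact (convex_halfSpace_re_lt _).isPathConnected ⟨(Real.log η - 1 : ℝ), by simp⟩

/-- The fibres of a covering of a path connected set are equipotent. -/
theorem ncard_eq_of_isCoveringMapOn {T : Type*} [TopologicalSpace T] {R : T → Set ℂ} {s : Set T}
    (cov : IsCoveringMapOn (fun x : {x : T × ℂ // x.2 ∈ R x.1} => x.1.1) s)
    (hs : IsPathConnected s) {t u : T} (ht : t ∈ s) (hu : u ∈ s) :
    (R t).ncard = (R u).ncard := by
  have cov' := cov.isCoveringMap_restrictPreimage
  have hcard : ∀ t (ht : t ∈ s), Nat.card (s.restrictPreimage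
      (fun x : {x : T × ℂ // x.2 ∈ R x.1} => x.1.1) ⁻¹' {⟨t, ht⟩}) = (R t).ncard := by
    intro t ht
    refine Nat.card_eq_of_bijective (fun x => (⟨x.1.1.1.2, ?_⟩ : R t)) ⟨?_, ?_⟩
    · obtain ⟨⟨⟨⟨t', z⟩, hx⟩, hx'⟩, h⟩ := x
      have h' : t' = t := congrArg Subtype.val h
      subst h'
      exact hx
    · rintro ⟨⟨⟨⟨t', z⟩, hx⟩, hx'⟩, h⟩ ⟨⟨⟨⟨t'', z'⟩, hy⟩, hy'⟩, k⟩ hxy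
      have h1 : t' = t := congrArg Subtype.val h
      have h2 : t'' = t := congrArg Subtype.val k
      have h3 : z = z' := congrArg Subtype.val hxy
      subst h1 h2 h3
      rfl
    · rintro ⟨z, hz⟩
      exact ⟨⟨⟨⟨(t, z), hz⟩, ht⟩, rfl⟩, rfl⟩
  obtain ⟨γ⟩ : Joined (⟨t, ht⟩ : s) ⟨u, hu⟩ :=
    (isPathConnected_iff_pathConnectedSpace.1 hs).joined _ _
  rw [← hcard t ht, ← hcard u hu]
  exact Nat.card_eq_of_bijective _ (cov'.monodromy_bijective (Path.Homotopic.Quotient.mk γ))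

variable {P : MvPolynomial (Fin 2) ℂ}

/-- The number of points of the fibre close to a given point is constant on a punctured
neighbourhood of its first coordinate, because the curve is a covering of it. -/
theorem exists_ncard_eq (hP : Irreducible P) {p : ℂ × ℂ} (h0 : evalAt P (p.1, 0) ≠ 0) {r : ℝ}
    (hr : 0 < r) (hroot : ∀ z ∈ closedBall p.2 r, evalAt P (p.1, z) = 0 → z = p.2) :
    ∃ N : ℕ, ∀ᶠ t in 𝓝[≠] p.1, {z ∈ ball p.2 r | evalAt P (t, z) = 0}.ncard = N := by
  obtain ⟨C, hC, hC1, -⟩ := exists_critical_values hP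
  have hC' : ∀ᶠ t in 𝓝 p.1, t ≠ p.1 → t ∉ C := by
    have : (C \ {p.1})ᶜ ∈ 𝓝 p.1 := (hC.subset sdiff_subset).isClosed.isOpen_compl.mem_nhds (by simp)
    filter_upwards [this] with t ht hne htC using ht ⟨htC, hne⟩
  have hcont : ∀ z : ℂ, Continuous fun t : ℂ => evalAt P (t, z) := fun z =>
    (continuous_evalAt P).comp (continuous_id.prodMk continuous_const)
  -- No zero crosses the boundary of the disc around `p.2`.
  have hsphere : ∀ᶠ t in 𝓝 p.1, ∀ z ∈ sphere p.2 r, evalAt P (t, z) ≠ 0 := by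
    refine (isCompact_sphere p.2 r).eventually_forall_of_forall_eventually fun z hz => ?_
    refine (continuous_evalAt P).continuousAt.eventually_ne fun h => ?_
    have := hroot z (sphere_subset_closedBall hz) h
    rw [this, mem_sphere, dist_self] at hz
    exact hr.ne hz
  obtain ⟨η, hη, hball⟩ := Metric.eventually_nhds_iff_ball.1
    ((hC'.and hsphere).and ((hcont 0).continuousAt.eventually_ne h0))
  let R : ℂ → Set ℂ := fun t => {z ∈ closedBall p.2 r | evalAt P (t, z) = 0}
  have hcov : IsCoveringMapOn (fun x : {x : ℂ × ℂ // x.2 ∈ R x.1} => x.1.1)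
      (ball p.1 η \ {p.1}) := by
    refine isCoveringMapOn_of_local_sections (isCompact_closedBall p.2 r) (fun t z hz => hz.1)
      ?_ (fun t ht => (finite_fiber (hball t ht.1).2).subset fun z hz => hz.2) fun t ht z hz => ?_
    · exact (isClosed_closedBall.preimage continuous_snd).inter
        (isClosed_eq (continuous_evalAt P) continuous_const)
    · obtain ⟨h, h1, h2, h3⟩ := exists_implicit (hasStrictFDerivAt_evalAt P) (continuous_evalAt _)
        hz.2 (hC1 t z ((hball t ht.1).1.1 ht.2) hz.2)
      refine ⟨h, h1, h2.mono fun u hu => hu.continuousAt, ?_,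
        h3.mono fun q hq hq' => hq.1 hq'.2⟩
      have hlim : Tendsto h (𝓝 t) (𝓝 z) := by
        have := h2.self_of_nhds.continuousAt.tendsto
        rwa [show h t = z from h1] at this
      have hlt : z ∈ ball p.2 r := lt_of_le_of_ne hz.1 fun heq =>
        (hball t ht.1).1.2 z heq hz.2
      have hlim' : Tendsto (fun u => (u, h u)) (𝓝 t) (𝓝 (t, z)) := tendsto_id.prodMk_nhds hlim
      filter_upwards [hlim.eventually_mem (isOpen_ball.mem_nhds hlt), hlim'.eventually h3]
        with u hu hu' using ⟨ball_subset_closedBall hu, hu'.2 rfl⟩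
  have hpc := isPathConnected_punctured_ball p.1 hη
  obtain ⟨t₀, ht₀⟩ := hpc.nonempty
  refine ⟨(R t₀).ncard, ?_⟩
  have hmem : ball p.1 η \ {p.1} ∈ 𝓝[≠] p.1 :=
    inter_mem (mem_nhdsWithin_of_mem_nhds (ball_mem_nhds _ hη)) self_mem_nhdsWithin
  filter_upwards [hmem] with t ht
  rw [← ncard_eq_of_isCoveringMapOn hcov hpc ht ht₀]
  congr 1
  ext z
  refine ⟨fun h => ⟨ball_subset_closedBall h.1, h.2⟩, fun h => ⟨?_, h.2⟩⟩
  exact lt_of_le_of_ne h.1 fun heq => (hball t ht.1).1.2 z heq h.2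

/-! ### The arcs of `A` and their end points -/

namespace ArcFamily

variable (𝔸 : ArcFamily P)

theorem Icc_subset (i : 𝔸.ι) : Icc (𝔸.lo i) (𝔸.hi i) ⊆ Icc 0 1 :=
  Icc_subset_Icc (𝔸.crit_subset _ (𝔸.lo_mem i)).1 (𝔸.crit_subset _ (𝔸.hi_mem i)).2

/-- The points of the `i`-th arc. -/
noncomputable def pt (i : 𝔸.ι) (α : ℝ) : ℂ × ℂ := (e α, 𝔸.F i α)

theorem continuousOn_pt (i : 𝔸.ι) : ContinuousOn (𝔸.pt i) (Icc (𝔸.lo i) (𝔸.hi i)) :=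
  continuous_e.continuousOn.prodMk (𝔸.cont i)

theorem pt_lo_ne_pt_mid (i : 𝔸.ι) : (𝔸.pt i) (𝔸.lo i) ≠ 𝔸.pt i ((𝔸.lo i + 𝔸.hi i) / 2) := by
  intro h
  have h1 := congrArg Prod.fst h
  have hlt := 𝔸.lt i
  have h2 := 𝔸.Icc_subset i (left_mem_Icc.2 hlt.le)
  have h3 := 𝔸.Icc_subset i (right_mem_Icc.2 hlt.le)
  have := eq_of_e_eq (α := (𝔸.lo i + 𝔸.hi i) / 2) (β := 𝔸.lo i)
    ⟨by linarith [h2.1], by linarith [h3.2]⟩ h2 h1.symm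
  linarith

/-- The set `A` is the union of the arcs: what remains of the curve over the unit circle is a finite
set of points over the critical arguments, which are components by themselves. -/
theorem arcSet_eq (hstar : ∀ z : ℂ, ‖z‖ = 1 → evalAt P (z, 0) ≠ 0) :
    arcSet P = ⋃ i, 𝔸.pt i '' Icc (𝔸.lo i) (𝔸.hi i) := by
  have hsub : ∀ i, 𝔸.pt i '' Icc (𝔸.lo i) (𝔸.hi i) ⊆ discLocus P := by
    rintro i _ ⟨α, hα, rfl⟩
    exact (mem_discLocus hstar).2 (𝔸.mem i α hα)
  apply Subset.antisymm
  · rintro p ⟨hp, hcomp⟩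
    by_contra hnot
    let U : Set (ℂ × ℂ) := ⋃ i, 𝔸.pt i '' Icc (𝔸.lo i) (𝔸.hi i)
    let S : Set (ℂ × ℂ) := ⋃ c ∈ 𝔸.crit, (fun z => (e c, z)) '' discFiber P c
    have hUc : IsClosed U := isClosed_iUnion_of_finite fun i =>
      (isCompact_Icc.image_of_continuousOn (𝔸.continuousOn_pt i)).isClosed
    have hSf : S.Finite := 𝔸.crit.finite_toSet.biUnion fun c _ => (finite_discFiber hstar c).image _
    have hcover : discLocus P ⊆ U ∪ S := by
      rintro ⟨t, z⟩ hq
      obtain ⟨α, hα, rfl⟩ := exists_e_eq hq.2.1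
      have hz := (mem_discLocus hstar).1 hq
      by_cases hc : α ∈ 𝔸.crit
      · exact Or.inr (mem_biUnion hc ⟨z, hz, rfl⟩)
      · obtain ⟨i, hi, rfl⟩ := 𝔸.exists_eq α (Ico_subset_Icc_self hα) hc z hz
        exact Or.inl (mem_iUnion.2 ⟨i, α, Ioo_subset_Icc_self hi, rfl⟩)
    -- In the component of `p` the point `p` would be isolated.
    have hK := isPreconnected_connectedComponentIn (F := discLocus P) (x := p)
    have hpK : p ∈ connectedComponentIn (discLocus P) p := mem_connectedComponentIn hp
    obtain ⟨q, hqK, hqp⟩ := hcomp.exists_ne p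
    have hKsub := connectedComponentIn_subset (discLocus P) p
    obtain ⟨x, -, hx1, hx2⟩ := isPreconnected_closed_iff.1 hK {p} (U ∪ S \ {p}) isClosed_singleton
      (hUc.union (hSf.subset sdiff_subset).isClosed) (fun x hx => by
        by_cases h : x = p
        · exact Or.inl h
        · rcases hcover (hKsub hx) with h' | h'
          · exact Or.inr (Or.inl h')
          · exact Or.inr (Or.inr ⟨h', h⟩)) ⟨p, hpK, rfl⟩ ⟨q, hqK, by
        rcases hcover (hKsub hqK) with h' | h'
        · exact Or.inl h'
        · exact Or.inr ⟨h', hqp⟩⟩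
    rcases hx2 with h | h
    · exact hnot ((show x = p from hx1) ▸ h)
    · exact h.2 hx1
  · refine iUnion_subset fun i => ?_
    rintro _ ⟨α, hα, rfl⟩
    refine ⟨hsub i ⟨α, hα, rfl⟩, ?_⟩
    have hlt := 𝔸.lt i
    have hK : 𝔸.pt i '' Icc (𝔸.lo i) (𝔸.hi i) ⊆ connectedComponentIn (discLocus P) (𝔸.pt i α) :=
      (isPreconnected_Icc.image _ (𝔸.continuousOn_pt i)).subset_connectedComponentIn ⟨α, hα, rfl⟩
        (hsub i)
    exact ⟨_, hK ⟨_, left_mem_Icc.2 hlt.le, rfl⟩, _, hK ⟨(𝔸.lo i + 𝔸.hi i) / 2,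
      ⟨by linarith, by linarith⟩, rfl⟩, 𝔸.pt_lo_ne_pt_mid i⟩

theorem pt_mem_arcSet (hstar : ∀ z : ℂ, ‖z‖ = 1 → evalAt P (z, 0) ≠ 0) {i : 𝔸.ι} {α : ℝ}
    (hα : α ∈ Icc (𝔸.lo i) (𝔸.hi i)) : 𝔸.pt i α ∈ arcSet P := by
  rw [𝔸.arcSet_eq hstar]
  exact mem_iUnion.2 ⟨i, α, hα, rfl⟩

/-- Counting branches at `p` on one side of its argument `α`: if `J` is the set of arcs that lie on
this side of `α`, the branches are the arcs in `J` that tend to `p`. -/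
theorem eventually_branchCount (hstar : ∀ z : ℂ, ‖z‖ = 1 → evalAt P (z, 0) ≠ 0) {p : ℂ × ℂ}
    {α : ℝ} (hp : p.1 = e α) {l : Filter ℝ} (hl : l ≤ 𝓝 0) (J : 𝔸.ι → Prop)
    (h1 : ∀ᶠ δ in l, α + δ ∈ Icc (0 : ℝ) 1 ∧ α + δ ∉ 𝔸.crit)
    (h2 : ∀ᶠ δ in l, ∀ i, α + δ ∈ Ioo (𝔸.lo i) (𝔸.hi i) ↔ J i)
    (h3 : ∀ i, J i → α ∈ Icc (𝔸.lo i) (𝔸.hi i)) :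
    ∀ᶠ r in 𝓝[>] (0 : ℝ), ∀ᶠ δ in l,
      branchCount P p r δ = {i | J i ∧ 𝔸.pt i α = p}.ncard := by
  have hev : ∀ᶠ r in 𝓝[>] (0 : ℝ), ∀ w ∈ discFiber P α, w ≠ p.2 → r < dist w p.2 := by
    rw [eventually_all_finite (finite_discFiber hstar α)]
    intro w _
    by_cases hw : w = p.2
    · exact Eventually.of_forall fun r h => absurd hw h
    · exact ((eventually_lt_nhds (dist_pos.2 hw)).filter_mono nhdsWithin_le_nhds).mono
        fun r hr _ => hr
  filter_upwards [hev, self_mem_nhdsWithin] with r hr hr0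
  have hclose : ∀ᶠ δ in l, ∀ i, J i → (dist (𝔸.F i (α + δ)) p.2 < r ↔ 𝔸.F i α = p.2) := by
    rw [eventually_all]
    intro i
    by_cases hJ : J i
    swap
    · exact Eventually.of_forall fun δ h => absurd h hJ
    have hlim : Tendsto (fun δ => dist (𝔸.F i (α + δ)) p.2) l (𝓝 (dist (𝔸.F i α) p.2)) := by
      have hadd : Tendsto (fun δ => α + δ) l (𝓝[Icc (𝔸.lo i) (𝔸.hi i)] α) := by
        refine tendsto_nhdsWithin_iff.2 ⟨?_, ?_⟩
        · have : Tendsto (fun δ => α + δ) (𝓝 0) (𝓝 (α + 0)) := tendsto_id.const_add α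
          rw [add_zero] at this
          exact this.mono_left hl
        · filter_upwards [h2] with δ hδ
          exact Ioo_subset_Icc_self ((hδ i).2 hJ)
      exact (((𝔸.cont i) α (h3 i hJ)).tendsto.comp hadd).dist tendsto_const_nhds
    by_cases hw : 𝔸.F i α = p.2
    · rw [hw, dist_self] at hlim
      filter_upwards [hlim.eventually_lt_const hr0] with δ hδ _ using ⟨fun _ => hw, fun _ => hδ⟩
    · filter_upwards [hlim.eventually_const_lt (hr _ (𝔸.mem i α (h3 i hJ)) hw)] with δ hδ _
      exact ⟨fun h => absurd h (not_lt.2 hδ.le), fun h => absurd h hw⟩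
  filter_upwards [h1, h2, hclose] with δ a1 a2 a3
  -- The points counted by `branchCount` are those of the arcs in `J` that tend to `p`.
  have himage : {q ∈ arcSet P | q.1 = p.1 * e δ ∧ dist q.2 p.2 < r} =
      (fun i => 𝔸.pt i (α + δ)) '' {i | J i ∧ 𝔸.pt i α = p} := by
    ext ⟨t, z⟩
    constructor
    · rintro ⟨hq, hq1, hq2⟩
      rw [hp, ← e_add] at hq1
      simp only at hq1 hq2
      subst hq1
      obtain ⟨i, hi, rfl⟩ := 𝔸.exists_eq _ a1.1 a1.2 z ((mem_discLocus hstar).1 hq.1)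
      have hJ := (a2 i).1 hi
      exact ⟨i, ⟨hJ, Prod.ext hp.symm ((a3 i hJ).1 hq2)⟩, rfl⟩
    · rintro ⟨i, ⟨hJ, hi⟩, h⟩
      rw [← h]
      refine ⟨𝔸.pt_mem_arcSet hstar (Ioo_subset_Icc_self ((a2 i).2 hJ)), ?_, ?_⟩
      · rw [hp, ← e_add]; rfl
      · exact (a3 i hJ).2 (congrArg Prod.snd hi)
  rw [branchCount, himage, InjOn.ncard_image]
  intro i hi j hj hij
  exact 𝔸.inj i j _ ((a2 i).2 hi.1) ((a2 j).2 hj.1) (congrArg Prod.snd hij)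

theorem eventually_branchCount_right (hstar : ∀ z : ℂ, ‖z‖ = 1 → evalAt P (z, 0) ≠ 0) {p : ℂ × ℂ}
    {α : ℝ} (hα : α ∈ Ico (0 : ℝ) 1) (hp : p.1 = e α) :
    ∀ᶠ r in 𝓝[>] (0 : ℝ), ∀ᶠ δ in 𝓝[>] (0 : ℝ), branchCount P p r δ =
      {i | α ∈ Ico (𝔸.lo i) (𝔸.hi i) ∧ 𝔸.pt i α = p}.ncard := by
  have hc : ∀ᶠ δ in 𝓝[>] (0 : ℝ), ∀ c ∈ 𝔸.crit, c ≤ α ∨ α + δ < c := by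
    rw [eventually_all_finset]
    intro c _
    by_cases h : c ≤ α
    · exact Eventually.of_forall fun δ => Or.inl h
    · filter_upwards [Ioo_mem_nhdsGT (sub_pos.2 (not_le.1 h))] with δ hδ
      exact Or.inr (by linarith [hδ.2])
  refine 𝔸.eventually_branchCount hstar hp nhdsWithin_le_nhds _ ?_ ?_ fun i hi =>
    Ico_subset_Icc_self hi
  · filter_upwards [hc, Ioo_mem_nhdsGT (sub_pos.2 hα.2)] with δ h1 h2
    refine ⟨⟨by linarith [hα.1, h2.1], by linarith [h2.2]⟩, fun h => ?_⟩
    rcases h1 _ h with h | h <;> linarith [h2.1]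
  · filter_upwards [hc, self_mem_nhdsWithin] with δ h1 (h2 : 0 < δ) i
    constructor
    · intro h
      refine ⟨(h1 _ (𝔸.lo_mem i)).resolve_right (not_lt.2 h.1.le), by linarith [h.2]⟩
    · intro h
      exact ⟨by linarith [h.1], (h1 _ (𝔸.hi_mem i)).resolve_left (not_le.2 h.2)⟩

theorem eventually_branchCount_left (hstar : ∀ z : ℂ, ‖z‖ = 1 → evalAt P (z, 0) ≠ 0) {p : ℂ × ℂ}
    {α : ℝ} (hα : α ∈ Ioc (0 : ℝ) 1) (hp : p.1 = e α) :
    ∀ᶠ r in 𝓝[>] (0 : ℝ), ∀ᶠ δ in 𝓝[>] (0 : ℝ), branchCount P p r (-δ) =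
      {i | α ∈ Ioc (𝔸.lo i) (𝔸.hi i) ∧ 𝔸.pt i α = p}.ncard := by
  have hc : ∀ᶠ δ in 𝓝[<] (0 : ℝ), ∀ c ∈ 𝔸.crit, α ≤ c ∨ c < α + δ := by
    rw [eventually_all_finset]
    intro c _
    by_cases h : α ≤ c
    · exact Eventually.of_forall fun δ => Or.inl h
    · filter_upwards [Ioo_mem_nhdsLT (sub_neg.2 (not_le.1 h))] with δ hδ
      exact Or.inr (by linarith [hδ.1])
  have hneg : Tendsto (fun δ : ℝ => -δ) (𝓝[>] 0) (𝓝[<] 0) := by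
    have := tendsto_neg_nhdsGT (a := (0 : ℝ))
    rwa [neg_zero] at this
  have key := 𝔸.eventually_branchCount hstar hp (l := 𝓝[<] 0) nhdsWithin_le_nhds
    (fun i => α ∈ Ioc (𝔸.lo i) (𝔸.hi i)) ?_ ?_ fun i hi => Ioc_subset_Icc_self hi
  · exact key.mono fun r hr => hneg.eventually hr
  · have h0 : 0 - α < 0 := by linarith [hα.1]
    filter_upwards [hc, Ioo_mem_nhdsLT h0] with δ h1 h2
    refine ⟨⟨by linarith [h2.1], by linarith [hα.2, h2.2]⟩, fun h => ?_⟩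
    rcases h1 _ h with h | h <;> linarith [h2.2]
  · filter_upwards [hc, self_mem_nhdsWithin] with δ h1 (h2 : δ < 0) i
    constructor
    · intro h
      exact ⟨by linarith [h.1], (h1 _ (𝔸.hi_mem i)).resolve_right (not_lt.2 h.2.le)⟩
    · intro h
      exact ⟨(h1 _ (𝔸.lo_mem i)).resolve_left (not_le.2 h.1), by linarith [h.2]⟩

theorem lo_lt_one (i : 𝔸.ι) : 𝔸.lo i < 1 :=
  (𝔸.lt i).trans_le (𝔸.Icc_subset i (right_mem_Icc.2 (𝔸.lt i).le)).2

theorem zero_lt_hi (i : 𝔸.ι) : 0 < 𝔸.hi i :=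
  (𝔸.Icc_subset i (left_mem_Icc.2 (𝔸.lt i).le)).1.trans_lt (𝔸.lt i)

/-- The points of `R_P` are those at which the numbers of arcs starting and ending differ. -/
theorem mem_boundaryPts_iff (hstar : ∀ z : ℂ, ‖z‖ = 1 → evalAt P (z, 0) ≠ 0) {p : ℂ × ℂ}
    (hp : p ∈ arcSet P) : p ∈ boundaryPts P ↔
      {i | 𝔸.pt i (𝔸.hi i) = p}.ncard ≠ {i | 𝔸.pt i (𝔸.lo i) = p}.ncard := by
  have hconst : ∀ {m n : ℕ}, (∀ᶠ r in 𝓝[>] (0 : ℝ), ∀ᶠ δ in 𝓝[>] (0 : ℝ),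
      branchCount P p r (-δ) = m) → (∀ᶠ r in 𝓝[>] (0 : ℝ), ∀ᶠ δ in 𝓝[>] (0 : ℝ),
      branchCount P p r δ = n) → (p ∈ boundaryPts P ↔ m ≠ n) := by
    intro m n hm hn
    refine ⟨fun h hmn => h.2 ?_, fun h => ⟨hp, fun h' => h ?_⟩⟩
    · filter_upwards [hm, hn] with r h1 h2
      filter_upwards [h1, h2] with δ h3 h4
      rw [h3, h4, hmn]
    · obtain ⟨r, h1, h2, h3⟩ := (hm.and (hn.and h')).exists
      obtain ⟨δ, h4, h5, h6⟩ := (h1.and (h2.and h3)).exists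
      rw [← h4, ← h5, h6]
  obtain ⟨α, hα, he⟩ := exists_e_eq hp.1.2.1
  by_cases hc : α ∈ 𝔸.crit
  · have hright : {i | α ∈ Ico (𝔸.lo i) (𝔸.hi i) ∧ 𝔸.pt i α = p} =
        {i | 𝔸.pt i (𝔸.lo i) = p} := by
      ext i
      constructor
      · rintro ⟨h1, h2⟩
        rcases eq_or_lt_of_le h1.1 with h | h
        · rwa [← h] at h2
        · exact absurd hc (𝔸.notMem i α ⟨h, h1.2⟩)
      · intro h
        have h1 : e (𝔸.lo i) = e α := by rw [he]; exact congrArg Prod.fst h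
        have h0 := (𝔸.Icc_subset i (left_mem_Icc.2 (𝔸.lt i).le)).1
        have h2 : 𝔸.lo i = α := by
          rcases eq_or_lt_of_le hα.1 with h3 | h3
          · rcases eq_or_lt_of_le h0 with h4 | h4
            · rw [← h3, ← h4]
            · exact eq_of_e_eq ⟨h4, 𝔸.lo_lt_one i⟩ (Ico_subset_Icc_self hα) h1
          · exact (eq_of_e_eq ⟨h3, hα.2⟩ ⟨h0, (𝔸.lo_lt_one i).le⟩ h1.symm).symm
        exact ⟨⟨h2.le, h2 ▸ 𝔸.lt i⟩, h2 ▸ h⟩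
    -- To the left of the point with argument `0` one has to start from the argument `1`.
    obtain ⟨β, hβ, hβe, hβc⟩ : ∃ β ∈ Ioc (0 : ℝ) 1, e β = e α ∧ β ∈ 𝔸.crit := by
      rcases eq_or_lt_of_le hα.1 with h3 | h3
      · exact ⟨1, by simp, e_eq_e_iff.2 ⟨1, by simp [← h3]⟩, 𝔸.one_mem⟩
      · exact ⟨α, ⟨h3, hα.2.le⟩, rfl, hc⟩
    have hleft : {i | β ∈ Ioc (𝔸.lo i) (𝔸.hi i) ∧ 𝔸.pt i β = p} =
        {i | 𝔸.pt i (𝔸.hi i) = p} := by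
      ext i
      constructor
      · rintro ⟨h1, h2⟩
        rcases eq_or_lt_of_le h1.2 with h | h
        · rwa [h] at h2
        · exact absurd hβc (𝔸.notMem i β ⟨h1.1, h⟩)
      · intro h
        have h1 : e (𝔸.hi i) = e β := by rw [hβe, he]; exact congrArg Prod.fst h
        have h0 := (𝔸.Icc_subset i (right_mem_Icc.2 (𝔸.lt i).le)).2
        have h2 : 𝔸.hi i = β := by
          rcases eq_or_lt_of_le hβ.2 with h3 | h3
          · rcases eq_or_lt_of_le h0 with h4 | h4
            · rw [h3, h4]
            · exact eq_of_e_eq ⟨𝔸.zero_lt_hi i, h4⟩ (Ioc_subset_Icc_self hβ) h1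
          · exact (eq_of_e_eq ⟨hβ.1, h3⟩ ⟨(𝔸.zero_lt_hi i).le, h0⟩ h1.symm).symm
        exact ⟨⟨h2 ▸ 𝔸.lt i, h2.ge⟩, h2 ▸ h⟩
    rw [← hright, ← hleft]
    exact hconst (𝔸.eventually_branchCount_left hstar hβ (he.symm.trans hβe.symm))
      (𝔸.eventually_branchCount_right hstar hα he.symm)
  -- Over a non-critical argument arcs neither start nor end.
  · have hα0 : 0 < α := lt_of_le_of_ne hα.1 fun h => hc (h ▸ 𝔸.zero_mem)
    have hne : ∀ i, ∀ c ∈ 𝔸.crit, 𝔸.pt i c ≠ p := by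
      intro i c hcc h
      have h1 : e α = e c := by rw [he]; exact (congrArg Prod.fst h).symm
      exact hc (eq_of_e_eq ⟨hα0, hα.2⟩ (𝔸.crit_subset c hcc) h1 ▸ hcc)
    have hboth : {i | α ∈ Ioc (𝔸.lo i) (𝔸.hi i) ∧ 𝔸.pt i α = p} =
        {i | α ∈ Ico (𝔸.lo i) (𝔸.hi i) ∧ 𝔸.pt i α = p} := by
      ext i
      refine and_congr_left fun _ => ⟨fun h => ⟨h.1.le, lt_of_le_of_ne h.2 ?_⟩,
        fun h => ⟨lt_of_le_of_ne h.1 ?_, h.2.le⟩⟩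
      · exact fun h => hc (h ▸ 𝔸.hi_mem i)
      · exact fun h => hc (h ▸ 𝔸.lo_mem i)
    have h1 := hconst (𝔸.eventually_branchCount_left hstar ⟨hα0, hα.2.le⟩ he.symm)
      (𝔸.eventually_branchCount_right hstar hα he.symm)
    rw [hboth] at h1
    simp [h1, hne _ _ (𝔸.hi_mem _), hne _ _ (𝔸.lo_mem _)]

theorem finite_boundaryPts (𝔸 : ArcFamily P) (hstar : ∀ z : ℂ, ‖z‖ = 1 → evalAt P (z, 0) ≠ 0) :
    (boundaryPts P).Finite := by
  have h : (range (fun i => 𝔸.pt i (𝔸.hi i)) ∪ range fun i => 𝔸.pt i (𝔸.lo i)).Finite :=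
    (finite_range _).union (finite_range _)
  refine h.subset fun p hp => ?_
  by_contra hnot
  refine (𝔸.mem_boundaryPts_iff hstar hp.1).1 hp ?_
  have h1 : {i | 𝔸.pt i (𝔸.hi i) = p} = ∅ :=
    eq_empty_of_forall_notMem fun i hi => hnot (Or.inl ⟨i, hi⟩)
  have h2 : {i | 𝔸.pt i (𝔸.lo i) = p} = ∅ :=
    eq_empty_of_forall_notMem fun i hi => hnot (Or.inr ⟨i, hi⟩)
  rw [h1, h2]

/-- At a point inside the open disc as many arcs end as start: on both sides their number is the
number of sheets of the projection to the `t₁`-line near the point. -/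
theorem boundaryPts_subset_torus (𝔸 : ArcFamily P) (hP : Irreducible P)
    (hstar : ∀ z : ℂ, ‖z‖ = 1 → evalAt P (z, 0) ≠ 0) : boundaryPts P ⊆ torus := by
  intro p hp
  refine ⟨hp.1.1.2.1, ?_⟩
  by_contra hnorm
  have hlt : ‖p.2‖ < 1 := lt_of_le_of_ne hp.1.1.2.2 hnorm
  refine hp.2 ?_
  have hfin := finite_fiber (hstar _ hp.1.1.2.1)
  have hev : ∀ᶠ r in 𝓝[>] (0 : ℝ), ∀ w ∈ {z | evalAt P (p.1, z) = 0}, w ≠ p.2 → r < dist w p.2 := by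
    rw [eventually_all_finite hfin]
    intro w _
    by_cases hw : w = p.2
    · exact Eventually.of_forall fun r h => absurd hw h
    · exact ((eventually_lt_nhds (dist_pos.2 hw)).filter_mono nhdsWithin_le_nhds).mono
        fun r hr _ => hr
  -- For `r < 1 - ‖p.2‖` all zeros that are `r`-close to `p.2` lie in the unit disc.
  filter_upwards [hev, Ioo_mem_nhdsGT (sub_pos.2 hlt)] with r h1 h2
  obtain ⟨N, hN⟩ := exists_ncard_eq hP (p := p) (hstar _ hp.1.1.2.1) h2.1 fun z hz hz0 => by
    by_contra hne
    exact absurd (h1 z hz0 hne) (not_lt.2 hz)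
  have hB : ∀ᶠ t in 𝓝[≠] p.1, t ∉ e '' 𝔸.crit := by
    have hBf : ((e '' 𝔸.crit) \ {p.1}).Finite := (𝔸.crit.finite_toSet.image e).subset sdiff_subset
    have : ((e '' 𝔸.crit) \ {p.1})ᶜ ∈ 𝓝 p.1 := hBf.isClosed.isOpen_compl.mem_nhds (by simp)
    filter_upwards [mem_nhdsWithin_of_mem_nhds this, self_mem_nhdsWithin] with t ht hne htC
      using ht ⟨htC, hne⟩
  have hcount : ∀ᶠ δ in 𝓝[≠] (0 : ℝ), branchCount P p r δ = N := by
    have hp0 : p.1 ≠ 0 := hp.1.1.1.1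
    have hlim : Tendsto (fun δ => p.1 * e δ) (𝓝[≠] 0) (𝓝[≠] p.1) := by
      refine tendsto_nhdsWithin_iff.2 ⟨?_, ?_⟩
      · have : Tendsto (fun δ => p.1 * e δ) (𝓝 0) (𝓝 (p.1 * e 0)) :=
          (continuous_e.tendsto 0).const_mul p.1
        rw [show e 0 = 1 by simp [e], mul_one] at this
        exact this.mono_left nhdsWithin_le_nhds
      · filter_upwards [mem_nhdsWithin_of_mem_nhds (Ioo_mem_nhds (show (-1 : ℝ) < 0 by norm_num)
          (show (0 : ℝ) < 1 by norm_num)), self_mem_nhdsWithin] with δ h3 h4 h5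
        have h6 : e δ = e 0 := by
          rw [show e 0 = 1 by simp [e]]
          exact mul_left_cancel₀ hp0 (h5.trans (mul_one _).symm)
        obtain ⟨n, hn⟩ := e_eq_e_iff.1 h6
        rw [zero_add] at hn
        rw [hn] at h3 h4
        have h7 : (-1 : ℤ) < n := by exact_mod_cast h3.1
        have h8 : n < 1 := by exact_mod_cast h3.2
        exact h4 (by simp [show n = 0 by omega])
    filter_upwards [hlim.eventually hN, hlim.eventually hB] with δ h3 h4
    rw [← h3, branchCount]
    have himage : {q ∈ arcSet P | q.1 = p.1 * e δ ∧ dist q.2 p.2 < r} =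
        (fun z => (p.1 * e δ, z)) '' {z ∈ ball p.2 r | evalAt P (p.1 * e δ, z) = 0} := by
      ext ⟨t, z⟩
      constructor
      · rintro ⟨hq, rfl, hq2⟩
        exact ⟨z, ⟨hq2, hq.1.1.2.2⟩, rfl⟩
      · rintro ⟨w, ⟨hw1, hw2⟩, h⟩
        obtain ⟨rfl, rfl⟩ := Prod.mk.inj h
        refine ⟨?_, rfl, hw1⟩
        have hunit : ‖p.1 * e δ‖ = 1 := by rw [norm_mul, norm_e, mul_one]; exact hp.1.1.2.1
        obtain ⟨β, hβ, hβe⟩ := exists_e_eq hunit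
        have hβc : β ∉ 𝔸.crit := fun hc => h4 ⟨β, hc, hβe⟩
        have hw : ‖w‖ ≤ 1 := by
          have := norm_sub_norm_le w p.2
          rw [mem_ball_iff_norm] at hw1
          linarith [h2.2]
        rw [← hβe] at hw2
        obtain ⟨i, hi, rfl⟩ := 𝔸.exists_eq β (Ico_subset_Icc_self hβ) hβc w ⟨hw, hw2⟩
        rw [← hβe]
        exact 𝔸.pt_mem_arcSet hstar (Ioo_subset_Icc_self hi)
    rw [himage, ncard_image_of_injective _ fun a b h => congrArg Prod.snd h]
  have hr : ∀ᶠ δ in 𝓝[>] (0 : ℝ), branchCount P p r δ = N :=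
    hcount.filter_mono (nhdsWithin_mono _ fun x (hx : 0 < x) => hx.ne')
  have hneg : Tendsto (fun δ : ℝ => -δ) (𝓝[>] 0) (𝓝[≠] 0) := by
    have := tendsto_neg_nhdsGT (a := (0 : ℝ))
    rw [neg_zero] at this
    exact this.mono_right (nhdsWithin_mono _ fun x (hx : x < 0) => hx.ne)
  filter_upwards [hr, hneg.eventually hcount] with δ h3 h4
  rw [h3, h4]

end ArcFamily

end MahlerSymbol

/-! ### Singular cocycles on affine simplices -/

namespace MahlerSymbol

open Filter Metric Set

section Affine

variable {E : Type*} [AddCommGroup E] [Module ℝ E] [TopologicalSpace E] [IsTopologicalAddGroup E]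
  [ContinuousSMul ℝ E] {K : Set E}

/-- The affine simplex with given vertices in a convex set. -/
noncomputable def affSimplex (hK : Convex ℝ K) {n : ℕ} (v : Fin (n + 1) → K) : Simplex n K where
  toFun a := ⟨∑ i, a i • (v i : E), hK.sum_mem (fun i _ => a.2.1 i) a.2.2 fun i _ => (v i).2⟩
  continuous_toFun := by
    refine Continuous.subtype_mk (continuous_finsetSum _ fun i _ => ?_) _
    exact ((continuous_apply i).comp continuous_subtype_val).smul continuous_const

theorem face_affSimplex (hK : Convex ℝ K) {n : ℕ} (v : Fin (n + 2) → K) (i : Fin (n + 2)) :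
    face i (affSimplex hK v) = affSimplex hK (v ∘ i.succAbove) := by
  ext a
  change ∑ j, FunOnFinite.linearMap ℝ ℝ i.succAbove a j • (v j : E) =
    ∑ j, a j • (v (i.succAbove j) : E)
  simp only [FunOnFinite.linearMap_apply_apply, Finset.sum_smul]
  rw [← Finset.sum_fiberwise Finset.univ i.succAbove]
  refine Finset.sum_congr rfl fun j _ => Finset.sum_congr rfl fun k hk => ?_
  rw [(Finset.mem_filter.1 hk).2]

variable {X : Type*} [TopologicalSpace X] {M : Type*} [AddCommGroup M] {g : Cochain 1 X M}

/-- The singular segment from `x` to `y` in a convex set, mapped by `H`. -/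
noncomputable def segSimplex (hK : Convex ℝ K) (H : C(K, X)) (x y : K) : Simplex 1 X :=
  H.comp (affSimplex hK ![x, y])

/-- A cocycle is additive on the edges of an affine triangle. -/
theorem cocycle_add (hg : coboundary 1 X M g = 0) (hK : Convex ℝ K) (H : C(K, X)) (x y z : K) :
    g (segSimplex hK H x y) + g (segSimplex hK H y z) = g (segSimplex hK H x z) := by
  have h := congrFun hg (H.comp (affSimplex hK ![x, y, z]))
  have hf : ∀ i, face i (H.comp (affSimplex hK ![x, y, z])) =
      H.comp (affSimplex hK (![x, y, z] ∘ i.succAbove)) := fun i => by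
    rw [← face_affSimplex]; rfl
  have h0 : ![x, y, z] ∘ (0 : Fin 3).succAbove = ![y, z] := by
    ext i; fin_cases i <;> rfl
  have h1 : ![x, y, z] ∘ (1 : Fin 3).succAbove = ![x, z] := by
    ext i; fin_cases i <;> rfl
  have h2 : ![x, y, z] ∘ (2 : Fin 3).succAbove = ![x, y] := by
    ext i; fin_cases i <;> rfl
  change ∑ i : Fin 3, ((-1 : ℤ) ^ (i : ℕ)) •
    g (face i (H.comp (affSimplex hK ![x, y, z]))) = 0 at h
  rw [Fin.sum_univ_three, hf, hf, hf, h0, h1, h2] at h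
  simp only [Fin.val_zero, pow_zero, one_smul, Fin.val_one, pow_one, neg_smul, Fin.val_two,
    even_two, Even.neg_pow, one_pow] at h
  change g (segSimplex hK H y z) + -g (segSimplex hK H x z) + g (segSimplex hK H x y) = 0 at h
  rw [← sub_eq_zero, ← h]
  abel

theorem cocycle_seg_self (hg : coboundary 1 X M g = 0) (hK : Convex ℝ K) (H : C(K, X)) (x : K) :
    g (segSimplex hK H x x) = 0 := by
  have := cocycle_add hg hK H x x x
  rwa [add_eq_right] at this

end Affine

section Paths

variable {X : Type*} [TopologicalSpace X] {M : Type*} [AddCommGroup M] {g : Cochain 1 X M}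

theorem convex_unitInterval : Convex ℝ unitInterval := convex_Icc 0 1

theorem affSimplex_unitInterval_apply (x y : unitInterval) (a : stdSimplex ℝ (Fin 2)) :
    (affSimplex convex_unitInterval ![x, y] a : ℝ) = (1 - a 1) * x + a 1 * y := by
  have : a 0 = 1 - a 1 := by linarith [stdSimplex.add_eq_one a]
  change ∑ i, a i • ((![x, y] i : unitInterval) : ℝ) = _
  simp [Fin.sum_univ_two, this]

/-- The part of a path between the parameters `x` and `y`, run through affinely (and backwards if
`y < x`). -/
noncomputable def subPath (γ : C(unitInterval, X)) (x y : unitInterval) : C(unitInterval, X) where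
  toFun t := γ ⟨(1 - t) * x + t * y, by
    exact convex_unitInterval x.2 y.2 (sub_nonneg.2 t.2.2) t.2.1 (by ring)⟩
  continuous_toFun := by fun_prop

theorem segSimplex_unitInterval (γ : C(unitInterval, X)) (x y : unitInterval) :
    segSimplex convex_unitInterval γ x y = simplexOfPath (subPath γ x y) := by
  ext a
  refine congrArg γ (Subtype.ext ?_)
  rw [affSimplex_unitInterval_apply]
  rfl

theorem subPath_zero_one (γ : C(unitInterval, X)) : subPath γ 0 1 = γ := by
  ext t
  refine congrArg γ (Subtype.ext ?_)
  simp

/-- Every singular `1`-simplex is the simplex of a path. -/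
theorem exists_simplexOfPath (σ : Simplex 1 X) : ∃ γ : C(unitInterval, X), simplexOfPath γ = σ := by
  refine ⟨σ.comp ⟨stdSimplexHomeomorphUnitInterval.symm,
    stdSimplexHomeomorphUnitInterval.symm.continuous⟩, ?_⟩
  ext a
  exact congrArg σ (stdSimplexHomeomorphUnitInterval.symm_apply_apply a)

/-- A cocycle that vanishes on all sufficiently small paths vanishes. -/
theorem cocycle_eq_zero_of_locally (hg : coboundary 1 X M g = 0)
    (hloc : ∀ p : X, ∃ W ∈ 𝓝 p, ∀ γ : C(unitInterval, X), range γ ⊆ W →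
      g (simplexOfPath γ) = 0) : g = 0 := by
  funext σ
  obtain ⟨γ, rfl⟩ := exists_simplexOfPath σ
  -- The value on the initial part of the path is locally constant as a function of its end.
  let u : unitInterval → M := fun t => g (segSimplex convex_unitInterval γ 0 t)
  have hu : IsLocallyConstant u := by
    rw [IsLocallyConstant.iff_eventually_eq]
    intro s
    obtain ⟨W, hW, hgW⟩ := hloc (γ s)
    obtain ⟨ε, hε, hball⟩ := Metric.mem_nhds_iff.1 (γ.continuous.continuousAt hW)
    filter_upwards [ball_mem_nhds s hε] with t ht
    have h1 := cocycle_add hg convex_unitInterval γ 0 s t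
    rw [segSimplex_unitInterval γ s t, hgW _ ?_, add_zero] at h1
    · exact h1.symm
    · rintro _ ⟨x, rfl⟩
      refine hball ?_
      have h2 := (convex_ball (s : ℝ) ε) (mem_ball_self hε) (show (t : ℝ) ∈ ball (s : ℝ) ε from ht)
        (sub_nonneg.2 x.2.2) x.2.1 (by ring)
      exact h2
  have h1 : u 1 = u 0 := hu.apply_eq_of_isPreconnected isPreconnected_univ (mem_univ _) (mem_univ _)
  have h2 : u 0 = 0 := cocycle_seg_self hg _ _ _
  rw [h2] at h1
  have h3 := segSimplex_unitInterval γ 0 1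
  rw [subPath_zero_one] at h3
  rw [← h3]
  exact h1

/-- `c` is the path that runs through `a` and then through `b`, at double speed. The condition is
phrased by the two halves of `c`, as this is what cocycles see. -/
def IsConcat (a b c : C(unitInterval, X)) : Prop :=
  a 1 = b 0 ∧ subPath c 0 ⟨1 / 2, by norm_num, by norm_num⟩ = a ∧
    subPath c ⟨1 / 2, by norm_num, by norm_num⟩ 1 = b

theorem cocycle_concat (hg : coboundary 1 X M g = 0) {a b c : C(unitInterval, X)}
    (h : IsConcat a b c) :
    g (simplexOfPath a) + g (simplexOfPath b) = g (simplexOfPath c) := by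
  rw [← h.2.1, ← h.2.2, ← segSimplex_unitInterval, ← segSimplex_unitInterval,
    cocycle_add hg, segSimplex_unitInterval, subPath_zero_one]

theorem exists_isConcat {a b : C(unitInterval, X)} (h : a 1 = b 0) :
    ∃ c : C(unitInterval, X), IsConcat a b c ∧
      (∀ t : unitInterval, (t : ℝ) ≤ 1 / 2 → ∃ s : unitInterval, (s : ℝ) = 2 * t ∧ c t = a s) ∧
      ∀ t : unitInterval, 1 / 2 < (t : ℝ) →
        ∃ s : unitInterval, (s : ℝ) = 2 * t - 1 ∧ c t = b s := by
  obtain ⟨c, h1, h2⟩ : ∃ c : C(unitInterval, X),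
      (∀ t : unitInterval, (t : ℝ) ≤ 1 / 2 → ∃ s : unitInterval, (s : ℝ) = 2 * t ∧ c t = a s) ∧
      ∀ t : unitInterval, 1 / 2 < (t : ℝ) →
        ∃ s : unitInterval, (s : ℝ) = 2 * t - 1 ∧ c t = b s := by
    let pa : Path (a 0) (a 1) := ⟨a, rfl, rfl⟩
    let pb : Path (a 1) (b 1) := ⟨b, h.symm, rfl⟩
    exact ⟨(pa.trans pb).toContinuousMap,
      fun t ht => ⟨_, rfl, (Path.trans_apply pa pb t).trans (dif_pos ht)⟩,
      fun t ht => ⟨_, rfl, (Path.trans_apply pa pb t).trans (dif_neg (not_le.2 ht))⟩⟩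
  refine ⟨c, ⟨h, ?_, ?_⟩, h1, h2⟩
  · ext t
    have ht : (1 - (t : ℝ)) * (0 : unitInterval) + t * (1 / 2) ≤ 1 / 2 := by
      have := t.2.2
      simp only [Icc.coe_zero]
      linarith
    obtain ⟨s, hs, hs'⟩ := h1 ⟨(1 - (t : ℝ)) * (0 : unitInterval) + t * (1 / 2), by
      have := t.2.1
      have := t.2.2
      simp only [Icc.coe_zero]
      constructor <;> linarith⟩ ht
    refine hs'.trans (congrArg a (Subtype.ext ?_))
    rw [hs]
    simp only [Icc.coe_zero]
    ring
  · ext t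
    have ht0 := t.2.1
    have ht1 := t.2.2
    rcases eq_or_lt_of_le ht0 with h0 | h0
    · have hs : c ⟨1 / 2, by norm_num, by norm_num⟩ = a 1 := by
        obtain ⟨s, hs, hs'⟩ := h1 ⟨1 / 2, by norm_num, by norm_num⟩ le_rfl
        rw [hs']
        exact congrArg a (Subtype.ext (by rw [hs]; norm_num))
      have ht : t = 0 := Subtype.ext h0.symm
      rw [ht, ← h, ← hs]
      exact congrArg c (Subtype.ext (by simp))
    · obtain ⟨s, hs, hs'⟩ := h2 ⟨(1 - (t : ℝ)) * (1 / 2) + t * (1 : unitInterval), by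
        simp only [Icc.coe_one]
        constructor <;> linarith⟩ (by simp only [Icc.coe_one]; linarith)
      refine hs'.trans (congrArg b (Subtype.ext ?_))
      rw [hs]
      simp only [Icc.coe_one]
      ring

end Paths

/-! ### A cocycle on the curve is determined by its values on smooth simplices -/

variable {P : MvPolynomial (Fin 2) ℂ} {M : Type*} [AddCommGroup M]

/-- A path in a disc of the curve is homotopic to the smooth path that is a segment in the local
coordinate, so a cocycle vanishing on smooth simplices vanishes on it. -/
theorem cocycle_eq_zero_of_contDiffOn {g : Cochain 1 (regLocus P) M}
    (hg : coboundary 1 (regLocus P) M g = 0)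
    (hsmooth : ∀ σ : Simplex 1 (regLocus P),
      ContDiffOn ℝ 1 (pathOfSimplex σ).extend (Icc 0 1) → g σ = 0) : g = 0 := by
  refine cocycle_eq_zero_of_locally hg fun p => ?_
  obtain ⟨π, ψ, r, hr, hψ, hψX, hψp, hev⟩ := exists_chart p.2
  have hπ : ∀ᶠ q in 𝓝 (p : ℂ × ℂ), π q ∈ ball (π p) r :=
    π.continuous.continuousAt.eventually_mem (ball_mem_nhds _ hr)
  refine ⟨{q | ψ (π q) = q ∧ π q ∈ ball (π p) r}, ?_, fun γ hγ => ?_⟩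
  · filter_upwards [continuous_subtype_val.continuousAt.eventually (hev.and hπ)] with q hq
      using ⟨hq.1 q.2, hq.2⟩
  have hcball := convex_ball (π (p : ℂ × ℂ)) r
  have hη : ∀ t, π (γ t) ∈ ball (π p) r := fun t => (hγ ⟨t, rfl⟩).2
  -- The homotopy in the coordinate `π` between the path and the segment between its end points.
  let seg : ℝ → ℂ := fun t => (1 - t) • π (γ 0) + t • π (γ 1)
  have hseg : ∀ t ∈ Icc (0 : ℝ) 1, seg t ∈ ball (π p) r := fun t ht =>
    hcball (hη 0) (hη 1) (sub_nonneg.2 ht.2) ht.1 (by ring)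
  let K : Set (ℝ × ℝ) := Icc 0 1 ×ˢ Icc 0 1
  have hK : Convex ℝ K := (convex_Icc 0 1).prod (convex_Icc 0 1)
  let h : K → ℂ := fun x => (1 - x.1.1) • π (γ ⟨x.1.2, x.2.2⟩) + x.1.1 • seg x.1.2
  have hh : ∀ x, h x ∈ ball (π p) r := fun x =>
    hcball (hη _) (hseg _ x.2.2) (sub_nonneg.2 x.2.1.2) x.2.1.1 (by ring)
  have hhc : Continuous h := by
    have h1 : Continuous fun x : K => (⟨x.1.2, x.2.2⟩ : unitInterval) := by fun_prop
    have h2 : Continuous fun x : K => π (γ ⟨x.1.2, x.2.2⟩) :=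
      π.continuous.comp (continuous_subtype_val.comp (γ.continuous.comp h1))
    simp only [h, seg]
    fun_prop
  let H : C(K, regLocus P) := ⟨fun x => ⟨ψ (h x), (hψX _ (hh x)).1⟩,
    Continuous.subtype_mk (hψ.continuousOn.comp_continuous hhc hh) _⟩
  -- The cocycle vanishes on segments along which the homotopy is smooth in the coordinate.
  have hsm : ∀ (x y : K) (f : ℝ → ℂ), ContDiff ℝ 1 f → (∀ t ∈ Icc (0 : ℝ) 1, f t ∈ ball (π p) r) →
      (∀ (t : ℝ) (z : K), t ∈ Icc (0 : ℝ) 1 →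
        (z : ℝ × ℝ) = (1 - t) • (x : ℝ × ℝ) + t • (y : ℝ × ℝ) → h z = f t) → g (segSimplex hK H x y) = 0 := by
    intro x y f hf hfb hfh
    refine hsmooth _ ?_
    have h1 : ContDiffOn ℝ 1 ψ (ball (π p) r) :=
      (hψ.contDiffOn isOpen_ball).restrict_scalars ℝ
    refine (h1.comp hf.contDiffOn hfb).congr fun t ht => ?_
    rw [Path.extend_apply _ ht]
    change ψ (h _) = ψ (f t)
    rw [hfh t _ ht]
    change ∑ i, (stdSimplexHomeomorphUnitInterval.symm ⟨t, ht⟩) i • ((![x, y] i : K) : ℝ × ℝ) = _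
    rw [Fin.sum_univ_two]
    rfl
  -- The corners of the square. On the edge from `v 0 0` to `v 0 1` the homotopy is the given path,
  -- on the other three edges it is smooth.
  let v : Fin 2 → Fin 2 → K := fun i j => ⟨(![0, 1] i, ![0, 1] j), by
    constructor
    · fin_cases i <;> simp
    · fin_cases j <;> simp⟩
  have hpath : simplexOfPath γ = segSimplex hK H (v 0 0) (v 0 1) := by
    refine ContinuousMap.ext fun a => Subtype.ext ?_
    have h0 : (affSimplex hK ![v 0 0, v 0 1] a : ℝ × ℝ) = (0, a 1) := by
      change ∑ i, a i • ((![v 0 0, v 0 1] i : K) : ℝ × ℝ) = _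
      simp [Fin.sum_univ_two, v]
    have h1 : h (affSimplex hK ![v 0 0, v 0 1] a) =
        π (γ (stdSimplexHomeomorphUnitInterval a)) := by
      simp only [h, h0]
      simp only [sub_zero, one_smul, zero_smul, add_zero]
      rfl
    change (γ (stdSimplexHomeomorphUnitInterval a) : ℂ × ℂ) = ψ (h _)
    rw [h1]
    exact (hγ ⟨_, rfl⟩).1.symm
  have e1 : g (segSimplex hK H (v 0 1) (v 1 1)) = 0 := by
    refine hsm _ _ (fun _ => π (γ 1)) contDiff_const (fun t _ => hη 1) fun t z _ hz => ?_
    have hz1 : (z : ℝ × ℝ).2 = 1 := by rw [hz]; simp [v]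
    have hγ1 : γ ⟨(z : ℝ × ℝ).2, z.2.2⟩ = γ 1 := congrArg γ (Subtype.ext hz1)
    simp only [h, seg]
    rw [hγ1, hz1]
    rw [sub_self, zero_smul, zero_add, one_smul, ← add_smul, sub_add_cancel, one_smul]
  have e2 : g (segSimplex hK H (v 0 0) (v 1 0)) = 0 := by
    refine hsm _ _ (fun _ => π (γ 0)) contDiff_const (fun t _ => hη 0) fun t z _ hz => ?_
    have hz1 : (z : ℝ × ℝ).2 = 0 := by rw [hz]; simp [v]
    have hγ1 : γ ⟨(z : ℝ × ℝ).2, z.2.2⟩ = γ 0 := congrArg γ (Subtype.ext hz1)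
    simp only [h, seg]
    rw [hγ1, hz1]
    rw [sub_zero, zero_smul, add_zero, one_smul, ← add_smul, sub_add_cancel, one_smul]
  have e3 : g (segSimplex hK H (v 1 0) (v 1 1)) = 0 := by
    refine hsm _ _ seg (by fun_prop) hseg fun t z _ hz => ?_
    have hz1 : (z : ℝ × ℝ).1 = 1 := by rw [hz]; simp [v]
    have hz2 : (z : ℝ × ℝ).2 = t := by rw [hz]; simp [v]
    simp only [h, hz1, hz2]
    rw [sub_self, zero_smul, zero_add, one_smul]
  have h1 := cocycle_add hg hK H (v 0 0) (v 0 1) (v 1 1)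
  have h2 := cocycle_add hg hK H (v 0 0) (v 1 0) (v 1 1)
  rw [e1, add_zero] at h1
  rw [e2, e3, add_zero] at h2
  rw [hpath, h1, ← h2]

end MahlerSymbol

/-! ### Local primitives of the form `C₂(log |t₁|, log |t₂|)` -/

namespace MahlerSymbol

open Filter Metric Set

/-- The real form `C₂(log |t₁|, log |t₂|) / (2πi)`, i.e.
`(log |t₁| d arg t₂ - log |t₂| d arg t₁) / 2π`. -/
noncomputable def argForm (p v : ℂ × ℂ) : ℝ :=
  (2 * Real.pi)⁻¹ * (Real.log ‖p.1‖ * (v.2 / p.2).im - Real.log ‖p.2‖ * (v.1 / p.1).im)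

theorem log_norm_eq {z w : ℂ} (hz : z ≠ 0) (hw : w ≠ 0) :
    Real.log ‖z‖ = (Complex.log (z / w)).re + Real.log ‖w‖ := by
  rw [Complex.log_re, norm_div, Real.log_div (norm_ne_zero_iff.2 hz) (norm_ne_zero_iff.2 hw)]
  ring

theorem hasFDerivAt_log_norm {z : ℂ} (hz : z ≠ 0) :
    HasFDerivAt (fun w : ℂ => Real.log ‖w‖)
      (Complex.reCLM.comp ((z⁻¹ • ContinuousLinearMap.id ℂ ℂ).restrictScalars ℝ)) z := by
  have h1 : HasDerivAt (fun w : ℂ => Complex.log (w / z)) (z⁻¹) z := by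
    have := ((hasDerivAt_id z).div_const z).clog (by simp [hz])
    simpa [hz] using this
  have h2 : HasFDerivAt (fun w : ℂ => Complex.log (w / z)) (z⁻¹ • ContinuousLinearMap.id ℂ ℂ) z :=
    h1.hasFDerivAt.congr_fderiv (by ext; simp)
  have h3 := (Complex.reCLM.hasFDerivAt.comp z (h2.restrictScalars ℝ)).add_const (Real.log ‖z‖)
  refine h3.congr_of_eventuallyEq ?_
  filter_upwards [eventually_ne_nhds hz] with w hw using log_norm_eq hw hz

theorem C2log_apply {p : ℂ × ℂ} (h1 : p.1 ≠ 0) (h2 : p.2 ≠ 0) (v : ℂ × ℂ) :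
    C2log p v = 2 * Real.pi * Complex.I * (argForm p v : ℝ) := by
  have d1 : ∀ v : ℂ × ℂ, fderiv ℝ (fun p : ℂ × ℂ => Real.log ‖p.1‖) p v = (v.1 / p.1).re := by
    intro v
    have h : HasFDerivAt (fun p : ℂ × ℂ => Real.log ‖p.1‖) _ p :=
      (hasFDerivAt_log_norm h1).comp p (hasFDerivAt_fst (𝕜 := ℝ))
    rw [h.fderiv]
    simp [div_eq_inv_mul]
  have d2 : ∀ v : ℂ × ℂ, fderiv ℝ (fun p : ℂ × ℂ => Real.log ‖p.2‖) p v = (v.2 / p.2).re := by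
    intro v
    have h : HasFDerivAt (fun p : ℂ × ℂ => Real.log ‖p.2‖) _ p :=
      (hasFDerivAt_log_norm h2).comp p (hasFDerivAt_snd (𝕜 := ℝ))
    rw [h.fderiv]
    simp [div_eq_inv_mul]
  have hI : ∀ w z : ℂ, (Complex.I * w / z).re = -(w / z).im := fun w z => by
    rw [mul_div_assoc]; simp
  simp only [C2log, C2, delForm, delBarForm, dForm, mulI, add_apply, sub_apply, smul_apply,
    ContinuousLinearMap.comp_apply, ContinuousLinearMap.coe_restrictScalars',
    ContinuousLinearMap.coe_id', id_eq, d1, d2, Prod.smul_fst, Prod.smul_snd, smul_eq_mul, hI,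
    Complex.ofRealCLM_apply, argForm]
  have hpi : (Real.pi : ℂ) ≠ 0 := by exact_mod_cast Real.pi_ne_zero
  simp only [Complex.real_smul]
  push_cast
  field_simp
  ring

/-- `F` is a primitive of `argForm` at the point `q` of `Z*(P)^reg`, expressed by its derivatives
along the differentiable curves on `Z*(P)^reg` through `q`, since `F` itself is a function on the
ambient space. -/
def IsPrimitiveAt (P : MvPolynomial (Fin 2) ℂ) (F : ℂ × ℂ → ℝ) (q : ℂ × ℂ) : Prop :=
  ∀ (γ : ℝ → ℂ × ℂ) (γ' : ℂ × ℂ) (s : ℝ), γ s = q → (∀ᶠ t in 𝓝 s, γ t ∈ regLocus P) →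
    HasDerivAt γ γ' s → HasDerivAt (fun t => F (γ t)) (argForm q γ') s

variable {P : MvPolynomial (Fin 2) ℂ}

/-- With local logarithms `Lⱼ` of `tⱼ` and a holomorphic primitive `H` of `L₁ dL₂`, the function
`(Im H - Im L₁ Re L₂) / 2π` is a local primitive. -/
theorem exists_primitive {p : ℂ × ℂ} (hp : p ∈ regLocus P) :
    ∃ F : ℂ × ℂ → ℝ, ContinuousAt F p ∧ ∀ᶠ q in 𝓝 p, q ∈ regLocus P → IsPrimitiveAt P F q := by
  obtain ⟨π, ψ, r, hr, hψ, hψX, hψp, hev⟩ := exists_chart hp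
  have hp1 : p.1 ≠ 0 := hp.1.1
  have hp2 : p.2 ≠ 0 := hp.1.2.1
  have hψc : ContinuousAt ψ (π p) := hψ.continuousOn.continuousAt (ball_mem_nhds _ hr)
  have hs1 : ∀ᶠ z in 𝓝 (π p), (ψ z).1 / p.1 ∈ Complex.slitPlane := by
    have : ContinuousAt (fun z => (ψ z).1 / p.1) (π p) := hψc.fst.div_const _
    refine this.eventually_mem (Complex.isOpen_slitPlane.mem_nhds ?_)
    simp [hψp, hp1]
  have hs2 : ∀ᶠ z in 𝓝 (π p), (ψ z).2 / p.2 ∈ Complex.slitPlane := by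
    have : ContinuousAt (fun z => (ψ z).2 / p.2) (π p) := hψc.snd.div_const _
    refine this.eventually_mem (Complex.isOpen_slitPlane.mem_nhds ?_)
    simp [hψp, hp2]
  obtain ⟨ρ, hρ, hball⟩ := Metric.eventually_nhds_iff_ball.1
    ((hs1.and hs2).and (ball_mem_nhds (π p) hr))
  have hψρ : DifferentiableOn ℂ ψ (ball (π p) ρ) := hψ.mono fun z hz => (hball z hz).2
  let L₁ : ℂ → ℂ := fun z => Complex.log ((ψ z).1 / p.1) + Real.log ‖p.1‖
  let L₂ : ℂ → ℂ := fun z => Complex.log ((ψ z).2 / p.2) + Real.log ‖p.2‖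
  have hL₁ : DifferentiableOn ℂ L₁ (ball (π p) ρ) :=
    ((hψρ.fst.div_const _).clog fun z hz => (hball z hz).1.1).add_const _
  have hL₂ : DifferentiableOn ℂ L₂ (ball (π p) ρ) :=
    ((hψρ.snd.div_const _).clog fun z hz => (hball z hz).1.2).add_const _
  obtain ⟨H, hH⟩ := (hL₁.mul (hL₂.deriv isOpen_ball)).isExactOn_ball
  have hd₁ : ∀ z ∈ ball (π p) ρ, HasDerivAt L₁ (deriv L₁ z) z := fun z hz =>
    (hL₁.differentiableAt (isOpen_ball.mem_nhds hz)).hasDerivAt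
  have hd₂ : ∀ z ∈ ball (π p) ρ, HasDerivAt L₂ (deriv L₂ z) z := fun z hz =>
    (hL₂.differentiableAt (isOpen_ball.mem_nhds hz)).hasDerivAt
  refine ⟨fun q => (2 * Real.pi)⁻¹ * ((H (π q)).im - (L₁ (π q)).im * (L₂ (π q)).re), ?_, ?_⟩
  · have hmem := mem_ball_self (x := π p) hρ
    have c1 : ContinuousAt (fun q => H (π q)) p :=
      (hH _ hmem).continuousAt.comp (f := π) π.continuous.continuousAt
    have c2 : ContinuousAt (fun q => L₁ (π q)) p :=
      (hd₁ _ hmem).continuousAt.comp (f := π) π.continuous.continuousAt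
    have c3 : ContinuousAt (fun q => L₂ (π q)) p :=
      (hd₂ _ hmem).continuousAt.comp (f := π) π.continuous.continuousAt
    have hre := fun w => Complex.continuous_re.continuousAt (x := w)
    have him := fun w => Complex.continuous_im.continuousAt (x := w)
    exact continuousAt_const.mul (((him _).comp c1).sub (((him _).comp c2).mul ((hre _).comp c3)))
  · have hπ : ∀ᶠ q in 𝓝 p, π q ∈ ball (π p) ρ :=
      π.continuous.continuousAt.eventually_mem (ball_mem_nhds _ hρ)
    filter_upwards [hev.eventually_nhds, hπ] with q hq hqb hqX γ γ' s hs hγX hγ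
    subst hs
    have hz : HasDerivAt (fun t => π (γ t)) (π γ') s :=
      (π.restrictScalars ℝ).hasFDerivAt.comp_hasDerivAt s hγ
    have hψγ : ∀ᶠ t in 𝓝 s, ψ (π (γ t)) = γ t := by
      filter_upwards [hγ.continuousAt.eventually hq, hγX] with t h1 h2 using h1 h2
    have hqs : ψ (π (γ s)) = γ s := hψγ.self_of_nhds
    have hslit := (hball _ hqb).1
    rw [hqs] at hslit
    have hq1 : (γ s).1 ≠ 0 := hqX.1.1
    have hq2 : (γ s).2 ≠ 0 := hqX.1.2.1
    have h1 := (hd₁ _ hqb).comp s hz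
    have h2 := (hd₂ _ hqb).comp s hz
    have hγ1 : HasDerivAt (fun t => (γ t).1) γ'.1 s :=
      (ContinuousLinearMap.fst ℝ ℂ ℂ).hasFDerivAt.comp_hasDerivAt s hγ
    have hγ2 : HasDerivAt (fun t => (γ t).2) γ'.2 s :=
      (ContinuousLinearMap.snd ℝ ℂ ℂ).hasFDerivAt.comp_hasDerivAt s hγ
    have e1 : deriv L₁ (π (γ s)) * π γ' = γ'.1 / (γ s).1 := by
      have h3 := ((hγ1.div_const p.1).clog_real hslit.1).add_const (Real.log ‖p.1‖ : ℂ)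
      have h4 := h3.congr_of_eventuallyEq (f₁ := L₁ ∘ fun t => π (γ t)) (by
        filter_upwards [hψγ] with t ht
        simp only [Function.comp, L₁, ht])
      rw [h1.unique h4]
      field_simp
    have e2 : deriv L₂ (π (γ s)) * π γ' = γ'.2 / (γ s).2 := by
      have h3 := ((hγ2.div_const p.2).clog_real hslit.2).add_const (Real.log ‖p.2‖ : ℂ)
      have h4 := h3.congr_of_eventuallyEq (f₁ := L₂ ∘ fun t => π (γ t)) (by
        filter_upwards [hψγ] with t ht
        simp only [Function.comp, L₂, ht])
      rw [h2.unique h4]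
      field_simp
    have h3 := (hH _ hqb).comp s hz
    rw [e1] at h1
    rw [e2] at h2
    rw [Pi.mul_apply, mul_assoc, e2] at h3
    have i3 := Complex.imCLM.hasFDerivAt.comp_hasDerivAt s h3
    have i1 := Complex.imCLM.hasFDerivAt.comp_hasDerivAt s h1
    have r2 := Complex.reCLM.hasFDerivAt.comp_hasDerivAt s h2
    refine ((i3.sub (i1.mul r2)).const_mul (2 * Real.pi)⁻¹).congr_deriv ?_
    have l1 : (L₁ (π (γ s))).re = Real.log ‖(γ s).1‖ := by
      rw [log_norm_eq hq1 hp1]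
      simp [L₁, hqs]
    have l2 : (L₂ (π (γ s))).re = Real.log ‖(γ s).2‖ := by
      rw [log_norm_eq hq2 hp2]
      simp [L₂, hqs]
    simp only [Complex.imCLM_apply, Complex.reCLM_apply, Function.comp, argForm, ← l1, ← l2,
      Complex.mul_im]
    ring

/-- Two local primitives differ by a constant along the curve. -/
theorem primitive_sub_eq {F G : ℂ × ℂ → ℝ} {p : ℂ × ℂ} (hp : p ∈ regLocus P)
    (hF : ∀ᶠ q in 𝓝 p, q ∈ regLocus P → IsPrimitiveAt P F q)
    (hG : ∀ᶠ q in 𝓝 p, q ∈ regLocus P → IsPrimitiveAt P G q) :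
    ∀ᶠ q in 𝓝 p, q ∈ regLocus P → F q - F p = G q - G p := by
  obtain ⟨π, ψ, r, hr, hψ, hψX, hψp, hev⟩ := exists_chart hp
  have hψc : ContinuousAt ψ (π p) := hψ.continuousOn.continuousAt (ball_mem_nhds _ hr)
  have hFG := hF.and hG
  rw [← hψp] at hFG
  obtain ⟨ρ, hρ, hball⟩ := Metric.eventually_nhds_iff_ball.1
    ((hψc.eventually hFG).and (ball_mem_nhds (π p) hr))
  have hπ : ∀ᶠ q in 𝓝 p, π q ∈ ball (π p) ρ :=
    π.continuous.continuousAt.eventually_mem (ball_mem_nhds _ hρ)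
  filter_upwards [hev, hπ] with q hq hqb hqX
  -- Along a segment in the coordinate of a chart both primitives have the same derivative.
  let line : ℝ → ℂ := fun t => (1 - t) • π p + t • π q
  have hline : ∀ t ∈ Icc (0 : ℝ) 1, line t ∈ ball (π p) ρ := fun t ht =>
    convex_ball (π p) ρ (mem_ball_self hρ) hqb (sub_nonneg.2 ht.2) ht.1 (by ring)
  have hld : ∀ t, HasDerivAt line (-1 • π p + 1 • π q) t := fun t => by
    have h1 : HasDerivAt (fun t : ℝ => (1 - t) • π p) (-(1 : ℝ) • π p) t :=
      ((hasDerivAt_id t).const_sub 1).smul_const (π p)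
    have h2 : HasDerivAt (fun t : ℝ => t • π q) ((1 : ℝ) • π q) t :=
      (hasDerivAt_id t).smul_const (π q)
    exact (HasDerivAt.fun_add h1 h2).congr_deriv (by simp)
  have hder : ∀ t ∈ Icc (0 : ℝ) 1,
      HasDerivAt (fun t => F (ψ (line t)) - G (ψ (line t))) 0 t := by
    intro t ht
    have hlt := hline t ht
    have hd : HasDerivAt (fun t => ψ (line t)) _ t :=
      ((hψ.differentiableAt (isOpen_ball.mem_nhds (hball _ hlt).2)).hasFDerivAt.restrictScalars
        ℝ).comp_hasDerivAt t (hld t)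
    have hX : ∀ᶠ s in 𝓝 t, ψ (line s) ∈ regLocus P := by
      filter_upwards [(hld t).continuousAt.eventually_mem (isOpen_ball.mem_nhds hlt)] with s hs
        using (hψX _ (hball _ hs).2).1
    have hXt := hX.self_of_nhds
    have h1 := ((hball _ hlt).1.1 hXt) (fun t => ψ (line t)) _ t rfl hX hd
    have h2 := ((hball _ hlt).1.2 hXt) (fun t => ψ (line t)) _ t rfl hX hd
    exact (HasDerivAt.fun_sub h1 h2).congr_deriv (sub_self _)
  have hconst := constant_of_derivWithin_zero
    (fun t ht => (hder t ht).differentiableAt.differentiableWithinAt)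
    (fun t ht => (hder t (Ico_subset_Icc_self ht)).hasDerivWithinAt.derivWithin
      (uniqueDiffOn_Icc zero_lt_one t (Ico_subset_Icc_self ht))) 1 (right_mem_Icc.2 zero_le_one)
  have l0 : line 0 = π p := by simp [line]
  have l1 : line 1 = π q := by simp [line]
  simp only [l0, l1, hψp, hq hqX] at hconst
  linarith

/-! ### Primitives along simplices -/

/-- Functions `F x` near `x` whose differences are locally constant have, on a compact convex set, a
common function `Φ` with the same increments: along the rays from a base point one adds up the
increments on short segments. -/
theorem exists_glued {E : Type*} [NormedAddCommGroup E] [NormedSpace ℝ E] {K : Set E}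
    (hK : Convex ℝ K) (hc : IsCompact K) (F : K → K → ℝ)
    (hF : ∀ x, ∀ᶠ q in 𝓝 x, ∀ᶠ q' in 𝓝 q, F x q' - F x q = F q q' - F q q) :
    ∃ Φ : K → ℝ, ∀ x, ∀ᶠ y in 𝓝 x, Φ y - Φ x = F x y - F x x := by
  rcases isEmpty_or_nonempty K with hempty | ⟨⟨x₀⟩⟩
  · exact ⟨fun _ => 0, fun x => hempty.elim x⟩
  choose ε hε hball using fun x => Metric.eventually_nhds_iff_ball.1 (hF x)
  have hcomp : CompactSpace K := isCompact_iff_compactSpace.1 hc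
  obtain ⟨δ, hδ, hleb⟩ := lebesgue_number_lemma_of_metric (s := (univ : Set K)) isCompact_univ
    (c := fun x : K => ball x (ε x)) (fun _ => isOpen_ball)
    (fun x _ => mem_iUnion.2 ⟨x, mem_ball_self (hε x)⟩)
  choose s hs using fun x : K => hleb x (mem_univ x)
  -- On the intersection of two balls the local functions differ by a constant.
  have hcons : ∀ x x' y z : K, y ∈ ball x (ε x) → y ∈ ball x' (ε x') → z ∈ ball x (ε x) →
      z ∈ ball x' (ε x') → F x z - F x y = F x' z - F x' y := by
    intro x x' y z hy hy' hz hz'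
    let f : unitInterval → K := fun t => ⟨(1 - (t : ℝ)) • (y : E) + (t : ℝ) • (z : E),
      hK y.2 z.2 (sub_nonneg.2 t.2.2) t.2.1 (by ring)⟩
    have hfc : Continuous f := Continuous.subtype_mk (by fun_prop) _
    have hfb : ∀ w : K, ∀ η, y ∈ ball w η → z ∈ ball w η → ∀ t, f t ∈ ball w η := by
      intro w η h1 h2 t
      exact convex_ball (w : E) η h1 h2 (sub_nonneg.2 t.2.2) t.2.1 (by ring)
    have hloc : IsLocallyConstant fun t => F x (f t) - F x' (f t) := by
      rw [IsLocallyConstant.iff_eventually_eq]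
      intro t
      filter_upwards [hfc.continuousAt.eventually (hball x _ (hfb x _ hy hz t)),
        hfc.continuousAt.eventually (hball x' _ (hfb x' _ hy' hz' t))] with u h1 h2
      linarith
    have h0 : f 0 = y := Subtype.ext (by simp [f])
    have h1 : f 1 = z := Subtype.ext (by simp [f])
    have := hloc.apply_eq_of_isPreconnected isPreconnected_univ (mem_univ 0) (mem_univ 1)
    rw [h0, h1] at this
    linarith
  let c : K → K → ℝ := fun x y => F (s x) y - F (s x) x
  have hadd : ∀ x y z, dist y x < δ → dist z x < δ → dist z y < δ → c x y + c y z = c x z := by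
    intro x y z h1 h2 h3
    have := hcons (s y) (s x) y z (hs y (mem_ball_self hδ)) (hs x h1) (hs y h3) (hs x h2)
    simp only [c]
    linarith
  -- Rays from `x₀` are divided into `N` steps shorter than `δ / 2`.
  obtain ⟨D, hD⟩ := hc.isBounded.exists_norm_le
  obtain ⟨N, hN⟩ := exists_nat_gt (2 * (2 * D) / δ)
  have hD0 : 0 ≤ D := (norm_nonneg _).trans (hD x₀ x₀.2)
  have hN0 : (0 : ℝ) < N := lt_of_le_of_lt (by positivity) hN
  let pt : ℕ → K → K := fun j x => if h : j ≤ N then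
    ⟨(1 - (j / N : ℝ)) • (x₀ : E) + (j / N : ℝ) • (x : E),
      hK x₀.2 x.2 (sub_nonneg.2 (div_le_one_of_le₀ (by exact_mod_cast h) hN0.le)) (by positivity)
        (by ring)⟩ else x
  have hpt : ∀ j x, j ≤ N → (pt j x : E) = (1 - (j / N : ℝ)) • (x₀ : E) + (j / N : ℝ) • (x : E) :=
    fun j x h => by simp only [pt, dif_pos h]
  have hstep : ∀ j x, j < N → dist (pt (j + 1) x) (pt j x) < δ / 2 := by
    intro j x hj
    rw [Subtype.dist_eq, hpt _ _ hj, hpt _ _ hj.le, dist_eq_norm]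
    have h1 : (1 - ((j + 1 : ℕ) / N : ℝ)) • (x₀ : E) + ((j + 1 : ℕ) / N : ℝ) • (x : E) -
        ((1 - (j / N : ℝ)) • (x₀ : E) + (j / N : ℝ) • (x : E)) = (1 / N : ℝ) • ((x : E) - x₀) := by
      push_cast
      module
    rw [h1, norm_smul, Real.norm_of_nonneg (by positivity)]
    have h2 : ‖(x : E) - x₀‖ ≤ 2 * D :=
      (norm_sub_le _ _).trans (by linarith [hD x x.2, hD x₀ x₀.2])
    have h3 : 2 * (2 * D) < N * δ := (div_lt_iff₀ hδ).1 hN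
    have h4 : 1 / (N : ℝ) * ‖(x : E) - x₀‖ ≤ 1 / N * (2 * D) := by gcongr
    refine h4.trans_lt ?_
    rw [one_div, inv_mul_lt_iff₀ hN0]
    linarith
  have hclose : ∀ j x y, j ≤ N → dist (pt j y) (pt j x) ≤ dist y x := by
    intro j x y hj
    rw [Subtype.dist_eq, hpt _ _ hj, hpt _ _ hj, dist_add_left, dist_smul₀, Subtype.dist_eq]
    refine mul_le_of_le_one_left dist_nonneg ?_
    rw [Real.norm_of_nonneg (by positivity)]
    exact div_le_one_of_le₀ (by exact_mod_cast hj) hN0.le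
  refine ⟨fun x => ∑ j ∈ Finset.range N, c (pt j x) (pt (j + 1) x), fun x => ?_⟩
  filter_upwards [ball_mem_nhds x (half_pos hδ), ball_mem_nhds x (hε x)] with y hy hyx
  have hyδ : dist y x < δ / 2 := hy
  -- The increments over neighbouring rays differ by a telescoping sum.
  have htel : ∀ j ∈ Finset.range N, c (pt j y) (pt (j + 1) y) - c (pt j x) (pt (j + 1) x) =
      c (pt (j + 1) x) (pt (j + 1) y) - c (pt j x) (pt j y) := by
    intro j hj
    have hjN := Finset.mem_range.1 hj
    have a1 := hstep j x hjN
    have a2 := hstep j y hjN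
    have a3 := (hclose j x y hjN.le).trans_lt hyδ
    have a4 := (hclose (j + 1) x y hjN).trans_lt hyδ
    have a5 : dist (pt (j + 1) y) (pt j x) < δ := by
      linarith [dist_triangle (pt (j + 1) y) (pt j y) (pt j x)]
    have b1 := hadd (pt j x) (pt j y) (pt (j + 1) y) (by linarith) a5 (by linarith)
    have b2 := hadd (pt j x) (pt (j + 1) x) (pt (j + 1) y) (by linarith) a5 (by linarith)
    linarith
  rw [← Finset.sum_sub_distrib, Finset.sum_congr rfl htel,
    Finset.sum_range_sub (fun j => c (pt j x) (pt j y))]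
  have hend : ∀ x, pt N x = x := fun x => Subtype.ext (by
    rw [hpt N x le_rfl, div_self hN0.ne']; simp)
  have hstart : ∀ x, pt 0 x = x₀ := fun x => Subtype.ext (by
    rw [hpt 0 x (Nat.zero_le _)]; simp)
  rw [hend, hend, hstart, hstart]
  have h1 : c x₀ x₀ = 0 := sub_self _
  rw [h1, sub_zero]
  exact hcons (s x) x x y (hs x (mem_ball_self hδ)) (mem_ball_self (hε x))
    (hs x (ball_subset_ball (half_le_self hδ.le) hy)) hyx

end MahlerSymbol

/-! ### The cohomology class of the form -/

namespace MahlerSymbol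

open Filter Metric Set

variable {P : MvPolynomial (Fin 2) ℂ}

/-- A primitive of `argForm` near the point `p` of `Z*(P)^reg`. -/
noncomputable def locPrim (p : regLocus P) : ℂ × ℂ → ℝ := (exists_primitive p.2).choose

theorem continuousAt_locPrim (p : regLocus P) : ContinuousAt (locPrim p) p :=
  (exists_primitive p.2).choose_spec.1

theorem eventually_isPrimitiveAt_locPrim (p : regLocus P) :
    ∀ᶠ q in 𝓝 (p : ℂ × ℂ), q ∈ regLocus P → IsPrimitiveAt P (locPrim p) q :=
  (exists_primitive p.2).choose_spec.2

/-- Near `p` the primitive at `p` has the same increments as the primitives at nearby points. -/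
theorem locPrim_sub_locPrim (p : regLocus P) : ∀ᶠ q : regLocus P in 𝓝 p,
    ∀ᶠ q' : regLocus P in 𝓝 q, locPrim p q' - locPrim p q = locPrim q q' - locPrim q q := by
  have h := (eventually_isPrimitiveAt_locPrim p).eventually_nhds
  filter_upwards [continuous_subtype_val.continuousAt.eventually h] with q hq
  have h2 := primitive_sub_eq q.2 hq (eventually_isPrimitiveAt_locPrim q)
  filter_upwards [continuous_subtype_val.continuousAt.eventually h2] with q' hq' using hq' q'.2

/-- `Φ` is a primitive of the pullback of `argForm` along the map `σ` into `Z*(P)^reg`; as `σ` need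
not be differentiable, this is expressed by comparison with local primitives on the curve. -/
def IsPrimitiveAlong {Z : Type*} [TopologicalSpace Z] (σ : Z → regLocus P) (Φ : Z → ℝ) : Prop :=
  ∀ x, ∀ᶠ y in 𝓝 x, Φ y - Φ x = locPrim (σ x) (σ y) - locPrim (σ x) (σ x)

namespace IsPrimitiveAlong

variable {Z W : Type*} [TopologicalSpace Z] [TopologicalSpace W] {σ : Z → regLocus P}
  {Φ Ψ : Z → ℝ}

theorem comp (h : IsPrimitiveAlong σ Φ) {f : W → Z} (hf : Continuous f) :
    IsPrimitiveAlong (σ ∘ f) (Φ ∘ f) := fun x => hf.continuousAt.eventually (h (f x))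

theorem sub_eq [PreconnectedSpace Z] (h : IsPrimitiveAlong σ Φ) (h' : IsPrimitiveAlong σ Ψ)
    (x y : Z) : Φ y - Φ x = Ψ y - Ψ x := by
  have hloc : IsLocallyConstant fun z => Φ z - Ψ z := by
    rw [IsLocallyConstant.iff_eventually_eq]
    intro z
    filter_upwards [h z, h' z] with w h1 h2
    linarith
  have := hloc.apply_eq_of_isPreconnected isPreconnected_univ (mem_univ x) (mem_univ y)
  linarith

theorem of_const (x : regLocus P) : IsPrimitiveAlong (fun _ : Z => x) fun _ => 0 := fun _ =>
  Eventually.of_forall fun _ => by simp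

theorem continuous (h : IsPrimitiveAlong σ Φ) (hσ : Continuous σ) : Continuous Φ := by
  rw [continuous_iff_continuousAt]
  intro x
  have h1 : ContinuousAt (fun y => locPrim (σ x) (σ y) - locPrim (σ x) (σ x) + Φ x) x :=
    ((ContinuousAt.comp (f := fun y => (σ y : ℂ × ℂ)) (continuousAt_locPrim (σ x))
      (continuous_subtype_val.comp hσ).continuousAt).sub continuousAt_const).add continuousAt_const
  refine h1.congr ?_
  filter_upwards [h x] with y hy
  linarith

theorem hasDerivAt {γ : C(unitInterval, regLocus P)} {Φ : unitInterval → ℝ}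
    (h : IsPrimitiveAlong γ Φ) {t : ℝ} {v : ℂ × ℂ}
    (hv : HasDerivAt (fun s => (γ (projIcc 0 1 zero_le_one s) : ℂ × ℂ)) v t) :
    HasDerivAt (fun s => Φ (projIcc 0 1 zero_le_one s))
      (argForm (γ (projIcc 0 1 zero_le_one t)) v) t := by
  set x := projIcc (0 : ℝ) 1 zero_le_one t
  have h1 := (eventually_isPrimitiveAt_locPrim (γ x)).self_of_nhds (γ x).2
    _ v t rfl (Eventually.of_forall fun s => (γ _).2) hv
  have h2 := (h1.sub_const (locPrim (γ x) (γ x))).add_const (Φ x)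
  refine h2.congr_of_eventuallyEq ?_
  filter_upwards [continuous_projIcc.continuousAt.eventually (h x)] with s hs
  rw [← hs]
  ring

end IsPrimitiveAlong

instance preconnectedSpace_stdSimplex (n : ℕ) : PreconnectedSpace (stdSimplex ℝ (Fin n)) :=
  Subtype.preconnectedSpace (convex_stdSimplex ℝ (Fin n)).isPreconnected

theorem exists_isPrimitiveAlong {n : ℕ} (σ : Simplex n (regLocus P)) :
    ∃ Φ, IsPrimitiveAlong σ Φ := by
  refine exists_glued (convex_stdSimplex ℝ _) (isCompact_stdSimplex ℝ _)
    (fun x y => locPrim (σ x) (σ y)) fun x => ?_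
  filter_upwards [σ.continuous.continuousAt.eventually (locPrim_sub_locPrim (σ x))] with q hq
  exact σ.continuous.continuousAt.eventually hq

/-- The increment of a primitive of `argForm` along a singular `1`-simplex, i.e. the integral of
the closed form `argForm` over the possibly non-differentiable simplex. -/
noncomputable def increment (σ : Simplex 1 (regLocus P)) : ℝ :=
  (exists_isPrimitiveAlong σ).choose (stdSimplex.vertex 1) -
    (exists_isPrimitiveAlong σ).choose (stdSimplex.vertex 0)

theorem increment_eq {σ : Simplex 1 (regLocus P)} {Φ : stdSimplex ℝ (Fin 2) → ℝ}
    (h : IsPrimitiveAlong σ Φ) :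
    increment σ = Φ (stdSimplex.vertex 1) - Φ (stdSimplex.vertex 0) :=
  (exists_isPrimitiveAlong σ).choose_spec.sub_eq h _ _

/-- The fundamental theorem of calculus along a path. Differentiability at the end points is not
required, because primitives are continuous along the path. -/
theorem increment_eq_integral (γ : C(unitInterval, regLocus P)) (v : ℝ → ℂ × ℂ)
    (hv : ∀ t ∈ Ioo (0 : ℝ) 1,
      HasDerivAt (fun s => (γ (projIcc 0 1 zero_le_one s) : ℂ × ℂ)) (v t) t)
    (hint : IntervalIntegrable (fun t => argForm (γ (projIcc 0 1 zero_le_one t)) (v t))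
      MeasureTheory.volume 0 1) :
    increment (simplexOfPath γ) =
      ∫ t in (0 : ℝ)..1, argForm (γ (projIcc 0 1 zero_le_one t)) (v t) := by
  obtain ⟨Φ, hΦ⟩ := exists_isPrimitiveAlong (simplexOfPath γ)
  have hΨ : IsPrimitiveAlong γ (Φ ∘ stdSimplexHomeomorphUnitInterval.symm) := by
    have h := hΦ.comp stdSimplexHomeomorphUnitInterval.symm.continuous
    have h2 : ⇑(simplexOfPath γ) ∘ stdSimplexHomeomorphUnitInterval.symm = γ := by
      funext s
      exact congrArg γ (stdSimplexHomeomorphUnitInterval.apply_symm_apply s)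
    rwa [h2] at h
  rw [intervalIntegral.integral_eq_sub_of_hasDerivAt_of_le zero_le_one
    ((hΨ.continuous γ.continuous).comp continuous_projIcc).continuousOn
    (fun t ht => hΨ.hasDerivAt (hv t ht)) hint, increment_eq hΦ]
  have v0 : stdSimplexHomeomorphUnitInterval.symm 0 = stdSimplex.vertex (0 : Fin 2) := by
    rw [Homeomorph.symm_apply_eq]; rfl
  have v1 : stdSimplexHomeomorphUnitInterval.symm 1 = stdSimplex.vertex (1 : Fin 2) := by
    rw [Homeomorph.symm_apply_eq]; rfl
  simp only [Function.comp, projIcc_left, projIcc_right]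
  rw [← v0, ← v1]
  rfl

theorem increment_eq_curveIntegral (σ : Simplex 1 (regLocus P))
    (hσ : ContDiffOn ℝ 1 (pathOfSimplex σ).extend (Icc 0 1)) :
    (2 * Real.pi * Complex.I : ℂ) * increment σ = curveIntegral C2log (pathOfSimplex σ) := by
  obtain ⟨γ, rfl⟩ := exists_simplexOfPath σ
  have hγ : ∀ t, (pathOfSimplex (simplexOfPath γ)).extend t =
      (γ (projIcc 0 1 zero_le_one t) : ℂ × ℂ) := fun t =>
    congrArg (fun s => (γ s : ℂ × ℂ)) (stdSimplexHomeomorphUnitInterval.apply_symm_apply _)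
  set f := ⇑(pathOfSimplex (simplexOfPath γ)).extend with hf
  have hfX : ∀ t, f t ∈ regLocus P := fun t => by rw [hγ]; exact (γ _).2
  have hfe : f = fun t => (γ (projIcc 0 1 zero_le_one t) : ℂ × ℂ) := funext hγ
  have hd := hσ.continuousOn_derivWithin (uniqueDiffOn_Icc zero_lt_one) le_rfl
  have hfc : ContinuousOn f (Icc 0 1) := hσ.continuousOn
  have hcont : ContinuousOn (fun t => argForm (f t) (derivWithin f (Icc 0 1) t)) (Icc 0 1) := by
    have n1 : ∀ t ∈ Icc (0 : ℝ) 1, (f t).1 ≠ 0 := fun t _ => (hfX t).1.1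
    have n2 : ∀ t ∈ Icc (0 : ℝ) 1, (f t).2 ≠ 0 := fun t _ => (hfX t).1.2.1
    exact continuousOn_const.mul
      (((hfc.fst.norm.log fun t ht => norm_ne_zero_iff.2 (n1 t ht)).mul
        (Complex.continuous_im.comp_continuousOn (hd.snd.div hfc.snd n2))).sub
      ((hfc.snd.norm.log fun t ht => norm_ne_zero_iff.2 (n2 t ht)).mul
        (Complex.continuous_im.comp_continuousOn (hd.fst.div hfc.fst n1))))
  have h1 : increment (simplexOfPath γ) =
      ∫ t in (0 : ℝ)..1, argForm (f t) (derivWithin f (Icc 0 1) t) := by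
    rw [hfe] at hcont ⊢
    refine increment_eq_integral γ _ (fun t ht => ?_)
      (hcont.intervalIntegrable_of_Icc zero_le_one)
    rw [← hfe]
    have h2 := (hσ.differentiableOn (by simp) t (Ioo_subset_Icc_self ht)).hasDerivWithinAt
    exact h2.hasDerivAt (Icc_mem_nhds ht.1 ht.2)
  rw [h1, curveIntegral_def, ← intervalIntegral.integral_ofReal,
    ← intervalIntegral.integral_const_mul]
  refine intervalIntegral.integral_congr fun t _ => ?_
  simp only [curveIntegralFun_def]
  exact (C2log_apply (hfX t).1.1 (hfX t).1.2.1 _).symm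

/-- The singular cochain `σ ↦ ∫_σ C₂(log |t₁|, log |t₂|)`, on continuous simplices `σ`, with values
in `ℝ(1)`. -/
noncomputable def formCochain (P : MvPolynomial (Fin 2) ℂ) :
    Cochain 1 (regLocus P) (tate realSubgroup 1) := fun σ =>
  ⟨(2 * Real.pi * Complex.I : ℂ) ^ (1 : ℤ) * increment σ,
    ⟨(increment σ : ℂ), ⟨increment σ, rfl⟩, rfl⟩⟩

theorem formCochain_apply (σ : Simplex 1 (regLocus P)) :
    (formCochain P σ : ℂ) = 2 * Real.pi * Complex.I * increment σ := by
  simp [formCochain]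

/-- A primitive along a `2`-simplex restricts to primitives along its faces. -/
theorem coboundary_formCochain (P : MvPolynomial (Fin 2) ℂ) :
    coboundary 1 (regLocus P) (tate realSubgroup 1) (formCochain P) = 0 := by
  funext σ
  obtain ⟨Φ, hΦ⟩ := exists_isPrimitiveAlong σ
  have key : ∀ i : Fin 3, increment (face i σ) =
      Φ (stdSimplex.vertex (i.succAbove 1)) - Φ (stdSimplex.vertex (i.succAbove 0)) := by
    intro i
    have h := increment_eq (σ := face i σ) (hΦ.comp (stdSimplex.continuous_map i.succAbove))
    rw [← stdSimplex.map_vertex i.succAbove, ← stdSimplex.map_vertex i.succAbove]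
    exact h
  apply Subtype.ext
  change ((∑ i : Fin 3, ((-1 : ℤ) ^ (i : ℕ)) • formCochain P (face i σ) :
    tate realSubgroup 1) : ℂ) = 0
  rw [Fin.sum_univ_three]
  simp only [AddSubgroup.coe_add, AddSubgroup.coe_zsmul, formCochain_apply, key]
  have a1 : (0 : Fin 3).succAbove 0 = 1 := rfl
  have a2 : (0 : Fin 3).succAbove 1 = 2 := rfl
  have a3 : (1 : Fin 3).succAbove 0 = 0 := rfl
  have a4 : (1 : Fin 3).succAbove 1 = 2 := rfl
  have a5 : (2 : Fin 3).succAbove 0 = 0 := rfl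
  have a6 : (2 : Fin 3).succAbove 1 = 1 := rfl
  rw [a1, a2, a3, a4, a5, a6]
  push_cast
  simp
  ring

theorem formCochain_mem_relCocycles {R : Set (regLocus P)} (hR : R.Finite) :
    formCochain P ∈ relCocycles R (tate realSubgroup 1) := by
  refine ⟨fun σ hσ => ?_, coboundary_formCochain P⟩
  -- A simplex in a finite set is constant.
  have hconst : ∀ x y, σ x = σ y := fun x y =>
    isPreconnected_univ.constant_of_mapsTo hR.isDiscrete σ.continuous.continuousOn
      (fun z _ => hσ ⟨z, rfl⟩) (mem_univ x) (mem_univ y)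
  have hσc : ⇑σ = fun _ => σ (stdSimplex.vertex 0) := funext fun x => hconst x _
  have h : IsPrimitiveAlong σ fun _ => 0 := by
    rw [hσc]; exact IsPrimitiveAlong.of_const _
  apply Subtype.ext
  rw [formCochain_apply, increment_eq h]
  simp

/-- Two cocycles that integrate the same form agree on differentiable simplices, hence on all. -/
theorem mk_formCochain_eq {R : Set (regLocus P)} (hR : R.Finite)
    {c : RelCoH1 R (tate realSubgroup 1)}
    (hc : IsDeRhamClass R (tate realSubgroup 1) C2log c) :
    c = QuotientAddGroup.mk ⟨formCochain P, formCochain_mem_relCocycles hR⟩ := by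
  obtain ⟨f, rfl, hf⟩ := hc
  congr 1
  apply Subtype.ext
  have h0 : coboundary 1 (regLocus P) (tate realSubgroup 1)
      ((f : Cochain 1 (regLocus P) (tate realSubgroup 1)) - formCochain P) = 0 := by
    rw [map_sub, coboundary_formCochain, sub_zero]
    exact f.2.2
  have h1 := cocycle_eq_zero_of_contDiffOn h0 fun σ hσ => by
    apply Subtype.ext
    have h2 := hf σ hσ
    rw [← increment_eq_curveIntegral σ hσ, ← formCochain_apply] at h2
    rw [Pi.sub_apply, AddSubgroup.coe_sub, h2, sub_self]
    rfl
  exact sub_eq_zero.1 h1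

theorem isDeRhamClass_formCochain {R : Set (regLocus P)} (hR : R.Finite) :
    IsDeRhamClass R (tate realSubgroup 1) C2log
      (QuotientAddGroup.mk ⟨formCochain P, formCochain_mem_relCocycles hR⟩) :=
  ⟨_, rfl, fun σ hσ => by rw [← increment_eq_curveIntegral σ hσ, ← formCochain_apply]⟩

end MahlerSymbol

/-! ### Joining arcs -/

namespace MahlerSymbol

open Filter Metric Set

/-- The additivity of path integrals and of boundaries: the value on a concatenation is the sum of
the values on the parts. -/
def IsAdditive {X : Type*} [TopologicalSpace X] (g : C(unitInterval, X) → ℝ) : Prop :=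
  ∀ a b c, IsConcat a b c → g a + g b = g c

section Concat

variable {X : Type*} [TopologicalSpace X] {a b c : C(unitInterval, X)}

theorem IsConcat.apply_left (h : IsConcat a b c) (s t : unitInterval) (hst : 2 * (t : ℝ) = s) :
    a s = c t := by
  rw [← h.2.1]
  refine congrArg c (Subtype.ext ?_)
  simp only [Icc.coe_zero]
  linarith

theorem IsConcat.apply_right (h : IsConcat a b c) (s t : unitInterval)
    (hst : 2 * (t : ℝ) - 1 = s) : b s = c t := by
  rw [← h.2.2]
  refine congrArg c (Subtype.ext ?_)
  simp only [Icc.coe_one]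
  linarith

theorem IsConcat.apply_zero (h : IsConcat a b c) : c 0 = a 0 :=
  (h.apply_left 0 0 (by simp)).symm

theorem IsConcat.apply_one (h : IsConcat a b c) : c 1 = b 1 :=
  (h.apply_right 1 1 (by simp; norm_num)).symm

/-- The multiplicity of the point `v` in the boundary of a path. -/
noncomputable def boundaryMult (v : X) (γ : C(unitInterval, X)) : ℝ :=
  indicator {v} (fun _ => 1) (γ 1) - indicator {v} (fun _ => 1) (γ 0)

theorem isAdditive_boundaryMult (v : X) : IsAdditive (boundaryMult v) := fun a b c h => by
  simp only [boundaryMult, h.apply_zero, h.apply_one, h.1]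
  ring

end Concat

/-- The arguments along the two parts are lifted to `ℝ` and fitted together by an integral shift. -/
theorem IsPositive.concat {X : Set (ℂ × ℂ)} {a b c : C(unitInterval, X)} (ha : IsPositive a)
    (hb : IsPositive b) (h : IsConcat a b c) : IsPositive c := by
  obtain ⟨θ, hθc, hθm, hθ⟩ := ha
  obtain ⟨η, hηc, hηm, hη⟩ := hb
  have h1 : e (θ 1) = e (η 0) := by rw [← hθ, ← hη, h.1]
  obtain ⟨n, hn⟩ := e_eq_e_iff.1 h1
  -- `u` runs through `[0, 1]` during the first half of the time and `v` during the second.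
  let u : unitInterval → unitInterval := fun t => projIcc 0 1 zero_le_one (2 * (t : ℝ))
  let v : unitInterval → unitInterval := fun t => projIcc 0 1 zero_le_one (2 * (t : ℝ) - 1)
  have hu : Continuous u := continuous_projIcc.comp (by fun_prop)
  have hv : Continuous v := continuous_projIcc.comp (by fun_prop)
  have hum : Monotone u := fun s t hst => monotone_projIcc _ (by
    have : (s : ℝ) ≤ t := hst
    linarith)
  have hvm : Monotone v := fun s t hst => monotone_projIcc _ (by
    have : (s : ℝ) ≤ t := hst
    linarith)
  refine ⟨fun t => θ (u t) + (η (v t) - η 0), (hθc.comp hu).add ((hηc.comp hv).sub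
    continuous_const), fun s t hst => ?_, fun t => ?_⟩
  · have hst' : (s : ℝ) < t := hst
    have m1 := hθm.monotone (hum hst.le)
    have m2 := hηm.monotone (hvm hst.le)
    rcases lt_or_ge (s : ℝ) (1 / 2) with hs | hs
    · have : u s < u t := by
        refine Subtype.coe_lt_coe.1 ?_
        simp only [u, coe_projIcc]
        refine lt_max_of_lt_right ?_
        rw [max_eq_right (le_min zero_le_one (by linarith [s.2.1])), lt_min_iff, min_lt_iff,
          min_lt_iff]
        exact ⟨Or.inr (by linarith), Or.inr (by linarith)⟩
      have := hθm this
      simp only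
      linarith
    · have : v s < v t := by
        refine Subtype.coe_lt_coe.1 ?_
        simp only [v, coe_projIcc]
        rw [min_eq_right (by linarith [s.2.2]), min_eq_right (by linarith [t.2.2]),
          max_eq_right (by linarith), max_eq_right (by linarith)]
        linarith
      have := hηm this
      simp only
      linarith
  · rcases le_or_gt (t : ℝ) (1 / 2) with ht | ht
    · have hv0 : v t = 0 := projIcc_of_le_left _ (by linarith)
      have hut : a (u t) = c t := h.apply_left _ _ (congrArg Subtype.val (projIcc_of_mem
        zero_le_one (show 2 * (t : ℝ) ∈ Icc 0 1 from ⟨by linarith [t.2.1], by linarith⟩))).symm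
      simp only [hv0, sub_self, add_zero, ← hut, hθ]
    · have hu1 : u t = 1 := projIcc_of_right_le _ (by linarith)
      have hvt : b (v t) = c t := h.apply_right _ _ (congrArg Subtype.val (projIcc_of_mem
        zero_le_one (show 2 * (t : ℝ) - 1 ∈ Icc 0 1 from
          ⟨by linarith, by linarith [t.2.2]⟩))).symm
      simp only [hu1, ← hvt, hη]
      rw [e_eq_e_iff]
      exact ⟨-n, by push_cast; linarith⟩

/-- The positively oriented paths `γ` together run through `A` exactly once, up to finitely many
coincidences. -/
structure Traverses {X : Set (ℂ × ℂ)} {ι : Type} (γ : ι → C(unitInterval, X)) (A : Set (ℂ × ℂ)) :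
    Prop where
  positive : ∀ k, IsPositive (γ k)
  cover : {p : ℂ × ℂ | ∃ k s, (γ k s : ℂ × ℂ) = p} = A
  once : {x : (ι × unitInterval) × (ι × unitInterval) |
    x.1 ≠ x.2 ∧ γ x.1.1 x.1.2 = γ x.2.1 x.2.2}.Finite

section Join

variable {X : Set (ℂ × ℂ)} {A : Set (ℂ × ℂ)}

/-- Coincidences are inherited by a reparametrised family. -/
theorem finite_coincidences {Y : Type*} {ι κ : Type} {γ : ι → unitInterval → Y}
    {δ : κ → unitInterval → Y} {T : κ × unitInterval → ι × unitInterval}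
    (hT : Function.Injective T) (h : ∀ x, δ x.1 x.2 = γ (T x).1 (T x).2)
    (hγ : {x : (ι × unitInterval) × (ι × unitInterval) |
      x.1 ≠ x.2 ∧ γ x.1.1 x.1.2 = γ x.2.1 x.2.2}.Finite) :
    {x : (κ × unitInterval) × (κ × unitInterval) |
      x.1 ≠ x.2 ∧ δ x.1.1 x.1.2 = δ x.2.1 x.2.2}.Finite := by
  refine (hγ.preimage ((hT.prodMap hT).injOn)).subset fun x hx => ⟨fun hne => hx.1 (hT hne), ?_⟩
  have := hx.2
  rwa [h, h] at this

/-- Two paths of the family, one ending where the other begins, are replaced by their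
concatenation. -/
theorem Traverses.exists_join {ι : Type} [Fintype ι] [DecidableEq ι] {γ : ι → C(unitInterval, X)}
    (hγ : Traverses γ A) {i j : ι} (hij : i ≠ j) (h : γ i 1 = γ j 0) :
    ∃ δ : {k // k ≠ j} → C(unitInterval, X), Traverses δ A ∧
      ∀ g, IsAdditive g → ∑ k, g (δ k) = ∑ k, g (γ k) := by
  obtain ⟨c, hc, hc1, hc2⟩ := exists_isConcat h
  choose! u hu hcu using hc1
  choose! v hv hcv using hc2
  let δ : {k // k ≠ j} → C(unitInterval, X) := fun k => if k.1 = i then c else γ k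
  have hδi : ∀ k, k.1 = i → δ k = c := fun k hk => if_pos hk
  have hδ : ∀ k, k.1 ≠ i → δ k = γ k := fun k hk => if_neg hk
  refine ⟨δ, ⟨fun k => ?_, ?_, ?_⟩, fun g hg => ?_⟩
  · by_cases hk : k.1 = i
    · rw [hδi k hk]
      exact (hγ.positive i).concat (hγ.positive j) hc
    · rw [hδ k hk]
      exact hγ.positive _
  · rw [← hγ.cover]
    ext p
    constructor
    · rintro ⟨k, s, rfl⟩
      by_cases hk : k.1 = i
      · rw [hδi k hk]
        rcases le_or_gt (s : ℝ) (1 / 2) with hs | hs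
        · exact ⟨i, u s, by rw [hcu s hs]⟩
        · exact ⟨j, v s, by rw [hcv s hs]⟩
      · exact ⟨k, s, by rw [hδ k hk]⟩
    · rintro ⟨k, s, rfl⟩
      by_cases hk : k = i
      · subst hk
        have hs : (s : ℝ) / 2 ∈ Icc (0 : ℝ) 1 := ⟨by linarith [s.2.1], by linarith [s.2.2]⟩
        refine ⟨⟨k, hij⟩, ⟨(s : ℝ) / 2, hs⟩, ?_⟩
        rw [hδi _ rfl, hc.apply_left s ⟨(s : ℝ) / 2, hs⟩ (show 2 * ((s : ℝ) / 2) = s by ring)]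
      by_cases hkj : k = j
      · subst hkj
        have hs : ((s : ℝ) + 1) / 2 ∈ Icc (0 : ℝ) 1 :=
          ⟨by linarith [s.2.1], by linarith [s.2.2]⟩
        refine ⟨⟨i, hij⟩, ⟨((s : ℝ) + 1) / 2, hs⟩, ?_⟩
        rw [hδi _ rfl, hc.apply_right s ⟨((s : ℝ) + 1) / 2, hs⟩
          (show 2 * (((s : ℝ) + 1) / 2) - 1 = s by ring)]
      · exact ⟨⟨k, hkj⟩, s, by rw [hδ _ hk]⟩
  -- `T` returns the path and the parameter of the old family that a parameter of the new one
  -- comes from.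
  · let T : {k // k ≠ j} × unitInterval → ι × unitInterval := fun x =>
      if x.1.1 = i then if (x.2 : ℝ) ≤ 1 / 2 then (i, u x.2) else (j, v x.2) else (x.1.1, x.2)
    refine finite_coincidences (T := T) (γ := fun k => γ k) (δ := fun k => δ k) ?_ ?_ hγ.once
    · rintro ⟨⟨k, hk⟩, s⟩ ⟨⟨l, hl⟩, t⟩ hT
      simp only [T] at hT
      have hus := hu s
      have hut := hu t
      have hvs := hv s
      have hvt := hv t
      by_cases hki : k = i
      · subst hki
        by_cases hli : l = k
        · subst hli
          simp only [if_true] at hT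
          by_cases hs : (s : ℝ) ≤ 1 / 2 <;> by_cases ht : (t : ℝ) ≤ 1 / 2 <;>
            simp only [hs, ht, if_true, if_false, Prod.mk.injEq] at hT
          · have h1 := hus hs
            rw [hT.2, hut ht] at h1
            have : s = t := Subtype.ext (by linarith)
            rw [this]
          · exact absurd hT.1 hij
          · exact absurd hT.1.symm hij
          · have h1 := hvs (not_le.1 hs)
            rw [hT.2, hvt (not_le.1 ht)] at h1
            have : s = t := Subtype.ext (by linarith)
            rw [this]
        · simp only [hli, if_true, if_false] at hT
          split_ifs at hT
          · exact absurd (congrArg Prod.fst hT).symm hli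
          · exact absurd (congrArg Prod.fst hT).symm hl
      · by_cases hli : l = i
        · simp only [hki, hli, if_true, if_false] at hT
          split_ifs at hT
          · exact absurd (congrArg Prod.fst hT) hki
          · exact absurd (congrArg Prod.fst hT) hk
        · simp only [hki, hli, if_false, Prod.mk.injEq] at hT
          obtain ⟨rfl, rfl⟩ := hT
          rfl
    · rintro ⟨⟨k, hk⟩, s⟩
      simp only [T]
      by_cases hki : k = i
      · rw [hδi _ hki, if_pos hki]
        split_ifs with hs
        · exact hcu s hs
        · exact hcv s (not_le.1 hs)
      · rw [hδ _ hki, if_neg hki]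
  · have e1 := Fintype.sum_eq_add_sum_subtype_ne (fun k => g (γ k)) j
    have e2 := Fintype.sum_eq_add_sum_subtype_ne (fun k => g (δ k)) ⟨i, hij⟩
    have e3 := Fintype.sum_eq_add_sum_subtype_ne (fun k : {k // k ≠ j} => g (γ k)) ⟨i, hij⟩
    have e4 : ∀ k : {k : {k // k ≠ j} // k ≠ ⟨i, hij⟩}, g (δ k.1) = g (γ k.1) := fun k => by
      rw [hδ _ fun hk => k.2 (Subtype.ext hk)]
    rw [e1, e2, e3, hδi _ rfl, ← hg _ _ _ hc, Fintype.sum_congr _ _ e4]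
    ring

/-- Joining paths as long as possible: in the end no non-closed path ends where another begins. -/
theorem Traverses.exists_reduced {ι : Type} [Fintype ι] {γ : ι → C(unitInterval, X)}
    (hγ : Traverses γ A) :
    ∃ (κ : Type) (_ : Fintype κ) (δ : κ → C(unitInterval, X)), Traverses δ A ∧
      (∀ i j, δ i 0 ≠ δ i 1 → δ j 0 ≠ δ j 1 → δ i 1 ≠ δ j 0) ∧
      ∀ g, IsAdditive g → ∑ k, g (δ k) = ∑ k, g (γ k) := by
  classical
  induction hn : Fintype.card ι using Nat.strong_induction_on generalizing ι with
  | _ n ih =>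
  by_cases hex : ∃ i j, i ≠ j ∧ γ i 1 = γ j 0 ∧ γ i 0 ≠ γ i 1 ∧ γ j 0 ≠ γ j 1
  · obtain ⟨i, j, hij, h, -, -⟩ := hex
    obtain ⟨δ, hδ, hsum⟩ := hγ.exists_join hij h
    obtain ⟨κ, hκ, ε, h1, h2, h3⟩ := ih (Fintype.card {k // k ≠ j})
      (hn ▸ Fintype.card_subtype_lt (x := j) (by simp)) hδ rfl
    exact ⟨κ, hκ, ε, h1, h2, fun g hg => (h3 g hg).trans (hsum g hg)⟩
  · refine ⟨ι, inferInstance, γ, hγ, fun i j hi hj h => ?_, fun g _ => rfl⟩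
    rcases eq_or_ne i j with rfl | hij
    · exact hi h.symm
    · exact hex ⟨i, j, hij, h, hi, hj⟩

/-- For a reduced family the end points of the non-closed paths are the points of the boundary: at
such a point only initial points or only end points occur, so their contributions do not cancel. -/
theorem sum_boundaryMult_ne_zero_iff {X : Type*} [TopologicalSpace X] {κ : Type} [Fintype κ]
    {δ : κ → C(unitInterval, X)}
    (hδ : ∀ i j, δ i 0 ≠ δ i 1 → δ j 0 ≠ δ j 1 → δ i 1 ≠ δ j 0) (v : X) :
    ∑ k, boundaryMult v (δ k) ≠ 0 ↔ ∃ k, δ k 0 ≠ δ k 1 ∧ (v = δ k 0 ∨ v = δ k 1) := by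
  have hnn : ∀ v w : X, 0 ≤ indicator {v} (fun _ => (1 : ℝ)) w := fun v =>
    indicator_nonneg fun _ _ => zero_le_one
  constructor
  · intro h
    obtain ⟨k, -, hk⟩ := Finset.exists_ne_zero_of_sum_ne_zero h
    refine ⟨k, fun h01 => hk (by simp [boundaryMult, h01]), ?_⟩
    by_contra hnot
    rw [not_or] at hnot
    exact hk (by simp [boundaryMult, Ne.symm hnot.1, Ne.symm hnot.2])
  · rintro ⟨k, hk, rfl | rfl⟩
    · refine (Finset.sum_neg' (fun i _ => ?_) ⟨k, Finset.mem_univ k, ?_⟩).ne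
      · by_cases hi : δ i 0 = δ i 1
        · simp [boundaryMult, hi]
        · have h0 := hnn (δ k 0) (δ i 0)
          rw [boundaryMult, indicator_of_notMem (s := {δ k 0}) (hδ i k hi hk)]
          linarith
      · simp [boundaryMult, hk.symm]
    · refine (Finset.sum_pos' (fun i _ => ?_) ⟨k, Finset.mem_univ k, ?_⟩).ne'
      · by_cases hi : δ i 0 = δ i 1
        · simp [boundaryMult, hi]
        · have h0 := hnn (δ k 1) (δ i 1)
          rw [boundaryMult, indicator_of_notMem (s := {δ k 1}) (hδ k i hk hi).symm]
          linarith
      · simp [boundaryMult, hk]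

end Join

namespace ArcFamily

variable {P : MvPolynomial (Fin 2) ℂ} (𝔸 : ArcFamily P)
  (hstar : ∀ z : ℂ, ‖z‖ = 1 → evalAt P (z, 0) ≠ 0) (hA : arcSet P ⊆ regLocus P)

/-- The argument of the first coordinate along the `i`-th arc. -/
noncomputable def arg (i : 𝔸.ι) (s : ℝ) : ℝ := 𝔸.lo i + s * (𝔸.hi i - 𝔸.lo i)

theorem arg_mem_Icc (i : 𝔸.ι) {s : ℝ} (hs : s ∈ Icc (0 : ℝ) 1) :
    𝔸.arg i s ∈ Icc (𝔸.lo i) (𝔸.hi i) := by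
  have := 𝔸.lt i
  simp only [arg]
  constructor <;> nlinarith [hs.1, hs.2]

theorem arg_mem_Ioo (i : 𝔸.ι) {s : ℝ} (hs : s ∈ Ioo (0 : ℝ) 1) :
    𝔸.arg i s ∈ Ioo (𝔸.lo i) (𝔸.hi i) := by
  have := 𝔸.lt i
  simp only [arg]
  constructor <;> nlinarith [hs.1, hs.2]

theorem arg_strictMono (i : 𝔸.ι) : StrictMono (𝔸.arg i) := fun s t hst => by
  have := sub_pos.2 (𝔸.lt i)
  simp only [arg]
  gcongr

/-- The `i`-th arc as a path. -/
noncomputable def path (i : 𝔸.ι) : C(unitInterval, regLocus P) where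
  toFun s := ⟨𝔸.pt i (𝔸.arg i s), hA (𝔸.pt_mem_arcSet hstar (𝔸.arg_mem_Icc i s.2))⟩
  continuous_toFun := Continuous.subtype_mk ((𝔸.continuousOn_pt i).comp_continuous
    (by unfold arg; fun_prop) fun s => 𝔸.arg_mem_Icc i s.2) _

theorem traverses_path : Traverses (𝔸.path hstar hA) (arcSet P) := by
  refine ⟨fun i => ⟨fun s => 𝔸.arg i s, by unfold arg; fun_prop, fun s t hst =>
    𝔸.arg_strictMono i hst, fun s => rfl⟩, ?_, ?_⟩
  · rw [𝔸.arcSet_eq hstar]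
    ext p
    simp only [mem_ofPred_eq, mem_iUnion]
    refine exists_congr fun i => ⟨?_, ?_⟩
    · rintro ⟨s, rfl⟩
      exact ⟨_, 𝔸.arg_mem_Icc i s.2, rfl⟩
    · rintro ⟨α, hα, rfl⟩
      have hpos := sub_pos.2 (𝔸.lt i)
      refine ⟨⟨(α - 𝔸.lo i) / (𝔸.hi i - 𝔸.lo i), div_nonneg (by linarith [hα.1]) hpos.le,
        div_le_one_of_le₀ (by linarith [hα.2]) hpos.le⟩, ?_⟩
      change 𝔸.pt i (𝔸.arg i _) = _
      rw [arg, div_mul_cancel₀ _ hpos.ne', add_sub_cancel]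
  · -- Coincidences occur only at end points of arcs.
    have key : ∀ (i j : 𝔸.ι) (s t : unitInterval), 𝔸.pt i (𝔸.arg i s) = 𝔸.pt j (𝔸.arg j t) →
        (i, s) ≠ (j, t) → s ∈ ({0, 1} : Set unitInterval) := by
      intro i j s t h hne
      by_contra hs
      simp only [mem_insert_iff, mem_singleton_iff, not_or] at hs
      have hs' : (s : ℝ) ∈ Ioo (0 : ℝ) 1 := ⟨unitInterval.pos_iff_ne_zero.2 hs.1,
        unitInterval.lt_one_iff_ne_one.2 hs.2⟩
      have hi := 𝔸.arg_mem_Ioo i hs'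
      have hI := 𝔸.Icc_subset i
      have hj := 𝔸.arg_mem_Icc j t.2
      have heq : 𝔸.arg i s = 𝔸.arg j t := eq_of_e_eq
        ⟨(hI (left_mem_Icc.2 (𝔸.lt i).le)).1.trans_lt hi.1,
          hi.2.trans_le (hI (right_mem_Icc.2 (𝔸.lt i).le)).2⟩
        (𝔸.Icc_subset j hj) (congrArg Prod.fst h)
      have hcrit := 𝔸.notMem i _ hi
      have hj' : 𝔸.arg i s ∈ Ioo (𝔸.lo j) (𝔸.hi j) := by
        rw [heq] at hcrit ⊢
        exact ⟨lt_of_le_of_ne hj.1 fun h => hcrit (h ▸ 𝔸.lo_mem j),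
          lt_of_le_of_ne hj.2 fun h => hcrit (h ▸ 𝔸.hi_mem j)⟩
      have hij : i = j := 𝔸.inj i j _ hi hj' (by
        have := congrArg Prod.snd h
        simp only [pt, ← heq] at this
        exact this)
      subst hij
      exact hne (by rw [Subtype.ext ((𝔸.arg_strictMono i).injective heq)])
    have hfin : ((univ : Set 𝔸.ι) ×ˢ ({0, 1} : Set unitInterval)).Finite :=
      finite_univ.prod (toFinite _)
    refine (hfin.prod hfin).subset ?_
    rintro ⟨⟨i, s⟩, ⟨j, t⟩⟩ ⟨hne, h⟩
    have h' := congrArg Subtype.val h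
    exact ⟨⟨mem_univ _, key i j s t h' hne⟩, ⟨mem_univ _, key j i t s h'.symm hne.symm⟩⟩

theorem path_zero (i : 𝔸.ι) : (𝔸.path hstar hA i 0 : ℂ × ℂ) = 𝔸.pt i (𝔸.lo i) := by
  change 𝔸.pt i (𝔸.arg i _) = _
  simp [arg]

theorem path_one (i : 𝔸.ι) : (𝔸.path hstar hA i 1 : ℂ × ℂ) = 𝔸.pt i (𝔸.hi i) := by
  change 𝔸.pt i (𝔸.arg i _) = _
  simp [arg]

theorem sum_boundaryMult_path (v : regLocus P) : ∑ i, boundaryMult v (𝔸.path hstar hA i) =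
    ({i | 𝔸.pt i (𝔸.hi i) = v}.ncard : ℝ) - {i | 𝔸.pt i (𝔸.lo i) = v}.ncard := by
  classical
  have hcard : ∀ q : 𝔸.ι → Prop, ({i | q i}.ncard : ℝ) = ∑ i, if q i then 1 else 0 := fun q => by
    rw [ncard_eq_toFinset_card', Finset.sum_boole]
    simp
  rw [hcard, hcard, ← Finset.sum_sub_distrib]
  refine Finset.sum_congr rfl fun i _ => ?_
  simp only [boundaryMult, indicator_apply, mem_singleton_iff, Subtype.ext_iff, path_zero, path_one]
  congr

/-- The arcs are joined to closed paths and to paths that run between points of `R_P`. -/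
theorem exists_arcDecomposition : ∃ D : ArcDecomposition P, ∀ g, IsAdditive g →
    ∑ μ, g (D.χ μ) + ∑ ν, g (D.ψ ν) = ∑ i, g (𝔸.path hstar hA i) := by
  classical
  obtain ⟨κ, _, δ, hδ, hred, hsum⟩ := (𝔸.traverses_path hstar hA).exists_reduced
  let q : κ → Prop := fun k => δ k 0 = δ k 1
  let eC := (Fintype.equivFin {k // q k}).symm
  let eO := (Fintype.equivFin {k // ¬ q k}).symm
  let E := (Equiv.sumCongr eC eO).trans (Equiv.sumCompl q)
  have hE : ∀ x, Sum.elim (fun μ => δ (eC μ)) (fun ν => δ (eO ν)) x = δ (E x) := by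
    rintro (μ | ν) <;> rfl
  refine ⟨{
    numClosed := _
    numOpen := _
    χ := fun μ => δ (eC μ)
    ψ := fun ν => δ (eO ν)
    closed := fun μ => (eC μ).2
    notClosed := fun ν => (eO ν).2
    positive_closed := fun μ => hδ.positive _
    positive_open := fun ν => hδ.positive _
    cover := ?_
    once := ?_
    endpoints := ?_ }, fun g hg => ?_⟩
  · rw [← hδ.cover]
    ext p
    constructor
    · rintro (⟨μ, s, h⟩ | ⟨ν, s, h⟩)
      · exact ⟨_, s, h⟩
      · exact ⟨_, s, h⟩
    · rintro ⟨k, s, h⟩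
      obtain ⟨x, rfl⟩ := E.surjective k
      rw [← hE] at h
      rcases x with μ | ν
      · exact Or.inl ⟨μ, s, h⟩
      · exact Or.inr ⟨ν, s, h⟩
  · exact finite_coincidences (γ := fun k => δ k) 
      (δ := fun x => ⇑((Sum.elim (fun μ => δ (eC μ)) (fun ν => δ (eO ν)) x : C(_, _))))
      (T := Prod.map E id) (E.injective.prodMap Function.injective_id)
      (fun x => congrArg (fun γ => γ x.2) (hE x.1)) hδ.once
  · have hcoe : ∀ v : regLocus P, v ∈ boundaryIn P ↔ ∑ k, boundaryMult v (δ k) ≠ 0 := by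
      intro v
      rw [hsum _ (isAdditive_boundaryMult v), 𝔸.sum_boundaryMult_path hstar hA, sub_ne_zero]
      by_cases hv : (v : ℂ × ℂ) ∈ arcSet P
      · rw [boundaryIn, mem_preimage, 𝔸.mem_boundaryPts_iff hstar hv, Ne, Ne, Nat.cast_inj]
      · have hvb : v ∉ boundaryIn P := fun h => hv h.1
        have h1 : {i | 𝔸.pt i (𝔸.hi i) = v} = ∅ := eq_empty_of_forall_notMem fun i hi =>
          hv (hi ▸ 𝔸.pt_mem_arcSet hstar (right_mem_Icc.2 (𝔸.lt i).le))
        have h2 : {i | 𝔸.pt i (𝔸.lo i) = v} = ∅ := eq_empty_of_forall_notMem fun i hi =>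
          hv (hi ▸ 𝔸.pt_mem_arcSet hstar (left_mem_Icc.2 (𝔸.lt i).le))
        simp [h1, h2, hvb]
    ext v
    rw [hcoe, sum_boundaryMult_ne_zero_iff hred]
    constructor
    · rintro ⟨ν, h⟩
      exact ⟨_, (eO ν).2, h⟩
    · rintro ⟨k, hk, h⟩
      refine ⟨eO.symm ⟨k, hk⟩, ?_⟩
      simpa using h
  · rw [← hsum g hg, ← E.sum_comp, Fintype.sum_sum_type]
    rfl

end ArcFamily

end MahlerSymbol

/-! ### Jensen's formula on the fibres -/

namespace MahlerSymbol

open Filter Metric Set MeasureTheory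

/-- Jensen's formula for a polynomial that does not vanish at the origin. -/
theorem logMahlerMeasure_eq_log_eval_zero {p : Polynomial ℂ} (h0 : p.eval 0 ≠ 0) :
    p.logMahlerMeasure =
      Real.log ‖p.eval 0‖ + (p.roots.map fun a => Real.posLog ‖a‖⁻¹).sum := by
  have hp : p ≠ 0 := fun h => h0 (by rw [h, Polynomial.eval_zero])
  have hroots : ∀ a ∈ p.roots, ‖a‖ ≠ 0 := fun a ha hn => h0 (by
    have h := (Polynomial.mem_roots'.1 ha).2
    rwa [norm_eq_zero.1 hn] at h)
  have hlog : ∀ s : Multiset ℂ, (∀ a ∈ s, ‖a‖ ≠ 0) →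
      Real.log ‖s.prod‖ + (s.map fun a => Real.posLog ‖a‖⁻¹).sum =
        (s.map fun a => Real.posLog ‖a‖).sum := by
    intro s
    induction s using Multiset.induction_on with
    | empty => simp
    | cons a s ih =>
      intro hs
      have h1 := hs a (Multiset.mem_cons_self a s)
      have h2 := fun b hb => hs b (Multiset.mem_cons_of_mem hb)
      have h3 : ‖s.prod‖ ≠ 0 := norm_ne_zero_iff.2 fun h =>
        h2 0 (Multiset.prod_eq_zero_iff.1 h) norm_zero
      have h4 := Real.posLog_sub_posLog_inv (x := ‖a‖)
      simp only [Multiset.prod_cons, Multiset.map_cons, Multiset.sum_cons, norm_mul,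
        Real.log_mul h1 h3]
      linarith [ih h2]
  have hlc : ‖p.leadingCoeff‖ ≠ 0 := norm_ne_zero_iff.2 (Polynomial.leadingCoeff_ne_zero.2 hp)
  have hprod : ‖p.roots.prod‖ ≠ 0 := norm_ne_zero_iff.2 fun h =>
    hroots 0 (Multiset.prod_eq_zero_iff.1 h) norm_zero
  rw [Polynomial.logMahlerMeasure_eq_log_leadingCoeff_add_sum_log_roots,
    ← Polynomial.coeff_zero_eq_eval_zero,
    (IsAlgClosed.splits p).coeff_zero_eq_leadingCoeff_mul_prod_roots, norm_mul, norm_mul, norm_pow,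
    norm_neg, norm_one, one_pow, one_mul, Real.log_mul hlc hprod, add_assoc, hlog _ hroots]

theorem integral_log_norm_eval_e (p : Polynomial ℂ) :
    ∫ β in (0 : ℝ)..1, Real.log ‖p.eval (e β)‖ = p.logMahlerMeasure := by
  have he : ∀ β : ℝ, e β = circleMap 0 1 (2 * Real.pi * β) := fun β => by
    simp only [e, circleMap]
    push_cast
    rw [zero_add, one_mul]
    congr 1
    ring
  simp only [he]
  rw [intervalIntegral.integral_comp_mul_left
    (fun θ => Real.log ‖p.eval (circleMap 0 1 θ)‖) (by positivity : 2 * Real.pi ≠ 0),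
    Polynomial.logMahlerMeasure_def, Real.circleAverage_def, mul_zero, mul_one]

variable {P : MvPolynomial (Fin 2) ℂ}

theorem evalAt_pStar (P : MvPolynomial (Fin 2) ℂ) (p : ℂ × ℂ) :
    evalAt (pStar P) p = evalAt P (p.1, 0) := by
  simp only [evalAt, pStar]
  rw [MvPolynomial.aeval_def, ← MvPolynomial.coe_eval₂Hom]
  change ((MvPolynomial.eval ![p.1, p.2]).comp (MvPolynomial.eval₂Hom _ _)) P = _
  congr 1
  ext i
  · simp
  · fin_cases i <;> simp

theorem mahler_pStar (P : MvPolynomial (Fin 2) ℂ) :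
    mahler (pStar P) = ∫ α in (0 : ℝ)..1, Real.log ‖evalAt P (e α, 0)‖ := by
  simp [mahler, evalAt_pStar]

namespace ArcFamily

variable (𝔸 : ArcFamily P)

/-- Jensen's formula on the fibre over `e(α)`: the roots in the closed disc are the values of the
arcs over `α`. -/
theorem integral_log_norm_evalAt (hstar : ∀ z : ℂ, ‖z‖ = 1 → evalAt P (z, 0) ≠ 0) {α : ℝ}
    (hα : α ∈ Icc (0 : ℝ) 1) (hc : α ∉ 𝔸.crit) :
    ∫ β in (0 : ℝ)..1, Real.log ‖evalAt P (e α, e β)‖ = Real.log ‖evalAt P (e α, 0)‖ +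
      ∑ i, (Ioo (𝔸.lo i) (𝔸.hi i)).indicator (fun α => -Real.log ‖𝔸.F i α‖) α := by
  classical
  set p := fiberPoly P (e α) with hp
  have h0 : p.eval 0 ≠ 0 := by
    rw [hp, eval_fiberPoly]
    exact hstar _ (norm_e α)
  have hp0 : p ≠ 0 := fiberPoly_ne_zero (hstar _ (norm_e α))
  have hroot : ∀ z, z ∈ p.roots ↔ evalAt P (e α, z) = 0 := fun z => by
    rw [Polynomial.mem_roots hp0, Polynomial.IsRoot, hp, eval_fiberPoly]
  -- Off the critical arguments the roots are simple.
  have hnodup : p.roots.Nodup := by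
    rw [Multiset.nodup_iff_count_le_one]
    intro z
    by_contra hz
    rw [Polynomial.count_roots, not_le, Polynomial.one_lt_rootMultiplicity_iff_isRoot hp0] at hz
    have h1 := hz.1
    have h2 := hz.2
    rw [Polynomial.IsRoot, hp, eval_fiberPoly] at h1
    rw [Polynomial.IsRoot, hp, derivative_fiberPoly, eval_fiberPoly] at h2
    exact 𝔸.pderiv_ne_zero α hα hc z h1 h2
  simp only [← eval_fiberPoly]
  rw [integral_log_norm_eval_e, ← hp, logMahlerMeasure_eq_log_eval_zero h0]
  congr 1
  have hsum : (p.roots.map fun a => Real.posLog ‖a‖⁻¹).sum =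
      ∑ a ∈ p.roots.toFinset, Real.posLog ‖a‖⁻¹ := by
    rw [Finset.sum, Multiset.toFinset_val, hnodup.dedup]
  simp only [indicator_apply]
  rw [hsum, ← Finset.sum_filter]
  have hmem : ∀ i, α ∈ Ioo (𝔸.lo i) (𝔸.hi i) → 𝔸.F i α ∈ discFiber P α := fun i hi =>
    𝔸.mem i α (Ioo_subset_Icc_self hi)
  have hF : ∀ i ∈ Finset.univ.filter fun i => α ∈ Ioo (𝔸.lo i) (𝔸.hi i),
      -Real.log ‖𝔸.F i α‖ = Real.posLog ‖𝔸.F i α‖⁻¹ := by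
    intro i hi
    have hm := hmem i (Finset.mem_filter.1 hi).2
    have hpos : 0 < ‖𝔸.F i α‖ := norm_pos_iff.2 (ne_zero_of_mem_discFiber hstar hm)
    rw [Real.posLog_eq_log, Real.log_inv]
    rw [abs_of_pos (inv_pos.2 hpos)]
    exact (one_le_inv₀ hpos).2 hm.1
  rw [Finset.sum_congr rfl hF, ← Finset.sum_image (g := fun i => 𝔸.F i α)
    (f := fun a : ℂ => Real.posLog ‖a‖⁻¹)]
  · symm
    refine Finset.sum_subset (fun a ha => ?_) fun a ha ha' => ?_
    · obtain ⟨i, hi, rfl⟩ := Finset.mem_image.1 ha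
      rw [Multiset.mem_toFinset, hroot]
      exact (hmem i (Finset.mem_filter.1 hi).2).2
    · rw [Multiset.mem_toFinset, hroot] at ha
      rw [Real.posLog_eq_zero_iff, abs_of_nonneg (by positivity)]
      refine inv_le_one_of_one_le₀ (le_of_not_ge fun hle => ha' ?_)
      obtain ⟨i, hi, hia⟩ := 𝔸.exists_eq α hα hc a ⟨hle, ha⟩
      exact Finset.mem_image.2 ⟨i, Finset.mem_filter.2 ⟨Finset.mem_univ i, hi⟩, hia⟩
  · intro i hi j hj h
    simp only [Finset.coe_filter, Finset.mem_univ, true_and, mem_ofPred_eq] at hi hj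
    exact 𝔸.inj i j α hi hj h

theorem continuousOn_log_norm (hstar : ∀ z : ℂ, ‖z‖ = 1 → evalAt P (z, 0) ≠ 0) (i : 𝔸.ι) :
    ContinuousOn (fun α => -Real.log ‖𝔸.F i α‖) (Icc (𝔸.lo i) (𝔸.hi i)) :=
  ((𝔸.cont i).norm.log fun α hα =>
    norm_ne_zero_iff.2 (ne_zero_of_mem_discFiber hstar (𝔸.mem i α hα))).neg

/-- The difference of the Mahler measures as a sum of integrals over the arcs. -/
theorem mahler_sub_mahler_pStar (hstar : ∀ z : ℂ, ‖z‖ = 1 → evalAt P (z, 0) ≠ 0) :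
    mahler P - mahler (pStar P) =
    ∑ i, ∫ α in 𝔸.lo i..𝔸.hi i, -Real.log ‖𝔸.F i α‖ := by
  have hint : ∀ i, Integrable
      ((Ioo (𝔸.lo i) (𝔸.hi i)).indicator fun α => -Real.log ‖𝔸.F i α‖) := fun i => by
    rw [integrable_indicator_iff measurableSet_Ioo]
    exact ((𝔸.continuousOn_log_norm hstar i).integrableOn_Icc).mono_set Ioo_subset_Icc_self
  have hsub : ∀ i, Ioo (𝔸.lo i) (𝔸.hi i) ⊆ Ioc 0 1 := fun i α hα =>
    ⟨(𝔸.Icc_subset i (left_mem_Icc.2 (𝔸.lt i).le)).1.trans_lt hα.1,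
      (𝔸.Icc_subset i (Ioo_subset_Icc_self hα)).2⟩
  have h1 : mahler P = ∫ α in (0 : ℝ)..1, (Real.log ‖evalAt P (e α, 0)‖ +
      ∑ i, (Ioo (𝔸.lo i) (𝔸.hi i)).indicator (fun α => -Real.log ‖𝔸.F i α‖) α) := by
    refine intervalIntegral.integral_congr_ae ?_
    filter_upwards [𝔸.crit.finite_toSet.countable.ae_notMem volume] with α hα h
    rw [uIoc_of_le zero_le_one] at h
    exact 𝔸.integral_log_norm_evalAt hstar (Ioc_subset_Icc_self h) hα
  have hcont : Continuous fun α : ℝ => Real.log ‖evalAt P (e α, 0)‖ :=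
    (((continuous_evalAt P).comp (continuous_e.prodMk continuous_const)).norm).log fun α =>
      norm_ne_zero_iff.2 (hstar _ (norm_e α))
  rw [h1, mahler_pStar, intervalIntegral.integral_add (hcont.intervalIntegrable 0 1)
    (integrable_finsetSum _ fun i _ => hint i).intervalIntegrable, add_sub_cancel_left,
    intervalIntegral.integral_finsetSum fun i _ => (hint i).intervalIntegrable]
  refine Finset.sum_congr rfl fun i _ => ?_
  rw [intervalIntegral.integral_of_le zero_le_one, setIntegral_indicator measurableSet_Ioo,
    inter_eq_self_of_subset_right (hsub i), intervalIntegral.integral_of_le (𝔸.lt i).le,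
    integral_Ioc_eq_integral_Ioo]

end ArcFamily

end MahlerSymbol

/-! ### The pairing with the cycle of arcs -/

namespace MahlerSymbol

open Filter Metric Set

variable {P : MvPolynomial (Fin 2) ℂ}

theorem isAdditive_increment :
    IsAdditive fun γ : C(unitInterval, regLocus P) => increment (simplexOfPath γ) := by
  intro a b c h
  have h1 := congrArg Subtype.val (cocycle_concat (coboundary_formCochain P) h)
  rw [AddSubgroup.coe_add, formCochain_apply, formCochain_apply, formCochain_apply, ← mul_add] at h1
  exact_mod_cast mul_left_cancel₀ Complex.two_pi_I_ne_zero h1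

theorem kronecker_pathClass {X : Type*} [TopologicalSpace X] {R : Set X} {M : AddSubgroup ℂ} {n : ℤ}
    (f : relCocycles R M) (γ : C(unitInterval, X)) (h : γ 0 = γ 1 ∨ γ 0 ∈ R ∧ γ 1 ∈ R) :
    kronecker R M (tate intSubgroup n) (QuotientAddGroup.mk f)
        (mapCoeff R (toTate n) (pathClass R γ h)) =
      ((f : Cochain 1 X M) (simplexOfPath γ) : ℂ) * (2 * Real.pi * Complex.I) ^ n := by
  change evalChain 1 X M (tate intSubgroup n) f
    (Finsupp.mapRange.addMonoidHom (toTate n) (Finsupp.single (simplexOfPath γ) 1)) = _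
  rw [Finsupp.mapRange.addMonoidHom_apply, Finsupp.mapRange_single, evalChain_single]
  simp [toTate]

/-- The twists by `2πi` and `(2πi)⁻¹` cancel in the pairing. -/
theorem kronecker_twistedCls (D : ArcDecomposition P) (hR : (boundaryIn P).Finite) :
    kronecker (boundaryIn P) (tate realSubgroup 1) (tate intSubgroup (-1))
        (QuotientAddGroup.mk ⟨formCochain P, formCochain_mem_relCocycles hR⟩) D.twistedCls =
      ((∑ μ, increment (simplexOfPath (D.χ μ)) + ∑ ν, increment (simplexOfPath (D.ψ ν)) : ℝ) :
        ℂ) := by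
  have hval : ∀ r : ℝ, (2 * Real.pi * Complex.I * r : ℂ) * (2 * Real.pi * Complex.I) ^ (-1 : ℤ) =
      r := fun r => by
    have := Complex.two_pi_I_ne_zero
    rw [zpow_neg_one]
    field_simp
  rw [ArcDecomposition.twistedCls, ArcDecomposition.cls]
  simp only [map_add, map_sum, kronecker_pathClass, formCochain_apply, hval]
  push_cast
  rfl

namespace ArcFamily

variable (𝔸 : ArcFamily P) (hstar : ∀ z : ℂ, ‖z‖ = 1 → evalAt P (z, 0) ≠ 0)
  (hA : arcSet P ⊆ regLocus P)

/-- On `|t₁| = 1` the form restricts to `-log |t₂| dα`, where `t₁ = e(α)`. -/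
theorem increment_path (i : 𝔸.ι) : increment (simplexOfPath (𝔸.path hstar hA i)) =
    ∫ α in 𝔸.lo i..𝔸.hi i, -Real.log ‖𝔸.F i α‖ := by
  set d := 𝔸.hi i - 𝔸.lo i with hd
  let v : ℝ → ℂ × ℂ := fun s =>
    (d • (2 * Real.pi * Complex.I * e (𝔸.arg i s)), d • deriv (𝔸.F i) (𝔸.arg i s))
  have hpath : ∀ s ∈ Icc (0 : ℝ) 1, (𝔸.path hstar hA i (projIcc 0 1 zero_le_one s) : ℂ × ℂ) =
      𝔸.pt i (𝔸.arg i s) := fun s hs => by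
    rw [projIcc_of_mem zero_le_one hs]
    rfl
  have hform : ∀ s ∈ Icc (0 : ℝ) 1,
      argForm (𝔸.path hstar hA i (projIcc 0 1 zero_le_one s)) (v s) =
        d * -Real.log ‖𝔸.F i (𝔸.arg i s)‖ := by
    intro s hs
    rw [hpath s hs]
    have h1 : (v s).1 / e (𝔸.arg i s) = d * (2 * Real.pi) * Complex.I := by
      have := e_ne_zero (𝔸.arg i s)
      simp only [v, Complex.real_smul]
      field_simp
    simp only [argForm, pt, norm_e, Real.log_one, h1]
    have h2 : ((d * (2 * Real.pi) * Complex.I : ℂ)).im = d * (2 * Real.pi) := by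
      have : (d * (2 * Real.pi) : ℂ) = ((d * (2 * Real.pi) : ℝ) : ℂ) := by push_cast; ring
      rw [this, Complex.im_ofReal_mul, Complex.I_im, mul_one]
    rw [h2]
    have := Real.pi_ne_zero
    field_simp
    ring
  have hcont : ContinuousOn (fun s => d * -Real.log ‖𝔸.F i (𝔸.arg i s)‖) (Icc 0 1) :=
    continuousOn_const.mul ((𝔸.continuousOn_log_norm hstar i).comp
      (by unfold arg; fun_prop) fun s hs => 𝔸.arg_mem_Icc i hs)
  have hcongr : EqOn (fun s => d * -Real.log ‖𝔸.F i (𝔸.arg i s)‖)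
      (fun s => argForm (𝔸.path hstar hA i (projIcc 0 1 zero_le_one s)) (v s)) (uIcc 0 1) :=
    fun s hs => (hform s (by rwa [uIcc_of_le zero_le_one] at hs)).symm
  rw [increment_eq_integral _ v (fun s hs => ?_)
    ((hcont.congr hform).intervalIntegrable_of_Icc zero_le_one),
    ← intervalIntegral.integral_congr hcongr]
  · have h := intervalIntegral.smul_integral_comp_add_mul (a := 0) (b := 1)
      (fun α => -Real.log ‖𝔸.F i α‖) d (𝔸.lo i)
    rw [intervalIntegral.integral_const_mul]
    simp only [smul_eq_mul, mul_zero, mul_one, add_zero, hd, add_sub_cancel] at h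
    rw [← h]
    simp only [arg, ← hd, mul_comm d]
  · have harg : HasDerivAt (𝔸.arg i) d s := by
      have := ((hasDerivAt_id s).mul_const d).const_add (𝔸.lo i)
      rw [one_mul] at this
      exact this
    have h1 : HasDerivAt (fun s => e (𝔸.arg i s)) _ s :=
      (hasDerivAt_e (𝔸.arg i s)).scomp s harg
    have h2 : HasDerivAt (fun s => 𝔸.F i (𝔸.arg i s)) _ s :=
      (𝔸.differentiableAt i _ (𝔸.arg_mem_Ioo i hs)).hasDerivAt.scomp s harg
    refine (h1.prodMk h2).congr_of_eventuallyEq ?_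
    filter_upwards [Ioo_mem_nhds hs.1 hs.2] with t ht using hpath t (Ioo_subset_Icc_self ht)

end ArcFamily

end MahlerSymbol

theorem mainTheorem1 (P : MvPolynomial (Fin 2) ℂ) (hP : Irreducible P)
    (hstar : ∀ z : ℂ, ‖z‖ = 1 → MahlerSymbol.evalAt P (z, 0) ≠ 0)
    (hA : MahlerSymbol.arcSet P ⊆ MahlerSymbol.regLocus P) :
    MahlerSymbol.boundaryPts P ⊆ MahlerSymbol.torus ∧
    (∃! c : MahlerSymbol.RelCoH1 (MahlerSymbol.boundaryIn P)
        (MahlerSymbol.tate MahlerSymbol.realSubgroup 1),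
      MahlerSymbol.IsDeRhamClass (MahlerSymbol.boundaryIn P)
        (MahlerSymbol.tate MahlerSymbol.realSubgroup 1) MahlerSymbol.C2log c) ∧
    ∃ D : MahlerSymbol.ArcDecomposition P,
      ∀ c : MahlerSymbol.RelCoH1 (MahlerSymbol.boundaryIn P)
          (MahlerSymbol.tate MahlerSymbol.realSubgroup 1),
        MahlerSymbol.IsDeRhamClass (MahlerSymbol.boundaryIn P)
          (MahlerSymbol.tate MahlerSymbol.realSubgroup 1) MahlerSymbol.C2log c →
        ((MahlerSymbol.mahler P - MahlerSymbol.mahler (MahlerSymbol.pStar P) : ℝ) : ℂ) =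
          MahlerSymbol.kronecker (MahlerSymbol.boundaryIn P)
            (MahlerSymbol.tate MahlerSymbol.realSubgroup 1)
            (MahlerSymbol.tate MahlerSymbol.intSubgroup (-1)) c D.twistedCls := by
  obtain ⟨𝔸⟩ := MahlerSymbol.nonempty_arcFamily hP hstar
  have hR : (MahlerSymbol.boundaryIn P).Finite :=
    (𝔸.finite_boundaryPts hstar).preimage Subtype.val_injective.injOn
  obtain ⟨D, hD⟩ := 𝔸.exists_arcDecomposition hstar hA
  refine ⟨𝔸.boundaryPts_subset_torus hP hstar,
    ⟨_, MahlerSymbol.isDeRhamClass_formCochain hR,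
      fun c hc => MahlerSymbol.mk_formCochain_eq hR hc⟩,
    D, fun c hc => ?_⟩
  rw [MahlerSymbol.mk_formCochain_eq hR hc, MahlerSymbol.kronecker_twistedCls D hR,
    hD _ MahlerSymbol.isAdditive_increment, 𝔸.mahler_sub_mahler_pStar hstar]
  simp only [𝔸.increment_path hstar hA]
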